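/- Let $G=(V,E)$ be a finite simple graph with maximum degree $\Delta$ and $m=|E|$ edges, let $q\in\mathbb N$, and let $L$ assign to each edge $e\in E$ a list $L(e)\subseteq[q]$ of colors. For an edge $e$ let $\Delta(e)$ be the number of edges different from $e$ that share an endpoint with $e$. Let $0<\varepsilon\le\frac1{10}$ with $\frac{\ln^2\Delta}{\Delta}\le\frac{\varepsilon^3}{15}$, and suppose that $(G,L)$ is a $(\frac43+4\varepsilon)\Delta$-extra-color edge-list-coloring instance, that is, $$|L(e)|\ \ge\ \Big(\frac43+4\varepsilon\Big)\Delta+\Delta(e)\qquad\text{for every } e\in E .$$ A proper $L$-edge-list-coloring is a map $\sigma:E\to[q]$ with $\sigma(e)\in L(e)$ for all $e$ and $\sigma(e)\ne\sigma(f)$ whenever $e\neq f$ share an endpoint. Let $X$ be the pure $(m-1)$-dimensional simplicial complex of edge-color pairs whose facets are the sets $\{(e,\sigma(e)):e\in E\}$, for $\sigma$ a proper $L$-edge-list-coloring, and let $\pi_{m-1}$ be the uniform distribution on its facets. The co-dimension of a face $\tau$ (possibly empty) is $k=m-|\tau|$, the link of $\tau$ is $X_\tau=\{\sigma\setminus\tau:\sigma\in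 X,\ \sigma\supseteq\tau\}$, and for a face $\eta$ of $X_\tau$ with $i+1$ elements $$\pi_{\tau,i}(\eta)=\binom{k}{i+1}^{-1}\Pr_{\sigma\sim\pi_{m-1}}[\sigma\supseteq\eta\mid\sigma\supseteq\tau].$$ $X_\tau(0)$ denotes the set of vertices of $X_\tau$, and $X(0)$ that of $X$. For $k\ge2$ the local walk $P_\tau\in\mathbb R^{X(0)\times X(0)}$ has the entries $$P_\tau(x,y)=\frac{\pi_{\tau,1}(\{x,y\})}{2\,\pi_{\tau,0}(\{x\})}=\frac1{k-1}\Pr_{\sigma\sim\pi_{m-1}}[y\in\sigma\mid\sigma\supseteq\tau\cup\{x\}]$$ for distinct $x,y\in X_\tau(0)$ (where $\pi_{\tau,1}(\{x,y\})=0$ if $\{x,y\}\notin X_\tau$), and all its other entries are $0$. Its eigenvalues are real; $\lambda_2(P_\tau)$ is the second largest of them, counted with multiplicity. Then for every $2\le k\le m$ and every face $\tau\in X$ of co-dimension $k$, $$\lambda_2(P_\tau)\ \le\ \frac{\varepsilon+\frac1\varepsilon}{k-1}.$$ -/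

import Mathlib

/-- A pure simplicial complex of dimension `rank - 1`, given by its facets, together with a
probability distribution `weight` on the facets. (If there are no facets at all, then there is no
face, and no distribution.) -/
structure WeightedComplex (U : Type*) where
  /-- The common number of elements of the facets, one more than the dimension. -/
  rank : ℕ
  /-- The facets. -/
  facets : Finset (Finset U)
  card_of_mem_facets : ∀ σ ∈ facets, σ.card = rank
  /-- The distribution on the facets. -/
  weight : Finset U → ℝ
  weight_nonneg : ∀ σ ∈ facets, 0 ≤ weight σ
  sum_weight : facets.Nonempty → ∑ σ ∈ facets, weight σ = 1

namespace WeightedComplex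

variable {U : Type*} [DecidableEq U] (X : WeightedComplex U)

/-- The faces are the subsets of the facets (so the empty set is a face of a nonempty complex). -/
def IsFace (τ : Finset U) : Prop := ∃ σ ∈ X.facets, τ ⊆ σ

/-- The vertex set `X(0)`. -/
def vertices : Finset U := X.facets.biUnion id

/-- The co-dimension `(rank - 1) - (|τ| - 1)` of a face `τ`. -/
def codim (τ : Finset U) : ℕ := X.rank - τ.card

/-- The link `X_τ = {σ \ τ : σ a face, τ ⊆ σ}` of a face `τ`. -/
def link (τ : Finset U) : Set (Finset U) := {η | ∃ σ, X.IsFace σ ∧ τ ⊆ σ ∧ η = σ \ τ}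

/-- The probability that a random facet contains `τ`. -/
noncomputable def probContains (τ : Finset U) : ℝ := ∑ σ ∈ X.facets with τ ⊆ σ, X.weight σ

/-- The induced distribution `π_{τ,i}` on the `i`-dimensional faces of the link of `τ`, evaluated at
such a face `η` (so that `i + 1 = |η|`): the probability that a random facet contains `η`, given that
it contains `τ`, divided by `codim τ` choose `i + 1`. -/
noncomputable def linkDist (τ η : Finset U) : ℝ :=
  1 / ((X.codim τ).choose η.card : ℝ) * (X.probContains (η ∪ τ) / X.probContains τ)

open scoped Classical in
/-- The matrix `P_τ` of the local walk at `τ`, indexed by `X(0)`: for distinct vertices `x`, `y` of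
the link of `τ` its entry is `π_{τ,1}({x, y}) / (2 π_{τ,0}({x}))`, and all other entries are `0`. -/
noncomputable def localWalk (τ : Finset U) : Matrix X.vertices X.vertices ℝ := fun x y =>
  if x ≠ y ∧ {x.1} ∈ X.link τ ∧ {y.1} ∈ X.link τ then
    X.linkDist τ {x.1, y.1} / (2 * X.linkDist τ {x.1})
  else 0

end WeightedComplex

/-- The second largest eigenvalue, counted with multiplicity, of a real square matrix whose
eigenvalues are all real. -/
noncomputable def lambda2 {n : Type*} [Fintype n] [DecidableEq n] (A : Matrix n n ℝ) : ℝ :=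
  (A.charpoly.roots.sort (· ≥ ·)).getD 1 0

/-- All eigenvalues of a local walk are real, so that `lambda2` applies to it. -/
theorem WeightedComplex.card_roots_charpoly_localWalk {U : Type*} [DecidableEq U]
    (X : WeightedComplex U) (τ : Finset U) :
    (X.localWalk τ).charpoly.roots.card = X.vertices.card := by
  classical
  have hp : ∀ η, 0 ≤ X.probContains η := fun η =>
    Finset.sum_nonneg fun σ hσ => X.weight_nonneg σ (Finset.mem_filter.1 hσ).1
  set w : X.vertices → ℝ := fun x => Real.sqrt (1 / (2 * X.linkDist τ {x.1})) with hw
  have hd : ∀ x : X.vertices, w x * w x = 1 / (2 * X.linkDist τ {x.1}) := fun x => by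
    refine Real.mul_self_sqrt ?_
    have : 0 ≤ X.linkDist τ {x.1} :=
      mul_nonneg (by positivity) (div_nonneg (hp _) (hp _))
    positivity
  set S : Matrix X.vertices X.vertices ℝ := fun x y =>
    if x ≠ y ∧ {x.1} ∈ X.link τ ∧ {y.1} ∈ X.link τ then X.linkDist τ {x.1, y.1} else 0 with hS
  have hP : X.localWalk τ = Matrix.diagonal w * (Matrix.diagonal w * S) := by
    ext x y
    rw [Matrix.diagonal_mul, Matrix.diagonal_mul, ← mul_assoc, hd]
    simp only [WeightedComplex.localWalk, hS]
    split_ifs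
    · ring
    · simp
  have hH : (Matrix.diagonal w * S * Matrix.diagonal w).IsHermitian := by
    ext x y
    have hxy : S y x = S x y := by
      simp only [hS]
      rw [Finset.pair_comm y.1 x.1]
      by_cases h : x ≠ y ∧ {x.1} ∈ X.link τ ∧ {y.1} ∈ X.link τ
      · rw [if_pos h, if_pos ⟨h.1.symm, h.2.2, h.2.1⟩]
      · rw [if_neg h, if_neg fun h' => h ⟨h'.1.symm, h'.2.2, h'.2.1⟩]
    rw [Matrix.conjTranspose_apply, Matrix.mul_diagonal, Matrix.mul_diagonal, Matrix.diagonal_mul,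
      Matrix.diagonal_mul, star_trivial, hxy]
    ring
  rw [hP, Matrix.charpoly_mul_comm, hH.roots_charpoly_eq_eigenvalues, Multiset.card_map]
  exact Finset.card_attach

/-! ### Edge-list-colorings -/

section EdgeListColoring

variable {V : Type*} [Fintype V] [DecidableEq V] (G : SimpleGraph V) [DecidableRel G.Adj] {q : ℕ}

/-- An edge-list-coloring instance is a graph `G` with a list `L e ⊆ [q]` for each edge `e`. It is a
`β`-extra-color instance if `|L e| ≥ β + Δ(e)` for each edge `e`, where `Δ(e)` is the number of
other edges that share an endpoint with `e`, that is, the degree of `e` in the line graph. -/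
def IsExtraColor (L : G.edgeSet → Finset (Fin q)) (β : ℝ) : Prop :=
  ∀ e : G.edgeSet, β + ((G.lineGraph.neighborSet e).ncard : ℝ) ≤ ((L e).card : ℝ)

/-- `c` is a proper `L`-edge-list-coloring. -/
def IsProperListColoring (L : G.edgeSet → Finset (Fin q)) (c : G.edgeSet → Fin q) : Prop :=
  (∀ e, c e ∈ L e) ∧ ∀ e f, G.lineGraph.Adj e f → c e ≠ c f

/-- A coloring as a set of edge-color pairs. -/
def coloringFacet (c : G.edgeSet → Fin q) : Finset (G.edgeSet × Fin q) :=
  Finset.univ.image fun e => (e, c e)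

open scoped Classical in
/-- The edge-color sets of the proper `L`-edge-list-colorings. -/
noncomputable def coloringFacets (L : G.edgeSet → Finset (Fin q)) :
    Finset (Finset (G.edgeSet × Fin q)) :=
  ({c | IsProperListColoring G L c} : Finset (G.edgeSet → Fin q)).image (coloringFacet G)

/-- The weighted simplicial complex of an edge-list-coloring instance `(G, L)`: its facets are the
proper `L`-edge-list-colorings, with the uniform distribution. -/
noncomputable def coloringComplex (L : G.edgeSet → Finset (Fin q)) :
    WeightedComplex (G.edgeSet × Fin q) where
  rank := Fintype.card G.edgeSet
  facets := coloringFacets G L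
  card_of_mem_facets := by
    intro σ hσ
    obtain ⟨c, -, rfl⟩ := Finset.mem_image.1 hσ
    exact Finset.card_image_of_injective _ fun e f h => (Prod.mk.inj h).1
  weight := fun _ => 1 / ((coloringFacets G L).card : ℝ)
  weight_nonneg := fun _ _ => by positivity
  sum_weight := by
    intro h
    have : ((coloringFacets G L).card : ℝ) ≠ 0 := by exact_mod_cast h.card_ne_zero
    simp [this]

end EdgeListColoring

/-!
The eigenvalue bound is a spectral gap in disguise. The local walk at a face `τ` is, up to the factor
`1 / (k - 1)` and a symmetrization, the off-diagonal part of the matrix of pair probabilities of the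
indicators `[σ e = c]`, where `σ` is a random coloring in which only the set `U` of the `k` edges left
uncolored by `τ` is resampled. On the hyperplane of those `v` for which the statistic
`lin v σ = ∑ e, v (e, σ e)` has mean zero, the full matrix of pair probabilities is the quadratic form
`Var (lin v)`, and its diagonal is `∑ e ∈ U, 𝔼 v (e, σ e) ^ 2`. A bound
`Var (lin v) ≤ (1 + 1 / ε) ∑ e ∈ U, 𝔼 v (e, σ e) ^ 2` therefore bounds the second eigenvalue by
`1 / (ε (k - 1))` (`lambda2_le_of_var_lin_le`, `localWalk_apply`).

The variance bound (`var_lin_edgeColorings_le`) is a matrix trickle-down argument in probabilistic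
form, on the line graph `H` of `G`. With `Ω` the set of all proper colorings, one proves by induction
on `U`, for all boundary conditions at once,
`Var (lin v) ≤ ∑ e ∈ U, 𝔼 v (e, σ e) ^ 2 + potential v` (`Admissible.var_lin_le`). The potential is a
quadratic form: a diagonal part with coefficients `∑ f, w U e f` over the neighbors `f` of `e` in `U`,
minus `4 / 5` times the averaged defects, which measure color by color how adjacent edges compete.

* If `U` has a component with at most two edges, then that component is independent of the rest, and
  variance and potential are both additive (`Separated.var_lin_union`,
  `Admissible.potential_union`). For a single pair of adjacent edges the distribution is explicit, and
  the bound is checked by completing squares (`var_lin_pair_le`).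
* Otherwise, let `C` be the normalized covariance matrix and `N` the normalized matrix of the claimed
  bound. The law of total variance, summed over the choice of the edge whose color is revealed, and
  the induction hypothesis give `k C - C ^ 2 ≤ k N - N ^ 2` (`var_lin_le_of_sum_avg_var_le`), as soon
  as the square of the potential is at most the total decrease of its diagonal when a random edge is
  removed from `U`. Since an a priori bound keeps the spectrum of `C + N` below `k`
  (`var_lin_le_of_var_erase_le`), this implies `C ≤ N` (`quadForm_le_of_sub_sq_le`).

The averaged defects are at most `1 / β` times the marginals, so the condition on the square of the
potential becomes a deterministic inequality on the line graph (`IsLineGraph.sum_siteCoef_sq_le`). The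
two ends of an edge are treated separately. At one vertex with `s` uncolored edges the defects form a
matrix on a clique with entries in `[0, 1 / β]`, whose norm is controlled by comparison with the
constant matrix `1 / (2 β)`. The main part `γ s` of the pair weights then has to satisfy a discrete
Riccati inequality, which is solved by the reciprocal of an affine function of `s`; the constant
`4 / 3 + 4 ε` is what keeps that function at least `3 ε` up to `s = Δ` (`three_mul_le_sub`). A small
harmonic part of the weights makes the decrease positive for every pair that has at least one further
neighbor, and the hypothesis on `ln ^ 2 Δ / Δ` makes its contribution negligible (`goodWeights`).
-/

namespace ListColoring

set_option linter.unusedSectionVars false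

open Finset
open scoped BigOperators

/-! ### Conditional averages over a finite set of configurations -/

section Average

variable {E K : Type*} [Fintype E] [DecidableEq E] [DecidableEq K]

/-- The configurations in `Ω` that agree with `ω` outside `U`. -/
def fiber (Ω : Finset (E → K)) (U : Finset E) (ω : E → K) : Finset (E → K) :=
  {ω' ∈ Ω | ∀ e ∉ U, ω' e = ω e}

/-- The average of `φ` over the configurations in `Ω` that agree with `ω` outside `U`, that is, the
conditional expectation of `φ` when exactly the coordinates in `U` are resampled. -/
noncomputable def avg (Ω : Finset (E → K)) (U : Finset E) (ω : E → K) (φ : (E → K) → ℝ) : ℝ :=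
  𝔼 ω' ∈ fiber Ω U ω, φ ω'

/-- The conditional variance of `φ` when the coordinates in `U` are resampled. -/
noncomputable def var (Ω : Finset (E → K)) (U : Finset E) (ω : E → K) (φ : (E → K) → ℝ) : ℝ :=
  avg Ω U ω (fun ω' => φ ω' ^ 2) - avg Ω U ω φ ^ 2

variable {Ω : Finset (E → K)} {U U' : Finset E} {ω ω' : E → K} {φ ψ : (E → K) → ℝ}

theorem mem_fiber : ω' ∈ fiber Ω U ω ↔ ω' ∈ Ω ∧ ∀ e ∉ U, ω' e = ω e := by
  simp [fiber]

theorem self_mem_fiber (h : ω ∈ Ω) : ω ∈ fiber Ω U ω := mem_fiber.2 ⟨h, fun _ _ => rfl⟩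

theorem fiber_eq_of_mem (h : ω' ∈ fiber Ω U ω) : fiber Ω U ω' = fiber Ω U ω := by
  ext σ
  rw [mem_fiber] at h
  simp only [mem_fiber]
  refine and_congr_right fun _ => forall₂_congr fun e he => ?_
  rw [h.2 e he]

theorem fiber_mono (hU : U' ⊆ U) : fiber Ω U' ω ⊆ fiber Ω U ω := fun σ hσ => by
  rw [mem_fiber] at hσ ⊢
  exact ⟨hσ.1, fun e he => hσ.2 e fun h => he (hU h)⟩

theorem avg_congr (h : ∀ ω' ∈ fiber Ω U ω, φ ω' = ψ ω') : avg Ω U ω φ = avg Ω U ω ψ :=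
  expect_congr rfl h

theorem var_congr (h : ∀ ω' ∈ fiber Ω U ω, φ ω' = ψ ω') : var Ω U ω φ = var Ω U ω ψ := by
  rw [var, var, avg_congr h, avg_congr (φ := fun ω' => φ ω' ^ 2) (ψ := fun ω' => ψ ω' ^ 2)
    fun σ hσ => by rw [h σ hσ]]

theorem avg_add : avg Ω U ω (fun σ => φ σ + ψ σ) = avg Ω U ω φ + avg Ω U ω ψ :=
  expect_add_distrib ..

theorem avg_sub : avg Ω U ω (fun σ => φ σ - ψ σ) = avg Ω U ω φ - avg Ω U ω ψ :=
  expect_sub_distrib ..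

theorem avg_const_mul (c : ℝ) : avg Ω U ω (fun σ => c * φ σ) = c * avg Ω U ω φ :=
  (mul_expect ..).symm

theorem avg_mul_const (c : ℝ) : avg Ω U ω (fun σ => φ σ * c) = avg Ω U ω φ * c :=
  (expect_mul ..).symm

theorem avg_sum {ι : Type*} (s : Finset ι) (f : ι → (E → K) → ℝ) :
    avg Ω U ω (fun σ => ∑ i ∈ s, f i σ) = ∑ i ∈ s, avg Ω U ω (f i) :=
  expect_sum_comm ..

theorem avg_const (h : ω ∈ Ω) (c : ℝ) : avg Ω U ω (fun _ => c) = c :=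
  expect_const ⟨ω, self_mem_fiber h⟩ c

theorem avg_mono (h : ∀ ω' ∈ fiber Ω U ω, φ ω' ≤ ψ ω') : avg Ω U ω φ ≤ avg Ω U ω ψ :=
  expect_le_expect h

theorem avg_nonneg (h : ∀ ω' ∈ fiber Ω U ω, 0 ≤ φ ω') : 0 ≤ avg Ω U ω φ :=
  expect_nonneg h

theorem card_mul_avg : ((fiber Ω U ω).card : ℝ) * avg Ω U ω φ = ∑ σ ∈ fiber Ω U ω, φ σ :=
  card_mul_expect ..

theorem eq_zero_of_avg_sq_eq_zero (h : avg Ω U ω (fun σ => φ σ ^ 2) = 0)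
    (hω' : ω' ∈ fiber Ω U ω) : φ ω' = 0 := by
  have h1 : ∑ σ ∈ fiber Ω U ω, φ σ ^ 2 = 0 := by rw [← card_mul_avg, h, mul_zero]
  exact pow_eq_zero_iff two_ne_zero |>.1
    ((sum_eq_zero_iff_of_nonneg fun σ _ => sq_nonneg (φ σ)).1 h1 ω' hω')

/-- The tower property. -/
theorem avg_avg (hU : U' ⊆ U) : avg Ω U ω (fun σ => avg Ω U' σ φ) = avg Ω U ω φ := by
  simp only [avg, expect_eq_sum_div_card]
  congr 1
  have h1 : ∀ σ ∈ fiber Ω U ω, (∑ i ∈ fiber Ω U' σ, φ i) / ((fiber Ω U' σ).card : ℝ)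
      = ∑ i ∈ fiber Ω U ω, if i ∈ fiber Ω U' σ then φ i / ((fiber Ω U' i).card : ℝ) else 0 := by
    intro σ hσ
    rw [← sum_filter, sum_div]
    have : {i ∈ fiber Ω U ω | i ∈ fiber Ω U' σ} = fiber Ω U' σ := by
      ext i
      simp only [mem_filter, and_iff_right_iff_imp]
      intro hi
      rw [← fiber_eq_of_mem hσ]
      exact fiber_mono hU hi
    rw [this]
    exact sum_congr rfl fun i hi => by rw [fiber_eq_of_mem hi]
  rw [sum_congr rfl h1, sum_comm]
  refine sum_congr rfl fun i hi => ?_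
  have h2 : ∀ σ ∈ fiber Ω U ω, (i ∈ fiber Ω U' σ ↔ σ ∈ fiber Ω U' i) := by
    intro σ hσ
    rw [mem_fiber] at hσ hi
    simp only [mem_fiber, hσ.1, hi.1, true_and]
    exact ⟨fun h e he => (h e he).symm, fun h e he => (h e he).symm⟩
  have h3 : ∑ σ ∈ fiber Ω U ω, (if i ∈ fiber Ω U' σ then φ i / ((fiber Ω U' i).card : ℝ) else 0)
      = ∑ σ ∈ fiber Ω U' i, φ i / ((fiber Ω U' i).card : ℝ) := by
    rw [← sum_filter]
    refine sum_congr ?_ fun _ _ => rfl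
    ext σ
    simp only [mem_filter]
    constructor
    · rintro ⟨h, h'⟩
      exact (h2 σ h).1 h'
    · intro h
      have h' : σ ∈ fiber Ω U ω := by
        rw [← fiber_eq_of_mem hi]
        exact fiber_mono hU h
      exact ⟨h', (h2 σ h').2 h⟩
  rw [h3, sum_const, nsmul_eq_mul]
  have : ((fiber Ω U' i).card : ℝ) ≠ 0 := by
    have := card_pos.2 ⟨i, self_mem_fiber (U := U') (mem_fiber.1 hi).1⟩
    positivity
  field_simp

theorem var_eq_avg (h : ω ∈ Ω) :
    var Ω U ω φ = avg Ω U ω (fun σ => (φ σ - avg Ω U ω φ) ^ 2) := by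
  have : (fun σ => (φ σ - avg Ω U ω φ) ^ 2)
      = fun σ => φ σ ^ 2 - 2 * avg Ω U ω φ * φ σ + avg Ω U ω φ ^ 2 := by ext σ; ring
  rw [this, avg_add, avg_sub, avg_const_mul, avg_const h, var]
  ring

theorem var_add_const (h : ω ∈ Ω) (c : ℝ) : var Ω U ω (fun σ => φ σ + c) = var Ω U ω φ := by
  have h1 : avg Ω U ω (fun σ => φ σ + c) = avg Ω U ω φ + c := by rw [avg_add, avg_const h]
  rw [var_eq_avg h, var_eq_avg h, h1]
  congr 1
  ext σ
  ring

/-- The law of total variance. -/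
theorem var_eq_avg_var_add (hU : U' ⊆ U) :
    var Ω U ω φ = avg Ω U ω (fun σ => var Ω U' σ φ) + var Ω U ω (fun σ => avg Ω U' σ φ) := by
  simp only [var, avg_sub, avg_avg hU]
  ring

/-- Resampling the coordinates in `U` except `g` amounts to conditioning on the value at `g`. -/
theorem fiber_erase {g : E} (h : ω' ∈ fiber Ω U ω) :
    fiber Ω (U.erase g) ω' = {σ ∈ fiber Ω U ω | σ g = ω' g} := by
  ext σ
  rw [mem_fiber] at h
  simp only [mem_fiber, mem_filter, mem_erase, not_and]
  constructor
  · rintro ⟨h1, h2⟩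
    refine ⟨⟨h1, fun e he => ?_⟩, h2 g fun h => absurd rfl h⟩
    rw [← h.2 e he]
    exact h2 e fun _ => he
  · rintro ⟨⟨h1, h2⟩, h3⟩
    refine ⟨h1, fun e he => ?_⟩
    by_cases hge : e = g
    · rw [hge, h3]
    · rw [h2 e (he hge), h.2 e (he hge)]

end Average

/-! ### Comparison of weighted quadratic forms -/

section QuadraticForms

open Matrix

variable {ι : Type*} [Fintype ι] [DecidableEq ι]

/-- If the quadratic form of a symmetric matrix exceeds `κ` times the form of `diagonal d` at some
vector, then there is an eigenvector relative to `diagonal d`, supported where `d ≠ 0`, with an eigenvalue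
larger than `κ`. The weight `d` may vanish, provided that the rows of the matrix vanish there. -/
theorem exists_weighted_eigenvector {d : ι → ℝ} (hd : ∀ x, 0 ≤ d x) {S : Matrix ι ι ℝ}
    (hS : S.IsSymm) (hS0 : ∀ x y, d x = 0 → S x y = 0) {κ : ℝ} (hκ : 0 ≤ κ) {v : ι → ℝ}
    (hv : κ * ∑ x, d x * v x ^ 2 < v ⬝ᵥ S *ᵥ v) :
    ∃ μ > κ, ∃ u : ι → ℝ, (∀ x, d x = 0 → u x = 0) ∧ 0 < ∑ x, d x * u x ^ 2 ∧
      ∀ x, (S *ᵥ u) x = μ * (d x * u x) := by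
  have hS0' : ∀ x y, d y = 0 → S x y = 0 := fun x y h => by rw [← hS.apply, hS0 y x h]
  have hSv : ∀ (z : ι → ℝ) x, (S *ᵥ z) x = ∑ y, S x y * z y := fun _ _ => rfl
  have hSv0 : ∀ (z : ι → ℝ) x, d x = 0 → (S *ᵥ z) x = 0 := fun z x hx => by
    rw [hSv]
    exact sum_eq_zero fun y _ => by rw [hS0 x y hx, zero_mul]
  set r : ι → ℝ := fun x => (Real.sqrt (d x))⁻¹ with hr
  have hr0 : ∀ x, d x ≠ 0 → r x * Real.sqrt (d x) = 1 := fun x hx =>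
    inv_mul_cancel₀ (Real.sqrt_ne_zero'.2 (lt_of_le_of_ne (hd x) (Ne.symm hx)))
  have hsq : ∀ x, Real.sqrt (d x) * Real.sqrt (d x) = d x := fun x => Real.mul_self_sqrt (hd x)
  set M : Matrix ι ι ℝ := Matrix.of fun x y => r x * S x y * r y with hM
  have hMv : ∀ z x, (M *ᵥ z) x = r x * (S *ᵥ fun y => r y * z y) x := by
    intro z x
    simp only [mulVec, dotProduct, hM, of_apply, mul_sum]
    exact sum_congr rfl fun y _ => by ring
  have hMs : M.IsSymm := by
    ext x y
    simp only [hM, transpose_apply, of_apply, hS.apply x y]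
    ring
  have hT : (κ • (1 : Matrix ι ι ℝ) - M).IsHermitian := by
    rw [IsHermitian, conjTranspose_eq_transpose_of_trivial, transpose_sub, hMs.eq, transpose_smul,
      transpose_one]
  have hTv : ∀ z, (κ • (1 : Matrix ι ι ℝ) - M) *ᵥ z = κ • z - M *ᵥ z := fun z => by
    rw [sub_mulVec, smul_mulVec, one_mulVec]
  have hnot : ¬ (κ • (1 : Matrix ι ι ℝ) - M).PosSemidef := by
    intro h
    have h1 := h.dotProduct_mulVec_nonneg (fun x => Real.sqrt (d x) * v x)
    rw [hTv, star_trivial, dotProduct_sub, dotProduct_smul, smul_eq_mul] at h1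
    have h2 : (fun x => Real.sqrt (d x) * v x) ⬝ᵥ (fun x => Real.sqrt (d x) * v x)
        = ∑ x, d x * v x ^ 2 := by
      refine sum_congr rfl fun x _ => ?_
      linear_combination (v x) ^ 2 * hsq x
    have h3 : (fun x => Real.sqrt (d x) * v x) ⬝ᵥ M *ᵥ (fun x => Real.sqrt (d x) * v x)
        = v ⬝ᵥ S *ᵥ v := by
      have h4 : (S *ᵥ fun y => r y * (Real.sqrt (d y) * v y)) = S *ᵥ v := by
        ext x
        rw [hSv, hSv]
        refine sum_congr rfl fun y _ => ?_
        by_cases hy : d y = 0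
        · rw [hS0' x y hy, zero_mul, zero_mul]
        · linear_combination S x y * v y * hr0 y hy
      refine sum_congr rfl fun x _ => ?_
      rw [hMv, h4]
      by_cases hx : d x = 0
      · rw [hSv0 v x hx, mul_zero, mul_zero, mul_zero]
      · linear_combination v x * (S *ᵥ v) x * hr0 x hx
    rw [h2, h3] at h1
    linarith
  rw [hT.posSemidef_iff_eigenvalues_nonneg, Pi.le_def] at hnot
  push Not at hnot
  obtain ⟨i, hi⟩ := hnot
  rw [Pi.zero_apply] at hi
  set z : ι → ℝ := ⇑(hT.eigenvectorBasis i) with hz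
  set μ : ℝ := κ - hT.eigenvalues i with hμ
  have hzM : ∀ x, (M *ᵥ z) x = μ * z x := by
    intro x
    have h1 := congrFun (hT.mulVec_eigenvectorBasis i) x
    rw [← hz, hTv] at h1
    simp only [Pi.sub_apply, Pi.smul_apply, smul_eq_mul] at h1
    rw [hμ]
    linarith
  have hμ0 : 0 < μ := by linarith
  have hz0 : ∀ x, d x = 0 → z x = 0 := by
    intro x hx
    have h1 := hzM x
    have : r x = 0 := by simp [hr, hx]
    rw [hMv, this, zero_mul] at h1
    exact (mul_eq_zero.1 h1.symm).resolve_left hμ0.ne'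
  refine ⟨μ, by linarith, fun x => r x * z x, fun x hx => by simp [hz0 x hx], ?_, fun x => ?_⟩
  · have h1 : ∑ x, d x * (r x * z x) ^ 2 = ∑ x, z x ^ 2 := by
      refine sum_congr rfl fun x _ => ?_
      by_cases hx : d x = 0
      · simp [hz0 x hx]
      · have := hr0 x hx
        rw [← hsq x]
        linear_combination (z x) ^ 2 * (r x * Real.sqrt (d x) + 1) * this
    rw [h1]
    have h2 : hT.eigenvectorBasis i ≠ 0 := hT.eigenvectorBasis.orthonormal.ne_zero i
    obtain ⟨x, hx⟩ : ∃ x, z x ≠ 0 := by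
      by_contra hcon
      push Not at hcon
      exact h2 (PiLp.ext hcon)
    exact sum_pos' (fun _ _ => sq_nonneg _) ⟨x, mem_univ x, by positivity⟩
  · by_cases hx : d x = 0
    · rw [hx, zero_mul, mul_zero, hSv0 _ x hx]
    · have h1 := hzM x
      rw [hMv] at h1
      have h2 := hr0 x hx
      rw [← hsq x]
      linear_combination Real.sqrt (d x) * h1 - (S *ᵥ fun y => r y * z y) x * h2
        - Real.sqrt (d x) * μ * z x * h2

/-- A comparison principle for the solutions of `k C - C² ≤ k N - N²`: if moreover `C + N < k`, then
`C ≤ N`. All forms are relative to the weight `d`. -/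
theorem quadForm_le_of_sub_sq_le {d : ι → ℝ} (hd : ∀ x, 0 ≤ d x) {C N : Matrix ι ι ℝ}
    (hC : C.IsSymm) (hN : N.IsSymm) (hC0 : ∀ x y, d x = 0 → C x y = 0)
    (hN0 : ∀ x y, d x = 0 → N x y = 0) {k k' : ℝ} (hk : k' < k)
    (h : ∀ v, k * (v ⬝ᵥ C *ᵥ v) - ∑ x, (d x)⁻¹ * (C *ᵥ v) x ^ 2
      ≤ k * (v ⬝ᵥ N *ᵥ v) - ∑ x, (d x)⁻¹ * (N *ᵥ v) x ^ 2)
    (hs : ∀ v, v ⬝ᵥ C *ᵥ v + v ⬝ᵥ N *ᵥ v ≤ k' * ∑ x, d x * v x ^ 2) (v : ι → ℝ) :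
    v ⬝ᵥ C *ᵥ v ≤ v ⬝ᵥ N *ᵥ v := by
  by_contra! hv
  obtain ⟨μ, hμ, u, hu0, hupos, hu⟩ := exists_weighted_eigenvector (S := C - N) hd (hC.sub hN)
    (fun x y hx => by simp [hC0 x y hx, hN0 x y hx]) le_rfl (v := v) (by
      rw [sub_mulVec, dotProduct_sub]
      linarith)
  set n := ∑ x, d x * u x ^ 2 with hn
  have hCu : ∀ x, (C *ᵥ u) x = (N *ᵥ u) x + μ * (d x * u x) := by
    intro x
    have := hu x
    rw [sub_mulVec, Pi.sub_apply] at this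
    linarith
  have h1 : u ⬝ᵥ C *ᵥ u = u ⬝ᵥ N *ᵥ u + μ * n := by
    simp only [dotProduct, hn, mul_sum, ← sum_add_distrib]
    refine sum_congr rfl fun x _ => ?_
    rw [hCu]
    ring
  have h2 : ∑ x, (d x)⁻¹ * (C *ᵥ u) x ^ 2
      = ∑ x, (d x)⁻¹ * (N *ᵥ u) x ^ 2 + 2 * μ * (u ⬝ᵥ N *ᵥ u) + μ ^ 2 * n := by
    simp only [dotProduct, hn, mul_sum, ← sum_add_distrib]
    refine sum_congr rfl fun x _ => ?_
    rw [hCu]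
    by_cases hx : d x = 0
    · simp [hx, hu0 x hx]
    · field_simp
      ring
  have h3 := h u
  have h4 := hs u
  rw [h2] at h3
  rw [h1] at h3 h4
  rw [← hn] at h4
  have h5 : μ * (k * n) ≤ μ * (2 * (u ⬝ᵥ N *ᵥ u) + μ * n) := by nlinarith
  have h6 := le_of_mul_le_mul_left h5 hμ
  nlinarith

end QuadraticForms

/-! ### Covariances of the indicators of site-color pairs -/

section Covariance

open Matrix

variable {E K : Type*} [Fintype E] [DecidableEq E] [Fintype K] [DecidableEq K]

/-- The statistic `∑ e, v (e, σ e)` of a configuration `σ`. -/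
def lin (v : E × K → ℝ) (σ : E → K) : ℝ := ∑ e, v (e, σ e)

/-- The indicator of the event that the site `x.1` has the color `x.2`. -/
def ind (x : E × K) (σ : E → K) : ℝ := if σ x.1 = x.2 then 1 else 0

/-- The marginal probability of the pair `x` when the coordinates in `U` are resampled. -/
noncomputable def marg (Ω : Finset (E → K)) (U : Finset E) (ω : E → K) (x : E × K) : ℝ :=
  avg Ω U ω (ind x)

/-- The marginal probability of the pair `x`, set to `0` when the site of `x` is not resampled. -/
noncomputable def wt (Ω : Finset (E → K)) (U : Finset E) (ω : E → K) (x : E × K) : ℝ :=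
  if x.1 ∈ U then marg Ω U ω x else 0

/-- The covariance matrix of the indicators `ind x` when the coordinates in `U` are resampled. -/
noncomputable def covMatrix (Ω : Finset (E → K)) (U : Finset E) (ω : E → K) :
    Matrix (E × K) (E × K) ℝ :=
  Matrix.of fun x y => avg Ω U ω (fun σ => ind x σ * ind y σ) - marg Ω U ω x * marg Ω U ω y

variable {Ω : Finset (E → K)} {U : Finset E} {ω : E → K}

theorem sum_mul_ind (f : E × K → ℝ) (e : E) (σ : E → K) :
    ∑ c, f (e, c) * ind (e, c) σ = f (e, σ e) := by
  simp [ind]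

theorem lin_eq_sum_ind (v : E × K → ℝ) (σ : E → K) : lin v σ = ∑ x, v x * ind x σ := by
  rw [Fintype.sum_prod_type]
  exact sum_congr rfl fun e _ => (sum_mul_ind v e σ).symm

theorem avg_coord (f : E × K → ℝ) (e : E) :
    avg Ω U ω (fun σ => f (e, σ e)) = ∑ c, marg Ω U ω (e, c) * f (e, c) := by
  have : (fun σ : E → K => f (e, σ e)) = fun σ => ∑ c, f (e, c) * ind (e, c) σ := by
    ext σ
    rw [sum_mul_ind]
  rw [this, avg_sum]
  exact sum_congr rfl fun c _ => by rw [avg_const_mul, marg, mul_comm]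

theorem marg_nonneg (x : E × K) : 0 ≤ marg Ω U ω x :=
  avg_nonneg fun σ _ => by rw [ind]; split_ifs <;> norm_num

theorem wt_nonneg (x : E × K) : 0 ≤ wt Ω U ω x := by
  rw [wt]
  split_ifs
  exacts [marg_nonneg x, le_rfl]

theorem marg_eq_card_div (x : E × K) : marg Ω U ω x
    = ({σ ∈ fiber Ω U ω | σ x.1 = x.2}.card : ℝ) / ((fiber Ω U ω).card : ℝ) := by
  rw [marg, avg, expect_eq_sum_div_card]
  simp [ind]

theorem marg_pos {σ : E → K} (hσ : σ ∈ fiber Ω U ω) (e : E) : 0 < marg Ω U ω (e, σ e) := by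
  rw [marg_eq_card_div]
  have h1 : 0 < {τ ∈ fiber Ω U ω | τ e = σ e}.card :=
    card_pos.2 ⟨σ, mem_filter.2 ⟨hσ, rfl⟩⟩
  have h2 : 0 < (fiber Ω U ω).card := card_pos.2 ⟨σ, hσ⟩
  positivity

theorem ind_eq_zero_of_marg_eq_zero {x : E × K} (h : marg Ω U ω x = 0) {σ : E → K}
    (hσ : σ ∈ fiber Ω U ω) : ind x σ = 0 := by
  rw [ind, if_neg]
  intro hx
  have := marg_pos hσ x.1
  rw [hx] at this
  exact this.ne' h

theorem sum_wt_mul (f : E × K → ℝ) :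
    ∑ x, wt Ω U ω x * f x = ∑ e ∈ U, avg Ω U ω (fun σ => f (e, σ e)) := by
  rw [Fintype.sum_prod_type, ← sum_subset (subset_univ U)]
  · refine sum_congr rfl fun e he => ?_
    rw [avg_coord]
    exact sum_congr rfl fun c _ => by rw [wt, if_pos he]
  · intro e _ he
    exact sum_eq_zero fun c _ => by rw [wt, if_neg he, zero_mul]

theorem covMatrix_isSymm : (covMatrix Ω U ω).IsSymm := by
  ext x y
  simp only [covMatrix, transpose_apply, of_apply, mul_comm]

theorem covMatrix_mulVec (v : E × K → ℝ) (x : E × K) : (covMatrix Ω U ω *ᵥ v) x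
    = avg Ω U ω (fun σ => ind x σ * lin v σ) - marg Ω U ω x * avg Ω U ω (lin v) := by
  have h1 : (fun σ => ind x σ * lin v σ) = fun σ => ∑ y, v y * (ind x σ * ind y σ) := by
    ext σ
    rw [lin_eq_sum_ind, mul_sum]
    exact sum_congr rfl fun y _ => by ring
  have h2 : lin v = fun σ => ∑ y, v y * ind y σ := funext fun σ => lin_eq_sum_ind v σ
  have h3 : (covMatrix Ω U ω *ᵥ v) x = ∑ y, covMatrix Ω U ω x y * v y := rfl
  rw [h1, h2, h3, avg_sum, avg_sum, mul_sum, ← sum_sub_distrib]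
  refine sum_congr rfl fun y _ => ?_
  rw [avg_const_mul, avg_const_mul, covMatrix, of_apply, ← marg]
  ring

theorem dotProduct_covMatrix_mulVec (v : E × K → ℝ) :
    v ⬝ᵥ covMatrix Ω U ω *ᵥ v = var Ω U ω (lin v) := by
  have h1 : (fun σ => lin v σ ^ 2) = fun σ => ∑ x, v x * (ind x σ * lin v σ) := by
    ext σ
    rw [sq]
    nth_rewrite 1 [lin_eq_sum_ind]
    rw [sum_mul]
    exact sum_congr rfl fun y _ => by ring
  have h2 : avg Ω U ω (lin v) = ∑ x, v x * marg Ω U ω x := by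
    have h2 : lin v = fun σ => ∑ y, v y * ind y σ := funext fun σ => lin_eq_sum_ind v σ
    rw [h2, avg_sum]
    exact sum_congr rfl fun x _ => by rw [avg_const_mul, marg]
  rw [var, h1, avg_sum, sq]
  nth_rewrite 1 [h2]
  rw [sum_mul, ← sum_sub_distrib]
  refine sum_congr rfl fun x _ => ?_
  rw [covMatrix_mulVec, avg_const_mul]
  ring

theorem covMatrix_eq_zero (hω : ω ∈ Ω) {x : E × K} (h : wt Ω U ω x = 0) (y : E × K) :
    covMatrix Ω U ω x y = 0 := by
  rw [covMatrix, of_apply]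
  by_cases hx : x.1 ∈ U
  · rw [wt, if_pos hx] at h
    rw [h, zero_mul, sub_zero, ← avg_const hω 0]
    exact avg_congr fun σ hσ => by rw [ind_eq_zero_of_marg_eq_zero h hσ, zero_mul]
  · have h1 : ∀ σ ∈ fiber Ω U ω, ind x σ = ind x ω := fun σ hσ => by
      rw [ind, ind, (mem_fiber.1 hσ).2 _ hx]
    have h2 : marg Ω U ω x = ind x ω := by
      rw [marg, avg_congr h1, avg_const hω]
    rw [avg_congr fun σ hσ => by rw [h1 σ hσ], avg_const_mul, h2, marg, sub_self]

/-- Conditioning on the color of `g`. -/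
theorem avg_erase_eq {g : E} {σ : E → K} (hσ : σ ∈ fiber Ω U ω) (φ : (E → K) → ℝ) :
    avg Ω (U.erase g) σ φ
      = (marg Ω U ω (g, σ g))⁻¹ * avg Ω U ω (fun τ => ind (g, σ g) τ * φ τ) := by
  have h1 : ((fiber Ω U ω).card : ℝ) ≠ 0 := by
    have := card_pos.2 ⟨σ, hσ⟩
    positivity
  have h2 : ({τ ∈ fiber Ω U ω | τ g = σ g}.card : ℝ) ≠ 0 := by
    have : 0 < {τ ∈ fiber Ω U ω | τ g = σ g}.card := card_pos.2 ⟨σ, mem_filter.2 ⟨hσ, rfl⟩⟩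
    positivity
  rw [marg_eq_card_div, avg, avg, fiber_erase hσ, expect_eq_sum_div_card, expect_eq_sum_div_card]
  have h3 : ∑ τ ∈ fiber Ω U ω, ind (g, σ g) τ * φ τ = ∑ τ ∈ fiber Ω U ω with τ g = σ g, φ τ := by
    rw [sum_filter]
    exact sum_congr rfl fun τ _ => by simp [ind]
  rw [h3]
  field_simp

/-- The squared norm of a row combination of the covariance matrix is the total variance of the
conditional expectations given one site. -/
theorem sum_inv_wt_mul_covMatrix_sq (hω : ω ∈ Ω) (v : E × K → ℝ) :
    ∑ x, (wt Ω U ω x)⁻¹ * (covMatrix Ω U ω *ᵥ v) x ^ 2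
      = ∑ g ∈ U, var Ω U ω (fun σ => avg Ω (U.erase g) σ (lin v)) := by
  set m := avg Ω U ω (lin v) with hm
  have h1 : ∀ x, (wt Ω U ω x)⁻¹ * (covMatrix Ω U ω *ᵥ v) x ^ 2 = wt Ω U ω x *
      ((marg Ω U ω x)⁻¹ * avg Ω U ω (fun τ => ind x τ * lin v τ) - m) ^ 2 := by
    intro x
    by_cases hx : wt Ω U ω x = 0
    · simp [hx]
    · have hxU : wt Ω U ω x = marg Ω U ω x := by
        rw [wt, if_pos]
        by_contra h
        exact hx (by rw [wt, if_neg h])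
      rw [hxU] at hx ⊢
      rw [covMatrix_mulVec, ← hm]
      field_simp
  rw [sum_congr rfl fun x _ => h1 x, sum_wt_mul (f := fun x =>
    ((marg Ω U ω x)⁻¹ * avg Ω U ω (fun τ => ind x τ * lin v τ) - m) ^ 2)]
  refine sum_congr rfl fun g _ => ?_
  rw [var_eq_avg hω, avg_avg (erase_subset g U)]
  exact avg_congr fun σ hσ => by rw [avg_erase_eq hσ]

/-- One step of the trickle-down argument. -/
theorem var_lin_le_of_sum_avg_var_le (hω : ω ∈ Ω) {N : Matrix (E × K) (E × K) ℝ} (hN : N.IsSymm)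
    (hN0 : ∀ x y, wt Ω U ω x = 0 → N x y = 0)
    (h : ∀ v, ∑ g ∈ U, avg Ω U ω (fun σ => var Ω (U.erase g) σ (lin v))
      ≤ (U.card : ℝ) * (v ⬝ᵥ N *ᵥ v) - ∑ x, (wt Ω U ω x)⁻¹ * (N *ᵥ v) x ^ 2)
    {k' : ℝ} (hk : k' < U.card)
    (hs : ∀ v, var Ω U ω (lin v) + v ⬝ᵥ N *ᵥ v ≤ k' * ∑ x, wt Ω U ω x * v x ^ 2)
    (v : E × K → ℝ) : var Ω U ω (lin v) ≤ v ⬝ᵥ N *ᵥ v := by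
  rw [← dotProduct_covMatrix_mulVec]
  refine quadForm_le_of_sub_sq_le (fun x => wt_nonneg x) covMatrix_isSymm hN
    (fun x y hx => covMatrix_eq_zero hω hx y) hN0 hk (fun v => ?_) (fun v => ?_) v
  · rw [sum_inv_wt_mul_covMatrix_sq hω, dotProduct_covMatrix_mulVec]
    refine le_trans (le_of_eq ?_) (h v)
    rw [sub_eq_iff_eq_add, ← sum_add_distrib, ← nsmul_eq_mul, ← sum_const]
    exact sum_congr rfl fun g _ => var_eq_avg_var_add (erase_subset g U)
  · rw [dotProduct_covMatrix_mulVec]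
    exact hs v

/-- A bound for the variance of `lin v` by second moments self-improves to a bound by variances,
because shifting `v` at one site changes `lin v` only by a constant. -/
theorem var_lin_le_sum_var (hω : ω ∈ Ω) {M : ℝ}
    (h : ∀ v : E × K → ℝ,
      var Ω U ω (lin v) ≤ M * ∑ e ∈ U, avg Ω U ω (fun σ => v (e, σ e) ^ 2)) (v : E × K → ℝ) :
    var Ω U ω (lin v) ≤ M * ∑ e ∈ U, var Ω U ω (fun σ => v (e, σ e)) := by
  have h1 := h fun x => v x - avg Ω U ω (fun σ => v (x.1, σ x.1))
  have h2 : lin (fun x => v x - avg Ω U ω (fun σ => v (x.1, σ x.1)))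
      = fun σ => lin v σ + (- ∑ e, avg Ω U ω (fun σ => v (e, σ e))) := by
    ext σ
    rw [lin, lin, sum_sub_distrib, sub_eq_add_neg]
  rw [h2, var_add_const hω] at h1
  refine h1.trans (le_of_eq ?_)
  congr 1
  exact sum_congr rfl fun e _ => (var_eq_avg hω).symm

end Covariance

/-! ### A priori bound for the covariance matrix -/

section APriori

open Matrix

variable {E K : Type*} [Fintype E] [DecidableEq E] [Fintype K] [DecidableEq K]
  {Ω : Finset (E → K)} {U : Finset E} {ω : E → K}

/-- Two configurations in the class of `ω` can be replaced, without changing their colors at `f`, by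
two configurations that have the same color at `e`. This is the form of connectedness of the
configuration space that excludes the largest conceivable eigenvalue `|U|` of the covariance
matrix. -/
def Linked (Ω : Finset (E → K)) (U : Finset E) (ω : E → K) : Prop :=
  ∀ e ∈ U, ∀ f ∈ U, e ≠ f → ∀ σ₁ ∈ fiber Ω U ω, ∀ σ₂ ∈ fiber Ω U ω,
    ∃ τ₁ ∈ fiber Ω U ω, ∃ τ₂ ∈ fiber Ω U ω, τ₁ f = σ₁ f ∧ τ₂ f = σ₂ f ∧ τ₁ e = τ₂ e

/-- If `|U|` copies of every summand `u (e, σ e)` agree with their sum, then the summands do not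
depend on `σ`. -/
theorem Linked.eq_of_forall_eq (h : Linked Ω U ω) (hU : 2 ≤ U.card) {y : E × K → ℝ}
    {S : (E → K) → ℝ} {k : ℝ} (hk : k ≠ 0)
    (hy : ∀ e ∈ U, ∀ σ ∈ fiber Ω U ω, k * y (e, σ e) = S σ) {f : E} (hf : f ∈ U) {σ₁ σ₂ : E → K}
    (h₁ : σ₁ ∈ fiber Ω U ω) (h₂ : σ₂ ∈ fiber Ω U ω) : y (f, σ₁ f) = y (f, σ₂ f) := by
  obtain ⟨e, he, hef⟩ : ∃ e ∈ U, e ≠ f := exists_mem_ne (by omega) f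
  obtain ⟨τ₁, ht₁, τ₂, ht₂, h1, h2, h3⟩ := h e he f hf hef σ₁ h₁ σ₂ h₂
  have key : ∀ τ ∈ fiber Ω U ω, y (f, τ f) = y (e, τ e) := fun τ hτ =>
    mul_left_cancel₀ hk ((hy f hf τ hτ).trans (hy e he τ hτ).symm)
  rw [← h1, ← h2, key τ₁ ht₁, key τ₂ ht₂, h3]

/-- If the variances one level down are at most `1 + m` times the second moments, then the
covariance matrix has no eigenvalue above `(1 + m) (k - 2) / (k - 2 - m)`, where `k = |U|`. -/
theorem var_lin_le_of_var_erase_le (hω : ω ∈ Ω) (hU : 3 ≤ U.card) (hlink : Linked Ω U ω)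
    {m κ : ℝ} (hm : 0 ≤ m) (hκ : 0 ≤ κ) (hmk : m < (U.card : ℝ) - 2)
    (hκm : (1 + m) * ((U.card : ℝ) - 2) ≤ κ * ((U.card : ℝ) - 2 - m))
    (h : ∀ g ∈ U, ∀ σ ∈ fiber Ω U ω, ∀ v : E × K → ℝ, var Ω (U.erase g) σ (lin v)
      ≤ (1 + m) * ∑ e ∈ U.erase g, avg Ω (U.erase g) σ (fun τ => v (e, τ e) ^ 2))
    (v : E × K → ℝ) : var Ω U ω (lin v) ≤ κ * ∑ x, wt Ω U ω x * v x ^ 2 := by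
  by_contra! hv
  rw [← dotProduct_covMatrix_mulVec] at hv
  obtain ⟨μ, hμ, u, hu0, hn, hu⟩ := exists_weighted_eigenvector (fun x => wt_nonneg x)
    covMatrix_isSymm (fun x y hx => covMatrix_eq_zero hω hx y) hκ hv
  have hμ0 : 0 < μ := by linarith
  set k : ℝ := (U.card : ℝ) with hk
  have hk3 : 3 ≤ k := by rw [hk]; exact_mod_cast hU
  set n := ∑ x, wt Ω U ω x * u x ^ 2 with hn_def
  have hn' : n = ∑ e ∈ U, avg Ω U ω (fun σ => u (e, σ e) ^ 2) := by
    rw [hn_def, sum_wt_mul (fun x => u x ^ 2)]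
  have hSu : ∀ σ : E → K, lin u σ = ∑ e ∈ U, u (e, σ e) := fun σ => by
    exact (sum_subset (subset_univ U) fun e _ he =>
      hu0 (e, σ e) (by rw [wt, if_neg he])).symm
  have hmean : ∀ e ∈ U, avg Ω U ω (fun σ => u (e, σ e)) = 0 := by
    intro e he
    have h1 : μ * avg Ω U ω (fun σ => u (e, σ e)) = ∑ c, (covMatrix Ω U ω *ᵥ u) (e, c) := by
      rw [avg_coord, mul_sum]
      exact sum_congr rfl fun c _ => by rw [hu, wt, if_pos he]
    have h2 : ∑ c, (covMatrix Ω U ω *ᵥ u) (e, c) = 0 := by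
      have h3 : ∀ σ : E → K, ∑ c, ind (e, c) σ = (1 : ℝ) := fun σ => by
        simp [ind]
      simp only [covMatrix_mulVec, sum_sub_distrib, ← avg_sum, ← sum_mul, marg, h3, one_mul]
      rw [avg_const hω, one_mul, sub_self]
    rw [h2] at h1
    exact (mul_eq_zero.1 h1).resolve_left hμ0.ne'
  have hmeanS : avg Ω U ω (lin u) = 0 := by
    rw [funext hSu, avg_sum]
    exact sum_eq_zero hmean
  have hcond : ∀ g ∈ U, ∀ σ ∈ fiber Ω U ω, avg Ω (U.erase g) σ (lin u) = μ * u (g, σ g) := by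
    intro g hg σ hσ
    have h1 := hu (g, σ g)
    rw [covMatrix_mulVec, hmeanS, mul_zero, sub_zero, wt, if_pos hg] at h1
    rw [avg_erase_eq hσ, h1]
    have := (marg_pos hσ g).ne'
    field_simp
  have hvarS : var Ω U ω (lin u) = μ * n := by
    rw [← dotProduct_covMatrix_mulVec, hn_def, mul_sum]
    refine sum_congr rfl fun x _ => ?_
    rw [hu]
    ring
  have hS2 : avg Ω U ω (fun σ => lin u σ ^ 2) = μ * n := by
    rw [← hvarS, var, hmeanS]
    ring
  have htotal : ∀ g ∈ U, var Ω U ω (lin u) = avg Ω U ω (fun σ => var Ω (U.erase g) σ (lin u))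
      + μ ^ 2 * avg Ω U ω (fun σ => u (g, σ g) ^ 2) := by
    intro g hg
    rw [var_eq_avg_var_add (erase_subset g U), var_congr (hcond g hg)]
    congr 1
    rw [var, avg_const_mul, hmean g hg, ← avg_const_mul]
    simp only [mul_zero, ne_eq, OfNat.ofNat_ne_zero, not_false_eq_true, zero_pow, sub_zero, mul_pow]
  -- the Cauchy-Schwarz inequality bounds the explained part of the variances from below
  have hlevel : ∀ g ∈ U, avg Ω U ω (fun σ => var Ω (U.erase g) σ (lin u)) ≤ (1 + m) *
      (n - avg Ω U ω (fun σ => u (g, σ g) ^ 2)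
        - (μ - 1) ^ 2 / (k - 1) * avg Ω U ω (fun σ => u (g, σ g) ^ 2)) := by
    intro g hg
    have h1 : ∀ σ ∈ fiber Ω U ω, var Ω (U.erase g) σ (lin u) ≤ (1 + m) *
        ((∑ e ∈ U.erase g, avg Ω (U.erase g) σ (fun τ => u (e, τ e) ^ 2))
          - (μ - 1) ^ 2 / (k - 1) * u (g, σ g) ^ 2) := by
      intro σ hσ
      have hσΩ : σ ∈ Ω := (mem_fiber.1 hσ).1
      refine (var_lin_le_sum_var hσΩ (h g hg σ hσ) u).trans ?_
      refine mul_le_mul_of_nonneg_left ?_ (by linarith)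
      simp only [var, sum_sub_distrib]
      refine sub_le_sub_left ?_ _
      have h2 : ∑ e ∈ U.erase g, avg Ω (U.erase g) σ (fun τ => u (e, τ e))
          = (μ - 1) * u (g, σ g) := by
        have h3 := hcond g hg σ hσ
        rw [funext hSu, avg_sum, ← add_sum_erase _ _ hg] at h3
        have h4 : avg Ω (U.erase g) σ (fun τ => u (g, τ g)) = u (g, σ g) := by
          rw [← avg_const hσΩ (u (g, σ g)) (U := U.erase g)]
          exact avg_congr fun τ hτ => by rw [(mem_fiber.1 hτ).2 g (notMem_erase g U)]
        rw [h4] at h3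
        linarith
      have h5 := sq_sum_le_card_mul_sum_sq (s := U.erase g)
        (f := fun e => avg Ω (U.erase g) σ (fun τ => u (e, τ e)))
      rw [h2, card_erase_of_mem hg, Nat.cast_sub (by omega), Nat.cast_one, ← hk] at h5
      rw [div_mul_eq_mul_div, div_le_iff₀ (by linarith)]
      linarith
    refine (avg_mono h1).trans (le_of_eq ?_)
    rw [avg_const_mul, avg_sub, avg_sum, avg_const_mul]
    congr 2
    rw [hn', ← add_sum_erase _ _ hg, add_sub_cancel_left]
    exact sum_congr rfl fun e _ => avg_avg (erase_subset g U)
  have hsum : k * (μ * n) ≤ (1 + m) * (k * n - n - (μ - 1) ^ 2 / (k - 1) * n) + μ ^ 2 * n := by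
    have h1 : ∑ g ∈ U, var Ω U ω (lin u) ≤ ∑ g ∈ U, ((1 + m) *
      (n - avg Ω U ω (fun σ => u (g, σ g) ^ 2)
        - (μ - 1) ^ 2 / (k - 1) * avg Ω U ω (fun σ => u (g, σ g) ^ 2))
        + μ ^ 2 * avg Ω U ω (fun σ => u (g, σ g) ^ 2)) :=
      sum_le_sum fun g hg => by
        have := htotal g hg
        have := hlevel g hg
        linarith
    simp only [sum_add_distrib, ← mul_sum, sum_sub_distrib, sum_const, nsmul_eq_mul, ← hk, hvarS,
      ← hn'] at h1
    linarith
  have hk1 : (μ - 1) ^ 2 / (k - 1) * (k - 1) = (μ - 1) ^ 2 :=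
    div_mul_cancel₀ _ (by linarith)
  have hpoly : (k * μ - μ ^ 2) * (k - 1) ≤ (1 + m) * ((k - 1) ^ 2 - (μ - 1) ^ 2) := by
    have h1 : n * (k * μ - μ ^ 2) ≤ n * ((1 + m) * (k - 1 - (μ - 1) ^ 2 / (k - 1))) := by
      linarith
    have h2 := mul_le_mul_of_nonneg_right (le_of_mul_le_mul_left h1 hn) (by linarith : 0 ≤ k - 1)
    refine h2.trans (le_of_eq ?_)
    linear_combination -(1 + m) * hk1
  rcases lt_or_ge μ k with hlt | hge
  · have h1 : (k - μ) * (μ * (k - 1)) ≤ (k - μ) * ((1 + m) * (k - 2 + μ)) := by linarith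
    have h2 := le_of_mul_le_mul_left h1 (by linarith)
    have h3 : μ * (k - 2 - m) ≤ κ * (k - 2 - m) := by linarith
    have h4 := le_of_mul_le_mul_right h3 (by linarith)
    linarith
  · -- now the Cauchy-Schwarz inequality for `lin u` is an equality
    have h1 : ∑ e ∈ U, avg Ω U ω (fun σ => (k * u (e, σ e) - lin u σ) ^ 2) ≤ 0 := by
      have h2 : ∑ e ∈ U, avg Ω U ω (fun σ => (k * u (e, σ e) - lin u σ) ^ 2)
          = k ^ 2 * n - k * (μ * n) := by
        rw [← avg_sum, ← hS2, hn', mul_sum, ← avg_const_mul]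
        simp only [← avg_const_mul]
        rw [← avg_sum, ← avg_sub]
        congr 1
        ext σ
        have h3 : ∀ e, (k * u (e, σ e) - lin u σ) ^ 2
            = k ^ 2 * u (e, σ e) ^ 2 - 2 * k * lin u σ * u (e, σ e) + lin u σ ^ 2 :=
          fun e => by ring
        simp only [h3, sum_add_distrib, sum_sub_distrib, ← mul_sum, ← hSu, sum_const,
          nsmul_eq_mul, ← hk]
        ring
      rw [h2]
      nlinarith [mul_nonneg (sub_nonneg.2 hge) (mul_nonneg (by linarith : 0 ≤ k) hn.le)]
    have h2 : ∀ e ∈ U, ∀ σ ∈ fiber Ω U ω, k * u (e, σ e) = lin u σ := by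
      intro e he σ hσ
      have h3 : ∀ f ∈ U, 0 ≤ avg Ω U ω (fun σ => (k * u (f, σ f) - lin u σ) ^ 2) :=
        fun f _ => avg_nonneg fun _ _ => sq_nonneg _
      have h4 := (sum_eq_zero_iff_of_nonneg h3).1 (le_antisymm h1 (sum_nonneg h3)) e he
      linarith [eq_zero_of_avg_sq_eq_zero h4 hσ]
    have h3 : n = 0 := by
      rw [hn']
      refine sum_eq_zero fun f hf => ?_
      have h4 : ∀ σ ∈ fiber Ω U ω, u (f, σ f) = u (f, ω f) := fun σ hσ =>
        hlink.eq_of_forall_eq (by omega) (by linarith : k ≠ 0) h2 hf hσ (self_mem_fiber hω)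
      have h5 := hmean f hf
      rw [avg_congr h4, avg_const hω] at h5
      rw [avg_congr fun σ hσ => by rw [h4 σ hσ], avg_const hω, h5]
      ring
    exact hn.ne' h3

end APriori

/-! ### List colorings of a graph -/

section Colorings

variable {E K : Type*} [Fintype E] [DecidableEq E] [Fintype K] [DecidableEq K]
  {H : SimpleGraph E} [DecidableRel H.Adj] {L : E → Finset K}

/-- The proper list colorings of the vertices of `H`. -/
def colorings (H : SimpleGraph E) [DecidableRel H.Adj] (L : E → Finset K) : Finset (E → K) :=
  {σ | (∀ e, σ e ∈ L e) ∧ ∀ e f, H.Adj e f → σ e ≠ σ f}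

theorem mem_colorings {σ : E → K} :
    σ ∈ colorings H L ↔ (∀ e, σ e ∈ L e) ∧ ∀ e f, H.Adj e f → σ e ≠ σ f := by
  simp [colorings]

/-- A proper partial coloring extends greedily if all lists are longer than the degrees. -/
theorem exists_mem_colorings_extending (hL : ∀ e, H.degree e < (L e).card) (S : Finset E)
    (σ : E → K) (h1 : ∀ e ∈ S, σ e ∈ L e) (h2 : ∀ e ∈ S, ∀ f ∈ S, H.Adj e f → σ e ≠ σ f) :
    ∃ τ ∈ colorings H L, ∀ e ∈ S, τ e = σ e := by
  induction hn : Sᶜ.card generalizing S σ with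
  | zero =>
    have hS : ∀ e, e ∈ S := fun e => by
      by_contra he
      exact (card_pos.2 ⟨e, mem_compl.2 he⟩).ne' hn
    exact ⟨σ, mem_colorings.2 ⟨fun e => h1 e (hS e), fun e f => h2 e (hS e) f (hS f)⟩,
      fun _ _ => rfl⟩
  | succ n ih =>
    obtain ⟨e, he⟩ : Sᶜ.Nonempty := card_pos.1 (by omega)
    have heS : e ∉ S := mem_compl.1 he
    obtain ⟨c, hc, hc'⟩ : ∃ c ∈ L e, c ∉ (H.neighborFinset e).image σ :=
      exists_mem_notMem_of_card_lt_card (card_image_le.trans_lt (by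
        rw [SimpleGraph.card_neighborFinset_eq_degree]
        exact hL e))
    have hne : ∀ f ∈ S, H.Adj e f → c ≠ σ f := fun f _ hf h =>
      hc' (mem_image.2 ⟨f, (H.mem_neighborFinset e f).2 hf, h.symm⟩)
    have hupd : ∀ f ∈ S, Function.update σ e c f = σ f := fun f hf =>
      Function.update_of_ne (by rintro rfl; exact heS hf) _ _
    obtain ⟨τ, hτ, hτS⟩ := ih (insert e S) (Function.update σ e c)
      (fun f hf => by
        rcases mem_insert.1 hf with rfl | hf
        · simpa using hc
        · rw [hupd f hf]
          exact h1 f hf)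
      (fun f hf g hg hfg => by
        rcases mem_insert.1 hf with rfl | hf' <;> rcases mem_insert.1 hg with rfl | hg'
        · exact absurd hfg (H.loopless.irrefl _)
        · rw [hupd g hg', Function.update_self]
          exact hne g hg' hfg
        · rw [hupd f hf', Function.update_self]
          exact (hne f hf' hfg.symm).symm
        · rw [hupd f hf', hupd g hg']
          exact h2 f hf' g hg' hfg)
      (by rw [compl_insert, card_erase_of_mem he, hn]; rfl)
    exact ⟨τ, hτ, fun f hf => by rw [hτS f (mem_insert_of_mem hf), hupd f hf]⟩

theorem linked_colorings (hL : ∀ e, H.degree e + 3 ≤ (L e).card) {U : Finset E} {ω : E → K}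
    (hω : ω ∈ colorings H L) : Linked (colorings H L) U ω := by
  intro e he f hf hef σ₁ h₁ σ₂ h₂
  obtain ⟨a, ha, ha'⟩ : ∃ a ∈ L e,
      a ∉ insert (σ₁ f) (insert (σ₂ f) ((H.neighborFinset e).image ω)) :=
    exists_mem_notMem_of_card_lt_card (by
      have h3 := card_insert_le (σ₁ f) (insert (σ₂ f) ((H.neighborFinset e).image ω))
      have h4 := card_insert_le (σ₂ f) ((H.neighborFinset e).image ω)
      have h5 := card_image_le (s := H.neighborFinset e) (f := ω)
      rw [SimpleGraph.card_neighborFinset_eq_degree] at h5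
      have := hL e
      omega)
  simp only [mem_insert, mem_image, SimpleGraph.mem_neighborFinset, not_or, not_exists,
    not_and] at ha'
  obtain ⟨ha₁, ha₂, ha₃⟩ := ha'
  have key : ∀ σ ∈ fiber (colorings H L) U ω, a ≠ σ f →
      ∃ τ ∈ fiber (colorings H L) U ω, τ f = σ f ∧ τ e = a := by
    intro σ hσ haσ
    rw [mem_fiber] at hσ
    have hσc := mem_colorings.1 hσ.1
    have hωc := mem_colorings.1 hω
    set σ' : E → K := fun g => if g = e then a else if g = f then σ f else ω g with hσ'
    have hval : ∀ g, g ∈ insert e (insert f Uᶜ) →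
        (g = e ∧ σ' g = a) ∨ (g ≠ e ∧ σ' g = σ g ∧ (g = f ∨ (g ∉ U ∧ σ g = ω g))) := by
      intro g hg
      by_cases hge : g = e
      · exact Or.inl ⟨hge, by simp [hσ', hge]⟩
      · refine Or.inr ⟨hge, ?_⟩
        by_cases hgf : g = f
        · exact ⟨by simp [hσ', hgf, Ne.symm hef], Or.inl hgf⟩
        · have hgU : g ∉ U := by simpa [hge, hgf] using hg
          exact ⟨by simp [hσ', hge, hgf, hσ.2 g hgU], Or.inr ⟨hgU, hσ.2 g hgU⟩⟩
    have hadj : ∀ g, (g = f ∨ (g ∉ U ∧ σ g = ω g)) → H.Adj e g → a ≠ σ g := by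
      rintro g (rfl | ⟨_, h⟩) hg
      · exact haσ
      · rw [h]
        exact fun h' => ha₃ g hg h'.symm
    obtain ⟨τ, hτ, hτS⟩ := exists_mem_colorings_extending (H := H) (L := L)
      (fun e => by have := hL e; omega)
      (insert e (insert f Uᶜ)) σ'
      (fun g hg => by
        rcases hval g hg with ⟨rfl, h⟩ | ⟨_, h, _⟩
        · rw [h]
          exact ha
        · rw [h]
          exact hσc.1 g)
      (fun g hg g' hg' hgg => by
        rcases hval g hg with ⟨rfl, h⟩ | ⟨hne, h, h'⟩ <;>
        rcases hval g' hg' with ⟨rfl, k⟩ | ⟨hne', k, k'⟩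
        · exact absurd hgg (H.loopless.irrefl _)
        · rw [h, k]
          exact hadj g' k' hgg
        · rw [h, k]
          exact (hadj g h' hgg.symm).symm
        · rw [h, k]
          exact hσc.2 g g' hgg)
    refine ⟨τ, mem_fiber.2 ⟨hτ, fun g hg => ?_⟩, ?_, ?_⟩
    · have hge : g ≠ e := fun h => hg (h ▸ he)
      have hgf : g ≠ f := fun h => hg (h ▸ hf)
      rw [hτS g (by simp [hg])]
      simp [hσ', hge, hgf]
    · rw [hτS f (by simp)]
      simp [hσ', Ne.symm hef]
    · rw [hτS e (by simp)]
      simp [hσ']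
  obtain ⟨τ₁, ht₁, hf₁, he₁⟩ := key σ₁ h₁ ha₁
  obtain ⟨τ₂, ht₂, hf₂, he₂⟩ := key σ₂ h₂ ha₂
  exact ⟨τ₁, ht₁, τ₂, ht₂, hf₁, hf₂, he₁.trans he₂.symm⟩

/-! ### Independence of non-adjacent parts -/

/-- No vertex of `U₁` is adjacent to a vertex of `U₂`. -/
def Separated (H : SimpleGraph E) (U₁ U₂ : Finset E) : Prop :=
  Disjoint U₁ U₂ ∧ ∀ e ∈ U₁, ∀ f ∈ U₂, ¬ H.Adj e f

theorem Separated.symm {U₁ U₂ : Finset E} (h : Separated H U₁ U₂) : Separated H U₂ U₁ :=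
  ⟨h.1.symm, fun e he f hf hef => h.2 f hf e he hef.symm⟩

variable {U₁ U₂ : Finset E} {ω : E → K}

theorem Separated.avg_left_eq (h : Separated H U₁ U₂) {σ : E → K} (hω : ω ∈ colorings H L)
    (hσ : σ ∈ fiber (colorings H L) (U₁ ∪ U₂) ω) {φ : (E → K) → ℝ}
    (hφ : ∀ τ τ', (∀ e ∉ U₂, τ e = τ' e) → φ τ = φ τ') :
    avg (colorings H L) U₁ σ φ = avg (colorings H L) U₁ ω φ := by
  have hσ' := mem_fiber.1 hσ
  -- a coloring of `U₁` compatible with `ρ` outside is transplanted to the surroundings `ρ'`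
  have key : ∀ ρ ρ' : E → K, ρ' ∈ colorings H L → (∀ e ∉ U₁ ∪ U₂, ρ e = ρ' e) →
      ∀ τ ∈ fiber (colorings H L) U₁ ρ,
        (fun e => if e ∈ U₁ then τ e else ρ' e) ∈ fiber (colorings H L) U₁ ρ' := by
    intro ρ ρ' hρ' hρρ τ hτ
    rw [mem_fiber] at hτ
    have hτc := mem_colorings.1 hτ.1
    have hρc := mem_colorings.1 hρ'
    have hside : ∀ e ∈ U₁, ∀ f ∉ U₁, H.Adj e f → ρ' f = τ f := by
      intro e he f hf hef
      rw [hτ.2 f hf]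
      exact (hρρ f (by
        rw [mem_union, not_or]
        exact ⟨hf, fun hf2 => h.2 e he f hf2 hef⟩)).symm
    refine mem_fiber.2 ⟨mem_colorings.2 ⟨fun e => ?_, fun e f hef => ?_⟩, fun e he => by simp [he]⟩
    · split_ifs
      exacts [hτc.1 e, hρc.1 e]
    · split_ifs with h1 h2 h2
      · exact hτc.2 e f hef
      · rw [hside e h1 f h2 hef]
        exact hτc.2 e f hef
      · rw [hside f h2 e h1 hef.symm]
        exact hτc.2 e f hef
      · exact hρc.2 e f hef
  refine expect_nbij' (fun τ e => if e ∈ U₁ then τ e else ω e)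
    (fun τ e => if e ∈ U₁ then τ e else σ e) (key σ ω hω hσ'.2)
    (key ω σ hσ'.1 fun e he => (hσ'.2 e he).symm) ?_ ?_ ?_
  · intro τ hτ
    ext e
    by_cases he : e ∈ U₁
    · simp [he]
    · simp [he, (mem_fiber.1 hτ).2 e he]
  · intro τ hτ
    ext e
    by_cases he : e ∈ U₁
    · simp [he]
    · simp [he, (mem_fiber.1 hτ).2 e he]
  · intro τ hτ
    refine hφ _ _ fun e he => ?_
    by_cases he1 : e ∈ U₁
    · simp [he1]
    · simp only [he1, if_false]
      rw [(mem_fiber.1 hτ).2 e he1, hσ'.2 e (by simp [he, he1])]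

theorem Separated.avg_union_eq (h : Separated H U₁ U₂) (hω : ω ∈ colorings H L)
    {φ : (E → K) → ℝ} (hφ : ∀ τ τ', (∀ e ∉ U₂, τ e = τ' e) → φ τ = φ τ') :
    avg (colorings H L) (U₁ ∪ U₂) ω φ = avg (colorings H L) U₁ ω φ := by
  rw [← avg_avg subset_union_left, avg_congr fun σ hσ => h.avg_left_eq hω hσ hφ, avg_const hω]

theorem Separated.avg_mul (h : Separated H U₁ U₂) (hω : ω ∈ colorings H L)
    {φ ψ : (E → K) → ℝ} (hφ : ∀ τ τ', (∀ e ∉ U₂, τ e = τ' e) → φ τ = φ τ')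
    (hψ : ∀ τ τ', (∀ e ∉ U₁, τ e = τ' e) → ψ τ = ψ τ') :
    avg (colorings H L) (U₁ ∪ U₂) ω (fun σ => φ σ * ψ σ)
      = avg (colorings H L) (U₁ ∪ U₂) ω φ * avg (colorings H L) (U₁ ∪ U₂) ω ψ := by
  rw [h.avg_union_eq hω hφ, ← avg_avg subset_union_left, ← avg_const_mul]
  refine avg_congr fun σ hσ => ?_
  rw [← h.avg_left_eq hω hσ hφ, ← avg_mul_const]
  exact avg_congr fun τ hτ => by rw [hψ τ σ (mem_fiber.1 hτ).2]

/-- The variances of separated parts add up. -/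
theorem Separated.var_lin_union (h : Separated H U₁ U₂) (hω : ω ∈ colorings H L)
    (v : E × K → ℝ) : var (colorings H L) (U₁ ∪ U₂) ω (lin v)
      = var (colorings H L) U₁ ω (lin v) + var (colorings H L) U₂ ω (lin v) := by
  set Ω := colorings H L
  set φ : (E → K) → ℝ := fun σ => ∑ e ∈ U₁, v (e, σ e) with hφ_def
  set ψ : (E → K) → ℝ := fun σ => ∑ e ∈ U₁ᶜ, v (e, σ e) with hψ_def
  have hφ : ∀ τ τ' : E → K, (∀ e ∉ U₂, τ e = τ' e) → φ τ = φ τ' := fun τ τ' hττ =>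
    sum_congr rfl fun e he => by rw [hττ e fun he2 => disjoint_left.1 h.1 he he2]
  have hψ : ∀ τ τ' : E → K, (∀ e ∉ U₁, τ e = τ' e) → ψ τ = ψ τ' := fun τ τ' hττ =>
    sum_congr rfl fun e he => by rw [hττ e (mem_compl.1 he)]
  have hlin : lin v = fun σ => φ σ + ψ σ := by
    ext σ
    exact (sum_add_sum_compl U₁ _).symm
  have hvar : ∀ {W W' : Finset E}, Separated H W W' → ∀ χ : (E → K) → ℝ,
      (∀ τ τ' : E → K, (∀ e ∉ W', τ e = τ' e) → χ τ = χ τ') →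
      var Ω (W ∪ W') ω χ = var Ω W ω χ := fun hW χ hχ => by
    rw [var, var, hW.avg_union_eq hω hχ,
      hW.avg_union_eq hω (φ := fun σ => χ σ ^ 2) fun τ τ' hττ => by rw [hχ τ τ' hττ]]
  have h1 : var Ω U₁ ω (lin v) = var Ω U₁ ω φ := by
    rw [hlin, ← var_add_const hω (ψ ω) (φ := φ)]
    exact var_congr fun σ hσ => by rw [hψ σ ω (mem_fiber.1 hσ).2]
  have h2 : var Ω U₂ ω (lin v) = var Ω U₂ ω ψ := by
    rw [hlin, ← var_add_const hω (φ ω) (φ := ψ)]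
    exact var_congr fun σ hσ => by rw [hφ σ ω (mem_fiber.1 hσ).2, add_comm]
  have h3 : var Ω (U₁ ∪ U₂) ω (lin v) = var Ω (U₁ ∪ U₂) ω φ + var Ω (U₁ ∪ U₂) ω ψ := by
    have h4 : (fun σ => (φ σ + ψ σ) ^ 2) = fun σ => φ σ ^ 2 + ψ σ ^ 2 + 2 * (φ σ * ψ σ) := by
      ext σ
      ring
    rw [hlin, var, var, var, h4, avg_add, avg_add, avg_add, avg_const_mul, h.avg_mul hω hφ hψ]
    ring
  rw [h3, hvar h φ hφ, h1, h2]
  congr 1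
  rw [union_comm]
  exact hvar h.symm ψ hψ

end Colorings

/-! ### Two adjacent vertices -/

section Pair

variable {E K : Type*} [Fintype E] [DecidableEq E] [Fintype K] [DecidableEq K]
  {H : SimpleGraph E} [DecidableRel H.Adj] {L : E → Finset K} {e f : E} {σ : E → K} {β : ℝ}

/-- The colors in the list of `e` that `σ` uses on no neighbor of `e` other than `f`. -/
def avail (H : SimpleGraph E) [DecidableRel H.Adj] (L : E → Finset K) (e f : E) (σ : E → K) :
    Finset K :=
  {c ∈ L e | ∀ g, H.Adj e g → g ≠ f → σ g ≠ c}

/-- The number of ways to recolor the adjacent vertices `e` and `f` in `σ`. -/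
def pairCount (H : SimpleGraph E) [DecidableRel H.Adj] (L : E → Finset K) (e f : E) (σ : E → K) :
    ℝ :=
  ((avail H L e f σ).card : ℝ) * (avail H L f e σ).card
    - (avail H L e f σ ∩ avail H L f e σ).card

/-- The probability, when `e` and `f` are recolored independently and conditioned to be properly
colored, of any prescribed pair of distinct available colors; here it is attached to those colors
`c` that are available for both `e` and `f`, and is the size of the defect caused by `c`. -/
noncomputable def defect (H : SimpleGraph E) [DecidableRel H.Adj] (L : E → Finset K) (e f : E)
    (c : K) (σ : E → K) : ℝ :=
  if c ∈ avail H L e f σ ∩ avail H L f e σ then (pairCount H L e f σ)⁻¹ else 0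

theorem mem_avail {c : K} :
    c ∈ avail H L e f σ ↔ c ∈ L e ∧ ∀ g, H.Adj e g → g ≠ f → σ g ≠ c := by
  simp [avail]

theorem avail_congr {σ' : E → K} (h : ∀ g, H.Adj e g → g ≠ f → σ g = σ' g) :
    avail H L e f σ = avail H L e f σ' := by
  ext c
  simp only [mem_avail]
  refine and_congr_right fun _ => forall₃_congr fun g h1 h2 => ?_
  rw [h g h1 h2]

theorem defect_congr {σ' : E → K} (h : ∀ g, H.Adj e g → g ≠ f → σ g = σ' g)
    (h' : ∀ g, H.Adj f g → g ≠ e → σ g = σ' g) (c : K) :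
    defect H L e f c σ = defect H L e f c σ' := by
  rw [defect, defect, pairCount, pairCount, avail_congr h, avail_congr h']

theorem pairCount_comm : pairCount H L e f σ = pairCount H L f e σ := by
  rw [pairCount, pairCount, inter_comm, mul_comm]

theorem defect_comm (c : K) : defect H L e f c σ = defect H L f e c σ := by
  rw [defect, defect, pairCount_comm, inter_comm]

theorem le_card_avail (hL : ∀ e, β + H.degree e ≤ (L e).card) (hef : H.Adj e f) :
    β + 1 ≤ (avail H L e f σ).card := by
  have h1 : L e \ ((H.neighborFinset e).erase f).image σ ⊆ avail H L e f σ := by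
    intro c hc
    rw [mem_sdiff, mem_image, not_exists] at hc
    exact mem_avail.2 ⟨hc.1, fun g hg hgf h => hc.2 g
      ⟨mem_erase.2 ⟨hgf, (H.mem_neighborFinset e g).2 hg⟩, h⟩⟩
  have h2 := card_le_card h1
  have h3 := le_card_sdiff (((H.neighborFinset e).erase f).image σ) (L e)
  have h4 : (((H.neighborFinset e).erase f).image σ).card ≤ ((H.neighborFinset e).erase f).card :=
    card_image_le
  have hmem : f ∈ H.neighborFinset e := (H.mem_neighborFinset e f).2 hef
  have h6 := card_pos.2 ⟨f, hmem⟩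
  rw [card_erase_of_mem hmem, SimpleGraph.card_neighborFinset_eq_degree] at h4
  rw [SimpleGraph.card_neighborFinset_eq_degree] at h6
  have h5 : (L e).card + 1 ≤ (avail H L e f σ).card + H.degree e := by omega
  have h7 : ((L e).card : ℝ) + 1 ≤ (avail H L e f σ).card + H.degree e := by exact_mod_cast h5
  linarith [hL e]

/-- Recoloring the adjacent vertices `e` and `f` amounts to choosing distinct available colors. -/
theorem sum_fiber_pair (hef : H.Adj e f) (hσ : σ ∈ colorings H L) (φ : K → K → ℝ) :
    ∑ τ ∈ fiber (colorings H L) {e, f} σ, φ (τ e) (τ f)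
      = ∑ a ∈ avail H L e f σ, ∑ b ∈ avail H L f e σ, if a ≠ b then φ a b else 0 := by
  have hne : e ≠ f := hef.ne
  have hσc := mem_colorings.1 hσ
  rw [← sum_product', ← sum_filter]
  refine sum_nbij' (fun τ => (τ e, τ f))
    (fun p g => if g = e then p.1 else if g = f then p.2 else σ g) ?_ ?_ ?_ ?_ fun _ _ => rfl
  · intro τ hτ
    rw [mem_fiber] at hτ
    have hτc := mem_colorings.1 hτ.1
    simp only [mem_filter, mem_product, mem_avail]
    refine ⟨⟨⟨hτc.1 e, fun g hg hgf => ?_⟩, ⟨hτc.1 f, fun g hg hge => ?_⟩⟩, hτc.2 e f hef⟩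
    · rw [← hτ.2 g (by simp [hgf, hg.ne'])]
      exact (hτc.2 e g hg).symm
    · rw [← hτ.2 g (by simp [hge, hg.ne'])]
      exact (hτc.2 f g hg).symm
  · rintro ⟨a, b⟩ hp
    simp only [mem_filter, mem_product, mem_avail] at hp
    obtain ⟨⟨⟨ha, ha'⟩, hb, hb'⟩, hab⟩ := hp
    refine mem_fiber.2 ⟨mem_colorings.2 ⟨fun g => ?_, fun g g' hgg => ?_⟩, fun g hg => ?_⟩
    · dsimp only
      split_ifs with h1 h2
      · rw [h1]; exact ha
      · rw [h2]; exact hb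
      · exact hσc.1 g
    · by_cases h1 : g = e
      · subst h1
        by_cases h2 : g' = f
        · simpa [h2, hne.symm] using hab
        · simpa [h2, hgg.ne'] using (ha' g' hgg h2).symm
      · by_cases h2 : g = f
        · subst h2
          by_cases h3 : g' = e
          · simpa [h3, h1] using hab.symm
          · simpa [h1, h3, hgg.ne'] using (hb' g' hgg h3).symm
        · by_cases h3 : g' = e
          · subst h3
            simpa [h1, h2] using ha' g hgg.symm h2
          · by_cases h4 : g' = f
            · subst h4
              simpa [h1, h2, h3] using hb' g hgg.symm h1
            · simpa [h1, h2, h3, h4] using hσc.2 g g' hgg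
    · simp only [mem_insert, mem_singleton, not_or] at hg
      simp [hg.1, hg.2]
  · intro τ hτ
    ext g
    by_cases h1 : g = e
    · simp [h1]
    · by_cases h2 : g = f
      · simp [h2, hne.symm]
      · simp [h1, h2, (mem_fiber.1 hτ).2 g (by simp [h1, h2])]
  · rintro ⟨a, b⟩ _
    simp [hne.symm]

theorem sum_sum_ne_mul (A B : Finset K) (x y : K → ℝ) :
    ∑ a ∈ A, ∑ b ∈ B, (if a ≠ b then x a * y b else 0)
      = (∑ a ∈ A, x a) * (∑ b ∈ B, y b) - ∑ c ∈ A ∩ B, x c * y c := by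
  have h1 : ∀ a ∈ A, ∑ b ∈ B, (if a ≠ b then x a * y b else 0)
      = x a * (∑ b ∈ B, y b) - if a ∈ B then x a * y a else 0 := by
    intro a _
    have h2 : ∀ b, (if a ≠ b then x a * y b else 0) = x a * y b - if a = b then x a * y b else 0 :=
      fun b => by by_cases h : a = b <;> simp [h]
    simp only [h2, sum_sub_distrib, ← mul_sum, sum_ite_eq]
  rw [sum_congr rfl h1, sum_sub_distrib, ← sum_mul, ← sum_filter, filter_mem_eq_inter]

theorem avg_pair (hef : H.Adj e f) (hσ : σ ∈ colorings H L) (x y : K → ℝ) :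
    avg (colorings H L) {e, f} σ (fun τ => x (τ e) * y (τ f)) =
      ((∑ a ∈ avail H L e f σ, x a) * (∑ b ∈ avail H L f e σ, y b)
        - ∑ c ∈ avail H L e f σ ∩ avail H L f e σ, x c * y c) / pairCount H L e f σ := by
  have hN : ((fiber (colorings H L) {e, f} σ).card : ℝ) = pairCount H L e f σ := by
    have h1 := sum_fiber_pair hef hσ (fun _ _ => (1 : ℝ) * 1)
    rw [sum_sum_ne_mul _ _ (fun _ => 1) (fun _ => 1)] at h1
    simpa [pairCount] using h1
  rw [avg, expect_eq_sum_div_card, hN, sum_fiber_pair hef hσ fun a b => x a * y b, sum_sum_ne_mul]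

theorem avg_pair_left (hef : H.Adj e f) (hσ : σ ∈ colorings H L) (x : K → ℝ) :
    avg (colorings H L) {e, f} σ (fun τ => x (τ e)) =
      ((avail H L f e σ).card * (∑ a ∈ avail H L e f σ, x a)
        - ∑ c ∈ avail H L e f σ ∩ avail H L f e σ, x c) / pairCount H L e f σ := by
  have := avg_pair hef hσ x fun _ => 1
  simp only [mul_one, sum_const, nsmul_eq_mul] at this
  rw [this, mul_comm]

theorem pairCount_pos (hβ : 0 < β) (hL : ∀ e, β + H.degree e ≤ (L e).card) (hef : H.Adj e f) :
    0 < pairCount H L e f σ := by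
  have h1 : β + 1 ≤ (avail H L e f σ).card := le_card_avail hL hef
  have h2 : β + 1 ≤ (avail H L f e σ).card := le_card_avail hL hef.symm
  have h3 : ((avail H L e f σ ∩ avail H L f e σ).card : ℝ) ≤ (avail H L e f σ).card := by
    exact_mod_cast card_le_card inter_subset_left
  rw [pairCount]
  nlinarith

/-- The defect at `c` is at most `β⁻¹` times the probability that `e` is recolored with `c`. -/
theorem mul_defect_le (hβ : 0 < β) (hL : ∀ e, β + H.degree e ≤ (L e).card) (hef : H.Adj e f)
    (hσ : σ ∈ colorings H L) (c : K) :
    β * defect H L e f c σ ≤ marg (colorings H L) {e, f} σ (e, c) := by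
  rw [defect]
  split_ifs with hc
  · have h1 := avg_pair_left hef hσ (fun a => if a = c then (1 : ℝ) else 0)
    have h2 : marg (colorings H L) {e, f} σ (e, c)
        = avg (colorings H L) {e, f} σ (fun τ => if τ e = c then (1 : ℝ) else 0) := rfl
    rw [h2, h1, sum_ite_eq', sum_ite_eq', if_pos hc, if_pos (mem_inter.1 hc).1, mul_one,
      ← div_eq_mul_inv]
    have h3 : 0 < pairCount H L e f σ := pairCount_pos hβ hL hef
    have h4 : β + 1 ≤ (avail H L f e σ).card := le_card_avail hL hef.symm
    gcongr
    linarith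
  · rw [mul_zero]
    exact marg_nonneg _

theorem defect_nonneg (hβ : 0 < β) (hL : ∀ e, β + H.degree e ≤ (L e).card) (hef : H.Adj e f)
    (c : K) : 0 ≤ defect H L e f c σ := by
  rw [defect]
  split_ifs
  · exact (inv_pos.2 (pairCount_pos hβ hL hef)).le
  · exact le_rfl

/-- The averaged defect is at most `β⁻¹` times a marginal probability. -/
theorem mul_avg_defect_le (hβ : 0 < β) (hL : ∀ e, β + H.degree e ≤ (L e).card) (hef : H.Adj e f)
    {U : Finset E} (he : e ∈ U) (hf : f ∈ U) (c : K) :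
    β * avg (colorings H L) U σ (defect H L e f c) ≤ marg (colorings H L) U σ (e, c) := by
  have hU : {e, f} ⊆ U := by
    intro g hg
    rcases mem_insert.1 hg with rfl | hg
    · exact he
    · rwa [mem_singleton.1 hg]
  rw [← avg_const_mul, marg, ← avg_avg hU (φ := ind (e, c))]
  exact avg_mono fun τ hτ => mul_defect_le hβ hL hef (mem_fiber.1 hτ).1 c

/-- The inequality behind the base case: completing squares replaces the rank-one part of the
correlation between two lists by a diagonal term supported on the common colors. -/
theorem two_mul_sub_sq_le {A B : Finset K} {N : ℝ} (hN : N = (A.card : ℝ) * B.card - (A ∩ B).card)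
    (hN0 : 0 < N) (hβ : 0 < β) (hA : β + 1 ≤ A.card) (hB : β + 1 ≤ B.card) (u v : K → ℝ) :
    2 * (((∑ a ∈ A, u a) * (∑ b ∈ B, v b) - ∑ c ∈ A ∩ B, u c * v c) / N)
      - ((B.card * (∑ a ∈ A, u a) - ∑ c ∈ A ∩ B, u c) / N
        + (A.card * (∑ b ∈ B, v b) - ∑ c ∈ A ∩ B, v c) / N) ^ 2
      ≤ (1 / 5 + 2 / β) / β * ((B.card * (∑ a ∈ A, u a ^ 2) - ∑ c ∈ A ∩ B, u c ^ 2) / N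
        + (A.card * (∑ b ∈ B, v b ^ 2) - ∑ c ∈ A ∩ B, v c ^ 2) / N)
        - 2 * (4 / 5 * ((∑ c ∈ A ∩ B, u c * v c) / N)) := by
  set a : ℝ := (A.card : ℝ)
  set b : ℝ := (B.card : ℝ)
  set α := ∑ c ∈ A ∩ B, u c with hα
  set γ := ∑ c ∈ A ∩ B, v c with hγ
  set D := ∑ c ∈ A ∩ B, u c * v c with hD
  set Su := ∑ a ∈ A, u a
  set Sv := ∑ b ∈ B, v b
  set P := (b * Su - α) / N with hP
  set Q := (a * Sv - γ) / N with hQ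
  set R := ∑ c ∈ A ∩ B, (u c ^ 2 + v c ^ 2) with hR
  have ha : 0 < a := by linarith
  have hb : 0 < b := by linarith
  have hab : 0 < a * b := mul_pos ha hb
  have hNP : N * P = b * Su - α := by rw [hP]; field_simp
  have hNQ : N * Q = a * Sv - γ := by rw [hQ]; field_simp
  have hNab : N ≤ a * b := by
    rw [hN]
    have : (0 : ℝ) ≤ (A ∩ B).card := by positivity
    linarith
  have hR0 : 0 ≤ R := sum_nonneg fun c _ => by positivity
  -- the rank-one part
  have h1 : 2 * (Su * Sv / N) - (P + Q) ^ 2 ≤ (α + γ) ^ 2 / (a * b * N) := by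
    have h2 : Su * Sv / N = (N * P + α) * (N * Q + γ) / (a * b * N) := by
      rw [hNP, hNQ]
      field_simp
      ring
    have h3 : (P + Q) ^ 2 = a * b * N * (P + Q) ^ 2 / (a * b * N) := by
      field_simp
    rw [h2, h3, ← mul_div_assoc, ← sub_div]
    gcongr
    have h4 : N * (N * (P + Q) ^ 2) ≤ a * b * (N * (P + Q) ^ 2) :=
      mul_le_mul_of_nonneg_right hNab (by positivity)
    nlinarith [sq_nonneg (N * P - γ), sq_nonneg (N * Q - α)]
  have h2 : (α + γ) ^ 2 / (a * b * N) ≤ 2 / β * (R / N) := by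
    have h3 : (α + γ) ^ 2 ≤ a * (2 * R) := by
      have h4 : α + γ = ∑ c ∈ A ∩ B, (u c + v c) := sum_add_distrib.symm
      have h5 := sq_sum_le_card_mul_sum_sq (s := A ∩ B) (f := fun c => u c + v c)
      have h6 : ∑ c ∈ A ∩ B, (u c + v c) ^ 2 ≤ 2 * R := by
        rw [hR, mul_sum]
        exact sum_le_sum fun c _ => by nlinarith [sq_nonneg (u c - v c)]
      have h7 : ((A ∩ B).card : ℝ) ≤ a := Nat.cast_le.2 (card_le_card inter_subset_left)
      rw [h4]
      calc _ ≤ _ := h5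
        _ ≤ ((A ∩ B).card : ℝ) * (2 * R) := by gcongr
        _ ≤ a * (2 * R) := by gcongr
    calc (α + γ) ^ 2 / (a * b * N) ≤ a * (2 * R) / (a * b * N) := by gcongr
      _ = 2 / b * (R / N) := by field_simp
      _ ≤ 2 / β * (R / N) := by gcongr; linarith
  -- the part supported on the common colors
  have h3 : -(2 * (1 / 5) * (D / N)) ≤ 1 / 5 * (R / N) := by
    have h4 : -(2 * D) ≤ R := by
      rw [hD, hR, mul_sum, ← sum_neg_distrib]
      exact sum_le_sum fun c _ => by nlinarith [sq_nonneg (u c + v c)]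
    have h5 := div_le_div_of_nonneg_right h4 hN0.le
    rw [neg_div, mul_div_assoc] at h5
    linarith
  have h4 : β * (R / N) ≤ (b * (∑ a ∈ A, u a ^ 2) - ∑ c ∈ A ∩ B, u c ^ 2) / N
        + (a * (∑ b ∈ B, v b ^ 2) - ∑ c ∈ A ∩ B, v c ^ 2) / N := by
    have h5 : ∑ c ∈ A ∩ B, u c ^ 2 ≤ ∑ a ∈ A, u a ^ 2 :=
      sum_le_sum_of_subset_of_nonneg inter_subset_left fun _ _ _ => sq_nonneg _
    have h6 : ∑ c ∈ A ∩ B, v c ^ 2 ≤ ∑ b ∈ B, v b ^ 2 :=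
      sum_le_sum_of_subset_of_nonneg inter_subset_right fun _ _ _ => sq_nonneg _
    have h7 : 0 ≤ ∑ c ∈ A ∩ B, u c ^ 2 := sum_nonneg fun _ _ => sq_nonneg _
    have h8 : 0 ≤ ∑ c ∈ A ∩ B, v c ^ 2 := sum_nonneg fun _ _ => sq_nonneg _
    rw [← add_div, ← mul_div_assoc, hR, sum_add_distrib]
    gcongr
    nlinarith [mul_le_mul_of_nonneg_left h5 hb.le, mul_le_mul_of_nonneg_left h6 ha.le,
      mul_le_mul_of_nonneg_right hB h7, mul_le_mul_of_nonneg_right hA h8]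
  have h5 : (1 / 5 + 2 / β) * (R / N) ≤ (1 / 5 + 2 / β) / β
      * ((b * (∑ a ∈ A, u a ^ 2) - ∑ c ∈ A ∩ B, u c ^ 2) / N
        + (a * (∑ b ∈ B, v b ^ 2) - ∑ c ∈ A ∩ B, v c ^ 2) / N) := by
    calc (1 / 5 + 2 / β) * (R / N) = (1 / 5 + 2 / β) / β * (β * (R / N)) := by field_simp
      _ ≤ _ := mul_le_mul_of_nonneg_left h4 (by positivity)
  have h6 : (Su * Sv - D) / N = Su * Sv / N - D / N := sub_div ..
  rw [h6]
  linarith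

theorem var_lin_pair_le (hβ : 0 < β) (hL : ∀ e, β + H.degree e ≤ (L e).card) (hef : H.Adj e f)
    (hσ : σ ∈ colorings H L) (v : E × K → ℝ) :
    var (colorings H L) {e, f} σ (lin v) ≤
      (1 + (1 / 5 + 2 / β) / β) * (avg (colorings H L) {e, f} σ (fun τ => v (e, τ e) ^ 2)
        + avg (colorings H L) {e, f} σ (fun τ => v (f, τ f) ^ 2))
      - 2 * (4 / 5 * ∑ c, defect H L e f c σ * (v (e, c) * v (f, c))) := by
  set Ω := colorings H L with hΩ
  have hne := hef.ne
  have h1 : var Ω {e, f} σ (lin v) = var Ω {e, f} σ (fun τ => v (e, τ e) + v (f, τ f)) := by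
    rw [← var_add_const hσ (∑ g ∈ ({e, f} : Finset E)ᶜ, v (g, σ g))
      (φ := fun τ => v (e, τ e) + v (f, τ f))]
    refine var_congr fun τ hτ => ?_
    rw [lin, ← sum_add_sum_compl ({e, f} : Finset E), sum_pair hne]
    congr 1
    exact sum_congr rfl fun g hg => by rw [(mem_fiber.1 hτ).2 g (mem_compl.1 hg)]
  have h2 : var Ω {e, f} σ (fun τ => v (e, τ e) + v (f, τ f))
      = avg Ω {e, f} σ (fun τ => v (e, τ e) ^ 2) + avg Ω {e, f} σ (fun τ => v (f, τ f) ^ 2)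
        + (2 * avg Ω {e, f} σ (fun τ => v (e, τ e) * v (f, τ f))
          - (avg Ω {e, f} σ (fun τ => v (e, τ e)) + avg Ω {e, f} σ (fun τ => v (f, τ f))) ^ 2) := by
    have h3 : (fun τ : E → K => (v (e, τ e) + v (f, τ f)) ^ 2)
        = fun τ => v (e, τ e) ^ 2 + v (f, τ f) ^ 2 + 2 * (v (e, τ e) * v (f, τ f)) := by
      ext τ
      ring
    rw [var, h3, avg_add, avg_add, avg_add, avg_const_mul]
    ring
  have h3 : ∑ c, defect H L e f c σ * (v (e, c) * v (f, c))
      = (∑ c ∈ avail H L e f σ ∩ avail H L f e σ, v (e, c) * v (f, c)) / pairCount H L e f σ := by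
    rw [sum_div, ← sum_subset (subset_univ (avail H L e f σ ∩ avail H L f e σ))]
    · exact sum_congr rfl fun c hc => by rw [defect, if_pos hc, inv_mul_eq_div]
    · intro c _ hc
      rw [defect, if_neg hc, zero_mul]
  have hA : β + 1 ≤ (avail H L e f σ).card := le_card_avail hL hef
  have hB : β + 1 ≤ (avail H L f e σ).card := le_card_avail hL hef.symm
  have key := two_mul_sub_sq_le (N := pairCount H L e f σ) rfl (pairCount_pos hβ hL hef) hβ
    hA hB (fun c => v (e, c)) (fun c => v (f, c))
  have hl := fun x => avg_pair_left hef hσ x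
  have hr := fun x => avg_pair_left hef.symm hσ x
  simp only [← hΩ, pair_comm f e, inter_comm (avail H L f e σ), pairCount_comm (e := f)] at hl hr
  rw [← h3, ← avg_pair hef hσ, ← hl, ← hr, ← hl (fun c => v (e, c) ^ 2),
    ← hr (fun c => v (f, c) ^ 2)] at key
  rw [h1, h2]
  linarith

end Pair

/-! ### The potential and its trickle-down recursion -/

section Potential

open Matrix

variable {E K : Type*} [Fintype E] [DecidableEq E] [Fintype K] [DecidableEq K]
  {H : SimpleGraph E} [DecidableRel H.Adj] {L : E → Finset K} {β : ℝ}
  {w : Finset E → E → E → ℝ} {U : Finset E} {ω : E → K}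

/-- The diagonal coefficient at `e`: the sum of the pair weights over the neighbors of `e` in
`U`. -/
def siteCoef (H : SimpleGraph E) [DecidableRel H.Adj] (w : Finset E → E → E → ℝ) (U : Finset E)
    (e : E) : ℝ :=
  ∑ f ∈ U with H.Adj e f, w U e f

/-- The total decrease of the pair weights at `e` when a further vertex is removed from `U`. -/
def excess (H : SimpleGraph E) [DecidableRel H.Adj] (w : Finset E → E → E → ℝ) (U : Finset E)
    (e : E) : ℝ :=
  ∑ f ∈ U with H.Adj e f, ∑ g ∈ (U.erase e).erase f, (w U e f - w (U.erase g) e f)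

/-- The quadratic form by which the variance of `lin v` may exceed the sum of the second moments: a
diagonal part with coefficients `siteCoef`, minus the averaged defects of adjacent pairs. -/
noncomputable def potential (H : SimpleGraph E) [DecidableRel H.Adj] (L : E → Finset K)
    (w : Finset E → E → E → ℝ) (U : Finset E) (ω : E → K) (v : E × K → ℝ) : ℝ :=
  ∑ e ∈ U, (siteCoef H w U e * avg (colorings H L) U ω (fun σ => v (e, σ e) ^ 2)
    - 4 / 5 * ∑ f ∈ U with H.Adj e f, ∑ c, avg (colorings H L) U ω (defect H L e f c)
      * (v (e, c) * v (f, c)))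

/-- The conditions on the pair weights under which the potential dominates the variances. The last
one is a purely deterministic inequality, which has to hold for all possible values of the
normalized averaged defects of a fixed color. -/
structure Admissible (H : SimpleGraph E) [DecidableRel H.Adj] (β : ℝ) (w : Finset E → E → E → ℝ) :
    Prop where
  separated : ∀ U₁ U₂, Separated H U₁ U₂ → ∀ e ∈ U₁, ∀ f ∈ U₁, H.Adj e f →
    w (U₁ ∪ U₂) e f = w U₁ e f
  pair : ∀ e f, H.Adj e f → (1 / 5 + 2 / β) / β ≤ w {e, f} e f
  le : ∀ U, ∀ e ∈ U, ∀ f ∈ U, H.Adj e f → w U e f + 4 / 5 / β ≤ 1 / 10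
  sq_le : ∀ U, (∀ e ∈ U, ∀ f ∈ U, H.Adj e f → ∃ g ∈ U, g ≠ e ∧ g ≠ f ∧ (H.Adj e g ∨ H.Adj f g)) →
    ∀ κ : E → E → ℝ, (∀ e ∈ U, ∀ f ∈ U, H.Adj e f → 0 ≤ κ e f ∧ κ e f ≤ 1 / β) → ∀ z : E → ℝ,
    ∑ e ∈ U, (siteCoef H w U e * z e - 4 / 5 * ∑ f ∈ U with H.Adj e f, κ e f * z f) ^ 2
      ≤ ∑ e ∈ U, excess H w U e * z e ^ 2

theorem sum_erase_comm {M : Type*} [AddCommMonoid M] (U : Finset E) (x : E → E → M) :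
    ∑ g ∈ U, ∑ e ∈ U.erase g, x g e = ∑ e ∈ U, ∑ g ∈ U.erase e, x g e :=
  sum_comm' fun g e => by
    simp only [mem_erase]
    tauto

theorem sum_erase_sum_filter {M : Type*} [AddCommMonoid M] {e : E} (x : E → E → M) :
    ∑ g ∈ U.erase e, ∑ f ∈ U.erase g with H.Adj e f, x g f
      = ∑ f ∈ U with H.Adj e f, ∑ g ∈ (U.erase e).erase f, x g f :=
  sum_comm' fun g f => by
    simp only [mem_erase, mem_filter]
    tauto

theorem cast_card_erase_erase {e f : E} (he : e ∈ U) (hf : f ∈ U) (hef : e ≠ f) :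
    (((U.erase e).erase f).card : ℝ) = (U.card : ℝ) - 2 := by
  have hf' : f ∈ U.erase e := mem_erase.2 ⟨hef.symm, hf⟩
  have h1 := card_erase_add_one he
  have h2 := card_erase_add_one hf'
  have h3 : ((U.erase e).erase f).card + 2 = U.card := by omega
  rw [← h3]
  push_cast
  ring

/-- The recursion for the potential: removing a random vertex is a martingale up to the excess. -/
theorem sum_avg_potential (v : E × K → ℝ) :
    ∑ g ∈ U, avg (colorings H L) U ω (fun σ => potential H L w (U.erase g) σ v)
      = ((U.card : ℝ) - 2) * potential H L w U ω v
        - ∑ e ∈ U, excess H w U e * avg (colorings H L) U ω (fun σ => v (e, σ e) ^ 2) := by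
  set Ω := colorings H L with hΩ
  have h1 : ∀ g ∈ U, avg Ω U ω (fun σ => potential H L w (U.erase g) σ v)
      = ∑ e ∈ U.erase g, (siteCoef H w (U.erase g) e * avg Ω U ω (fun σ => v (e, σ e) ^ 2)
        - 4 / 5 * ∑ f ∈ U.erase g with H.Adj e f, ∑ c, avg Ω U ω (defect H L e f c)
          * (v (e, c) * v (f, c))) := by
    intro g _
    simp only [potential, avg_sum, avg_sub, avg_const_mul, avg_mul_const, ← hΩ,
      avg_avg (erase_subset g U)]
  rw [sum_congr rfl h1, sum_erase_comm, potential, mul_sum, ← sum_sub_distrib]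
  refine sum_congr rfl fun e he => ?_
  rw [sum_sub_distrib, ← sum_mul, ← mul_sum, sum_erase_sum_filter fun g f =>
    ∑ c, avg Ω U ω (defect H L e f c) * (v (e, c) * v (f, c))]
  have h2 : ∑ g ∈ U.erase e, siteCoef H w (U.erase g) e
      = ((U.card : ℝ) - 2) * siteCoef H w U e - excess H w U e := by
    simp only [siteCoef, excess]
    rw [sum_erase_sum_filter fun g f => w (U.erase g) e f, mul_sum, ← sum_sub_distrib]
    refine sum_congr rfl fun f hf => ?_
    rw [mem_filter] at hf
    rw [sum_sub_distrib, sum_const, nsmul_eq_mul, cast_card_erase_erase he hf.1 hf.2.ne]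
    ring
  have h3 : ∑ f ∈ U with H.Adj e f, ∑ g ∈ (U.erase e).erase f,
        ∑ c, avg Ω U ω (defect H L e f c) * (v (e, c) * v (f, c))
      = ((U.card : ℝ) - 2) * ∑ f ∈ U with H.Adj e f,
        ∑ c, avg Ω U ω (defect H L e f c) * (v (e, c) * v (f, c)) := by
    rw [mul_sum]
    refine sum_congr rfl fun f hf => ?_
    rw [mem_filter] at hf
    rw [sum_const, nsmul_eq_mul, cast_card_erase_erase he hf.1 hf.2.ne]
  rw [h2, h3]
  ring

theorem potential_le (hβ : 0 < β) (hL : ∀ e, β + H.degree e ≤ (L e).card) {M : ℝ}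
    (hM : ∀ e ∈ U, ∑ f ∈ U with H.Adj e f, (w U e f + 4 / 5 / β) ≤ M) (v : E × K → ℝ) :
    potential H L w U ω v
      ≤ M * ∑ e ∈ U, avg (colorings H L) U ω (fun σ => v (e, σ e) ^ 2) := by
  set Ω := colorings H L with hΩ
  set T : E → E → K → ℝ := fun e f c => avg Ω U ω (defect H L e f c) with hT
  have hT0 : ∀ e f, H.Adj e f → ∀ c, 0 ≤ T e f c := fun e f hef c =>
    avg_nonneg fun σ _ => defect_nonneg hβ hL hef c
  have hTs : ∀ e f c, T e f c = T f e c := fun e f c =>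
    avg_congr fun σ _ => defect_comm c
  have h1 : -(∑ e ∈ U, ∑ f ∈ U with H.Adj e f, ∑ c, T e f c * (v (e, c) * v (f, c)))
      ≤ ∑ e ∈ U, ∑ f ∈ U with H.Adj e f, ∑ c, T e f c * v (e, c) ^ 2 := by
    have h2 : ∑ e ∈ U, ∑ f ∈ U with H.Adj e f, ∑ c, T e f c * v (f, c) ^ 2
        = ∑ e ∈ U, ∑ f ∈ U with H.Adj e f, ∑ c, T e f c * v (e, c) ^ 2 := by
      rw [sum_comm' (t' := U) (s' := fun e => {f ∈ U | H.Adj e f})]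
      · exact sum_congr rfl fun e _ => sum_congr rfl fun f _ => sum_congr rfl fun c _ => by
          rw [hTs]
      · intro e f
        simp only [mem_filter, H.adj_comm e f]
        tauto
    have h3 : -(2 * ∑ e ∈ U, ∑ f ∈ U with H.Adj e f, ∑ c, T e f c * (v (e, c) * v (f, c)))
        ≤ ∑ e ∈ U, ∑ f ∈ U with H.Adj e f, ∑ c, T e f c * v (e, c) ^ 2
          + ∑ e ∈ U, ∑ f ∈ U with H.Adj e f, ∑ c, T e f c * v (f, c) ^ 2 := by
      simp only [mul_sum, ← sum_neg_distrib, ← sum_add_distrib]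
      refine sum_le_sum fun e _ => sum_le_sum fun f hf => sum_le_sum fun c _ => ?_
      have := hT0 e f (mem_filter.1 hf).2 c
      nlinarith [mul_nonneg this (sq_nonneg (v (e, c) + v (f, c)))]
    linarith
  have h2 : ∀ e ∈ U, ∀ f ∈ U, H.Adj e f → ∑ c, T e f c * v (e, c) ^ 2
      ≤ 1 / β * avg Ω U ω (fun σ => v (e, σ e) ^ 2) := by
    intro e he f hf hef
    rw [avg_coord (fun x => v x ^ 2), mul_sum]
    refine sum_le_sum fun c _ => ?_
    have h3 : T e f c ≤ 1 / β * marg Ω U ω (e, c) := by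
      rw [one_div, le_inv_mul_iff₀ hβ]
      exact mul_avg_defect_le hβ hL hef he hf c
    calc T e f c * v (e, c) ^ 2 ≤ 1 / β * marg Ω U ω (e, c) * v (e, c) ^ 2 := by gcongr
      _ = _ := by ring
  have h3 : ∀ e ∈ U, 0 ≤ avg Ω U ω (fun σ => v (e, σ e) ^ 2) := fun e _ =>
    avg_nonneg fun _ _ => sq_nonneg _
  calc potential H L w U ω v
      = ∑ e ∈ U, siteCoef H w U e * avg Ω U ω (fun σ => v (e, σ e) ^ 2)
        + 4 / 5 * -(∑ e ∈ U, ∑ f ∈ U with H.Adj e f, ∑ c, T e f c * (v (e, c) * v (f, c))) := by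
        rw [potential, sum_sub_distrib, ← mul_sum]
        ring
    _ ≤ ∑ e ∈ U, siteCoef H w U e * avg Ω U ω (fun σ => v (e, σ e) ^ 2)
        + 4 / 5 * ∑ e ∈ U, ∑ f ∈ U with H.Adj e f, 1 / β * avg Ω U ω (fun σ => v (e, σ e) ^ 2) := by
        gcongr
        refine h1.trans (sum_le_sum fun e he => sum_le_sum fun f hf => ?_)
        exact h2 e he f (mem_filter.1 hf).1 (mem_filter.1 hf).2
    _ = ∑ e ∈ U, (∑ f ∈ U with H.Adj e f, (w U e f + 4 / 5 / β))
          * avg Ω U ω (fun σ => v (e, σ e) ^ 2) := by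
        rw [mul_sum, ← sum_add_distrib]
        refine sum_congr rfl fun e _ => ?_
        simp only [siteCoef, sum_add_distrib, sum_const, nsmul_eq_mul]
        ring
    _ ≤ _ := by
        rw [mul_sum]
        exact sum_le_sum fun e he => mul_le_mul_of_nonneg_right (hM e he) (h3 e he)

theorem Admissible.potential_le_card (hw : Admissible H β w) (hβ : 0 < β)
    (hL : ∀ e, β + H.degree e ≤ (L e).card) (v : E × K → ℝ) :
    potential H L w U ω v ≤ ((U.card : ℝ) - 1) / 10
      * ∑ e ∈ U, avg (colorings H L) U ω (fun σ => v (e, σ e) ^ 2) := by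
  refine potential_le hβ hL (fun e he => ?_) v
  have h1 : ∑ f ∈ U with H.Adj e f, (w U e f + 4 / 5 / β)
      ≤ ({f ∈ U | H.Adj e f}.card : ℝ) * (1 / 10) := by
    rw [← nsmul_eq_mul]
    exact sum_le_card_nsmul _ _ _ fun f hf => hw.le U e he f (mem_filter.1 hf).1 (mem_filter.1 hf).2
  have h2 : {f ∈ U | H.Adj e f}.card + 1 ≤ U.card := by
    rw [← card_erase_add_one he]
    gcongr
    intro f hf
    rw [mem_filter] at hf
    exact mem_erase.2 ⟨hf.2.ne', hf.1⟩
  have h3 : ({f ∈ U | H.Adj e f}.card : ℝ) + 1 ≤ U.card := by exact_mod_cast h2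
  linarith

/-- The potential of a union of separated sets is the sum of the potentials. -/
theorem Admissible.potential_union (hw : Admissible H β w) {U₁ U₂ : Finset E}
    (h : Separated H U₁ U₂) (hω : ω ∈ colorings H L) (v : E × K → ℝ) :
    potential H L w (U₁ ∪ U₂) ω v = potential H L w U₁ ω v + potential H L w U₂ ω v := by
  have key : ∀ {W W' : Finset E}, Separated H W W' → ∀ e ∈ W,
      (siteCoef H w (W ∪ W') e * avg (colorings H L) (W ∪ W') ω (fun σ => v (e, σ e) ^ 2)
        - 4 / 5 * ∑ f ∈ W ∪ W' with H.Adj e f, ∑ c,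
          avg (colorings H L) (W ∪ W') ω (defect H L e f c) * (v (e, c) * v (f, c)))
      = siteCoef H w W e * avg (colorings H L) W ω (fun σ => v (e, σ e) ^ 2)
        - 4 / 5 * ∑ f ∈ W with H.Adj e f, ∑ c,
          avg (colorings H L) W ω (defect H L e f c) * (v (e, c) * v (f, c)) := by
    intro W W' hW e he
    have h1 : {f ∈ W ∪ W' | H.Adj e f} = {f ∈ W | H.Adj e f} := by
      ext f
      simp only [mem_filter, mem_union]
      refine ⟨fun hf => ⟨hf.1.resolve_right fun hf' => hW.2 e he f hf' hf.2, hf.2⟩,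
        fun hf => ⟨Or.inl hf.1, hf.2⟩⟩
    have h2 : siteCoef H w (W ∪ W') e = siteCoef H w W e := by
      rw [siteCoef, siteCoef, h1]
      exact sum_congr rfl fun f hf =>
        hw.separated W W' hW e he f (mem_filter.1 hf).1 (mem_filter.1 hf).2
    rw [h1, h2, hW.avg_union_eq hω fun τ τ' hτ => by rw [hτ e (disjoint_left.1 hW.1 he)]]
    congr 2
    refine sum_congr rfl fun f hf => sum_congr rfl fun c _ => ?_
    rw [mem_filter] at hf
    rw [hW.avg_union_eq hω fun τ τ' hτ => defect_congr
      (fun g hg _ => hτ g fun hg' => hW.2 e he g hg' hg)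
      (fun g hg _ => hτ g fun hg' => hW.2 f hf.1 g hg' hg) c]
  rw [potential, sum_union h.1]
  congr 1
  · exact sum_congr rfl fun e he => key h e he
  · rw [union_comm]
    exact sum_congr rfl fun e he => key h.symm e he

/-- The matrix of the quadratic form given by the second moments plus the potential. -/
noncomputable def potentialMatrix (H : SimpleGraph E) [DecidableRel H.Adj] (L : E → Finset K)
    (w : Finset E → E → E → ℝ) (U : Finset E) (ω : E → K) : Matrix (E × K) (E × K) ℝ :=
  Matrix.of fun x y =>
    (if x = y then wt (colorings H L) U ω x * (1 + siteCoef H w U x.1) else 0)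
      - 4 / 5 * if x.1 ∈ U ∧ (y.1 ∈ U ∧ H.Adj x.1 y.1) ∧ x.2 = y.2 then
        avg (colorings H L) U ω (defect H L x.1 y.1 x.2) else 0

theorem potentialMatrix_isSymm : (potentialMatrix H L w U ω).IsSymm := by
  ext x y
  simp only [potentialMatrix, transpose_apply, of_apply]
  congr 1
  · by_cases hxy : x = y
    · rw [hxy]
    · rw [if_neg hxy, if_neg (Ne.symm hxy)]
  · by_cases h : x.1 ∈ U ∧ (y.1 ∈ U ∧ H.Adj x.1 y.1) ∧ x.2 = y.2
    · rw [if_pos h, if_pos ⟨h.2.1.1, ⟨h.1, h.2.1.2.symm⟩, h.2.2.symm⟩, h.2.2]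
      congr 1
      exact avg_congr fun σ _ => defect_comm _
    · rw [if_neg h, if_neg fun h' => h ⟨h'.2.1.1, ⟨h'.1, h'.2.1.2.symm⟩, h'.2.2.symm⟩]

theorem potentialMatrix_mulVec {e : E} (he : e ∈ U) (c : K) (v : E × K → ℝ) :
    (potentialMatrix H L w U ω *ᵥ v) (e, c)
      = marg (colorings H L) U ω (e, c) * (1 + siteCoef H w U e) * v (e, c)
        - 4 / 5 * ∑ f ∈ U with H.Adj e f,
          avg (colorings H L) U ω (defect H L e f c) * v (f, c) := by
  have h1 : (potentialMatrix H L w U ω *ᵥ v) (e, c)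
    = ∑ y, potentialMatrix H L w U ω (e, c) y * v y := rfl
  rw [h1]
  simp only [potentialMatrix, of_apply, sub_mul, sum_sub_distrib, ite_mul, zero_mul,
    sum_ite_eq, mem_univ, if_true, mul_assoc, ← mul_sum]
  rw [wt, if_pos he]
  congr 2
  rw [Fintype.sum_prod_type, sum_filter, ← sum_subset (subset_univ U)]
  · refine sum_congr rfl fun f hf => ?_
    by_cases hef : H.Adj e f
    · simp [he, hf, hef]
    · simp [hef]
  · intro f _ hf
    simp [hf]

end Potential

/-! ### The induction on the number of free sites -/

section Induction

open Matrix

variable {E K : Type*} [Fintype E] [DecidableEq E] [Fintype K] [DecidableEq K]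
  {H : SimpleGraph E} [DecidableRel H.Adj] {L : E → Finset K} {β : ℝ}
  {w : Finset E → E → E → ℝ} {U : Finset E} {ω : E → K}

theorem avg_defect_eq_zero (hβ : 0 < β) (hL : ∀ e, β + H.degree e ≤ (L e).card) {e f : E}
    (he : e ∈ U) (hf : f ∈ U) (hef : H.Adj e f) {c : K}
    (h : marg (colorings H L) U ω (e, c) = 0) : avg (colorings H L) U ω (defect H L e f c) = 0 := by
  have h1 := mul_avg_defect_le (σ := ω) hβ hL hef he hf c
  have h2 : 0 ≤ avg (colorings H L) U ω (defect H L e f c) :=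
    avg_nonneg fun σ _ => defect_nonneg hβ hL hef c
  rw [h] at h1
  nlinarith

theorem potentialMatrix_eq_zero (hβ : 0 < β) (hL : ∀ e, β + H.degree e ≤ (L e).card) {x : E × K}
    (hx : wt (colorings H L) U ω x = 0) (y : E × K) : potentialMatrix H L w U ω x y = 0 := by
  rw [potentialMatrix, of_apply, hx, zero_mul, ite_self, zero_sub, neg_eq_zero, mul_eq_zero]
  right
  refine ite_eq_right_iff.2 fun h => ?_
  rw [wt, if_pos h.1] at hx
  exact avg_defect_eq_zero hβ hL h.1 h.2.1.1 h.2.1.2 hx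

theorem dotProduct_potentialMatrix_mulVec (v : E × K → ℝ) :
    v ⬝ᵥ potentialMatrix H L w U ω *ᵥ v
      = ∑ e ∈ U, avg (colorings H L) U ω (fun σ => v (e, σ e) ^ 2) + potential H L w U ω v := by
  have h1 : ∀ e ∉ U, ∀ c, (potentialMatrix H L w U ω *ᵥ v) (e, c) = 0 := by
    intro e he c
    refine sum_eq_zero fun y _ => ?_
    simp [potentialMatrix, wt, he]
  rw [dotProduct, Fintype.sum_prod_type, ← sum_subset (subset_univ U) fun e _ he =>
    sum_eq_zero fun c _ => by rw [h1 e he, mul_zero], potential, ← sum_add_distrib]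
  refine sum_congr rfl fun e he => ?_
  simp only [potentialMatrix_mulVec he, avg_coord (fun x => v x ^ 2)]
  rw [sum_comm (s := {f ∈ U | H.Adj e f})]
  simp only [mul_sum, ← sum_sub_distrib, ← sum_add_distrib]
  refine sum_congr rfl fun c _ => ?_
  simp only [mul_sub, mul_sum]
  rw [← add_sub_assoc]
  congr 1
  · ring
  · exact sum_congr rfl fun f _ => by ring

/-- The deterministic inequality bounds the square of the potential by the excess. -/
theorem Admissible.sum_inv_wt_mul_sq_le (hw : Admissible H β w) (hβ : 0 < β)
    (hL : ∀ e, β + H.degree e ≤ (L e).card)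
    (hU : ∀ e ∈ U, ∀ f ∈ U, H.Adj e f → ∃ g ∈ U, g ≠ e ∧ g ≠ f ∧ (H.Adj e g ∨ H.Adj f g))
    (v : E × K → ℝ) :
    ∑ x, (wt (colorings H L) U ω x)⁻¹ * (potentialMatrix H L w U ω *ᵥ v) x ^ 2
      ≤ ∑ e ∈ U, avg (colorings H L) U ω (fun σ => v (e, σ e) ^ 2) + 2 * potential H L w U ω v
        + ∑ e ∈ U, excess H w U e * avg (colorings H L) U ω (fun σ => v (e, σ e) ^ 2) := by
  set Ω := colorings H L with hΩ
  set p : E → K → ℝ := fun e c => marg Ω U ω (e, c) with hp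
  set T : E → E → K → ℝ := fun e f c => avg Ω U ω (defect H L e f c) with hT
  set M : E → K → ℝ := fun e c => p e c * siteCoef H w U e * v (e, c)
    - 4 / 5 * ∑ f ∈ U with H.Adj e f, T e f c * v (f, c) with hM
  have hp0 : ∀ e c, 0 ≤ p e c := fun e c => marg_nonneg _
  have hT0 : ∀ e ∈ U, ∀ f ∈ U, H.Adj e f → ∀ c, p e c = 0 → T e f c = 0 :=
    fun e he f hf hef c h => avg_defect_eq_zero hβ hL he hf hef h
  have hTs : ∀ e f c, T e f c = T f e c := fun e f c => avg_congr fun σ _ => defect_comm c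
  have hM0 : ∀ e ∈ U, ∀ c, p e c = 0 → M e c = 0 := by
    intro e he c h
    have : ∑ f ∈ U with H.Adj e f, T e f c * v (f, c) = 0 := sum_eq_zero fun f hf => by
      rw [hT0 e he f (mem_filter.1 hf).1 (mem_filter.1 hf).2 c h, zero_mul]
    simp only [hM, h, this]
    ring
  have hpot : ∑ e ∈ U, ∑ c, v (e, c) * M e c = potential H L w U ω v := by
    have h1 : ∑ e ∈ U, ∑ c, p e c * v (e, c) ^ 2
        = ∑ e ∈ U, avg Ω U ω (fun σ => v (e, σ e) ^ 2) :=
      sum_congr rfl fun e _ => (avg_coord (fun x => v x ^ 2) e).symm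
    have h2 : v ⬝ᵥ potentialMatrix H L w U ω *ᵥ v = ∑ e ∈ U, ∑ c, p e c * v (e, c) ^ 2
        + ∑ e ∈ U, ∑ c, v (e, c) * M e c := by
      rw [dotProduct, Fintype.sum_prod_type, ← sum_subset (subset_univ U) fun e _ he =>
        sum_eq_zero fun c _ => by
          have h1 : (potentialMatrix H L w U ω *ᵥ v) (e, c) = 0 :=
            sum_eq_zero fun y _ => by simp [potentialMatrix, wt, he]
          rw [h1, mul_zero], ← sum_add_distrib]
      refine sum_congr rfl fun e he => ?_
      rw [← sum_add_distrib]
      refine sum_congr rfl fun c _ => ?_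
      rw [potentialMatrix_mulVec he]
      simp only [hM, hp, hT, hΩ]
      ring
    rw [dotProduct_potentialMatrix_mulVec, h1] at h2
    linarith
  have hlhs : ∑ x, (wt Ω U ω x)⁻¹ * (potentialMatrix H L w U ω *ᵥ v) x ^ 2
      = ∑ e ∈ U, ∑ c, (p e c)⁻¹ * (p e c * v (e, c) + M e c) ^ 2 := by
    rw [Fintype.sum_prod_type, ← sum_subset (subset_univ U) fun e _ he =>
      sum_eq_zero fun c _ => by rw [wt, if_neg he, _root_.inv_zero, zero_mul]]
    refine sum_congr rfl fun e he => sum_congr rfl fun c _ => ?_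
    rw [potentialMatrix_mulVec he, wt, if_pos he]
    congr 2
    simp only [hM, hp, hT, hΩ]
    ring
  have hexp : ∑ e ∈ U, ∑ c, (p e c)⁻¹ * (p e c * v (e, c) + M e c) ^ 2
      = ∑ e ∈ U, ∑ c, p e c * v (e, c) ^ 2 + 2 * ∑ e ∈ U, ∑ c, v (e, c) * M e c
        + ∑ e ∈ U, ∑ c, (p e c)⁻¹ * M e c ^ 2 := by
    simp only [mul_sum, ← sum_add_distrib]
    refine sum_congr rfl fun e he => sum_congr rfl fun c _ => ?_
    by_cases h : p e c = 0
    · simp [h, hM0 e he c h]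
    · field_simp
      ring
  have hmain : ∑ e ∈ U, ∑ c, (p e c)⁻¹ * M e c ^ 2
      ≤ ∑ e ∈ U, excess H w U e * avg Ω U ω (fun σ => v (e, σ e) ^ 2) := by
    have h1 : ∀ c, ∑ e ∈ U, (p e c)⁻¹ * M e c ^ 2
        ≤ ∑ e ∈ U, excess H w U e * (p e c * v (e, c) ^ 2) := by
      intro c
      set s : E → ℝ := fun e => Real.sqrt (p e c) with hs
      have hs2 : ∀ e, s e * s e = p e c := fun e => Real.mul_self_sqrt (hp0 e c)
      have hs0 : ∀ e, s e = 0 ↔ p e c = 0 := fun e => Real.sqrt_eq_zero (hp0 e c)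
      have hsn : ∀ e, 0 ≤ s e := fun e => Real.sqrt_nonneg _
      have h2 := hw.sq_le U hU (fun e f => T e f c / (s e * s f)) (fun e he f hf hef => by
        have ht : 0 ≤ T e f c := avg_nonneg fun σ _ => defect_nonneg hβ hL hef c
        refine ⟨div_nonneg ht (mul_nonneg (hsn e) (hsn f)), ?_⟩
        refine div_le_of_le_mul₀ (mul_nonneg (hsn e) (hsn f)) (by positivity) ?_
        have h3 : β * T e f c ≤ s e * s e := by
          rw [hs2]
          exact mul_avg_defect_le hβ hL hef he hf c
        have h4 : β * T e f c ≤ s f * s f := by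
          rw [hs2, hTs]
          exact mul_avg_defect_le hβ hL hef.symm hf he c
        have h5 : (β * T e f c) ^ 2 ≤ (s e * s f) ^ 2 := by
          calc (β * T e f c) ^ 2 = (β * T e f c) * (β * T e f c) := sq _
            _ ≤ (s e * s e) * (s f * s f) :=
              mul_le_mul h3 h4 (by positivity) (mul_self_nonneg _)
            _ = _ := by ring
        have h6 := abs_le_of_sq_le_sq h5 (mul_nonneg (hsn e) (hsn f))
        rw [one_div, le_inv_mul_iff₀ hβ]
        exact (le_abs_self _).trans h6) (fun e => s e * v (e, c))
      have h3 : ∀ e ∈ U, (p e c)⁻¹ * M e c ^ 2 = (siteCoef H w U e * (s e * v (e, c))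
          - 4 / 5 * ∑ f ∈ U with H.Adj e f, T e f c / (s e * s f) * (s f * v (f, c))) ^ 2 := by
        intro e he
        have h4 : ∀ f ∈ U.filter (H.Adj e), T e f c / (s e * s f) * (s f * v (f, c))
            = (s e)⁻¹ * (T e f c * v (f, c)) := by
          intro f hf
          rw [mem_filter] at hf
          by_cases h5 : s f = 0
          · have : T e f c = 0 := by
              rw [hTs]
              exact hT0 f hf.1 e he hf.2.symm c ((hs0 f).1 h5)
            simp [this]
          · by_cases h6 : s e = 0
            · simp [h6]
            · field_simp
        rw [sum_congr rfl h4, ← mul_sum]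
        by_cases h5 : s e = 0
        · have h6 := (hs0 e).1 h5
          simp [h6, h5]
        · rw [← hs2 e]
          simp only [hM, ← hs2]
          field_simp
      rw [sum_congr rfl h3]
      refine h2.trans (le_of_eq (sum_congr rfl fun e _ => ?_))
      rw [← hs2 e]
      ring
    calc ∑ e ∈ U, ∑ c, (p e c)⁻¹ * M e c ^ 2 = ∑ c, ∑ e ∈ U, (p e c)⁻¹ * M e c ^ 2 := sum_comm
      _ ≤ ∑ c, ∑ e ∈ U, excess H w U e * (p e c * v (e, c) ^ 2) := sum_le_sum fun c _ => h1 c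
      _ = ∑ e ∈ U, ∑ c, excess H w U e * (p e c * v (e, c) ^ 2) := sum_comm
      _ = _ := sum_congr rfl fun e _ => by rw [avg_coord (fun x => v x ^ 2), mul_sum]
  have h1 : ∑ e ∈ U, ∑ c, p e c * v (e, c) ^ 2
      = ∑ e ∈ U, avg Ω U ω (fun σ => v (e, σ e) ^ 2) :=
    sum_congr rfl fun e _ => (avg_coord (fun x => v x ^ 2) e).symm
  rw [hlhs, hexp, hpot, h1]
  linarith

/-- The trickle-down step. -/
theorem Admissible.var_lin_le_of_erase (hw : Admissible H β w) (hβ : 3 ≤ β)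
    (hL : ∀ e, β + H.degree e ≤ (L e).card) (hω : ω ∈ colorings H L) (hcard : 3 ≤ U.card)
    (hU : ∀ e ∈ U, ∀ f ∈ U, H.Adj e f → ∃ g ∈ U, g ≠ e ∧ g ≠ f ∧ (H.Adj e g ∨ H.Adj f g))
    (h : ∀ g ∈ U, ∀ σ ∈ colorings H L, ∀ v, var (colorings H L) (U.erase g) σ (lin v)
      ≤ ∑ e ∈ U.erase g, avg (colorings H L) (U.erase g) σ (fun τ => v (e, τ e) ^ 2)
        + potential H L w (U.erase g) σ v) (v : E × K → ℝ) :
    var (colorings H L) U ω (lin v)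
      ≤ ∑ e ∈ U, avg (colorings H L) U ω (fun σ => v (e, σ e) ^ 2) + potential H L w U ω v := by
  have hβ0 : 0 < β := by linarith
  set Ω := colorings H L with hΩ
  set k : ℝ := (U.card : ℝ) with hk
  have hk3 : 3 ≤ k := by rw [hk]; exact_mod_cast hcard
  have hwt : ∀ v : E × K → ℝ, ∑ x, wt Ω U ω x * v x ^ 2
      = ∑ e ∈ U, avg Ω U ω (fun σ => v (e, σ e) ^ 2) := fun v => sum_wt_mul fun x => v x ^ 2
  have hdeg : ∀ e, H.degree e + 3 ≤ (L e).card := by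
    intro e
    have h1 : ((H.degree e + 3 : ℕ) : ℝ) ≤ (L e).card := by
      push_cast
      linarith [hL e]
    exact_mod_cast h1
  have hcov : ∀ v, var Ω U ω (lin v) ≤ (k + 8) / 9 * ∑ x, wt Ω U ω x * v x ^ 2 := by
    refine var_lin_le_of_var_erase_le (m := (k - 2) / 10) hω hcard (linked_colorings hdeg hω)
      (by linarith) (by linarith) (by rw [← hk]; linarith) (by rw [← hk]; nlinarith) ?_
    intro g hg σ hσ v
    refine (h g hg σ (mem_fiber.1 hσ).1 v).trans ?_
    have h1 := hw.potential_le_card (U := U.erase g) (ω := σ) hβ0 hL v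
    rw [card_erase_of_mem hg, Nat.cast_sub (by omega), Nat.cast_one, ← hk] at h1
    linarith
  rw [← dotProduct_potentialMatrix_mulVec]
  refine var_lin_le_of_sum_avg_var_le hω potentialMatrix_isSymm
    (fun x y hx => potentialMatrix_eq_zero hβ0 hL hx y) (fun v => ?_)
    (k' := (k + 8) / 9 + (1 + (k - 1) / 10)) (by rw [← hk]; linarith) (fun v => ?_) v
  · have h1 : ∑ g ∈ U, avg Ω U ω (fun σ => var Ω (U.erase g) σ (lin v))
        ≤ ∑ g ∈ U, (∑ e ∈ U.erase g, avg Ω U ω (fun σ => v (e, σ e) ^ 2)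
          + avg Ω U ω (fun σ => potential H L w (U.erase g) σ v)) := by
      refine sum_le_sum fun g hg => ?_
      refine (avg_mono fun σ hσ => h g hg σ (mem_fiber.1 hσ).1 v).trans (le_of_eq ?_)
      rw [avg_add, avg_sum]
      congr 1
      exact sum_congr rfl fun e _ => avg_avg (erase_subset g U)
    have h2 : ∑ g ∈ U, ∑ e ∈ U.erase g, avg Ω U ω (fun σ => v (e, σ e) ^ 2)
        = (k - 1) * ∑ e ∈ U, avg Ω U ω (fun σ => v (e, σ e) ^ 2) := by
      rw [sum_erase_comm, mul_sum]
      refine sum_congr rfl fun e he => ?_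
      rw [sum_const, nsmul_eq_mul, card_erase_of_mem he, Nat.cast_sub (by omega), Nat.cast_one]
    rw [sum_add_distrib, h2, sum_avg_potential, ← hΩ, ← hk] at h1
    have h3 := hw.sum_inv_wt_mul_sq_le (ω := ω) hβ0 hL hU v
    rw [← hΩ] at h3
    rw [dotProduct_potentialMatrix_mulVec, ← hΩ, ← hk]
    linarith
  · have h1 := hw.potential_le_card (U := U) (ω := ω) hβ0 hL v
    have h2 := hcov v
    rw [dotProduct_potentialMatrix_mulVec, ← hΩ, hwt] at *
    linarith

/-- The variance of a statistic is at most the sum of the second moments plus the potential. -/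
theorem Admissible.var_lin_le (hw : Admissible H β w) (hβ : 3 ≤ β)
    (hL : ∀ e, β + H.degree e ≤ (L e).card) (U : Finset E) (hω : ω ∈ colorings H L)
    (v : E × K → ℝ) : var (colorings H L) U ω (lin v)
      ≤ ∑ e ∈ U, avg (colorings H L) U ω (fun σ => v (e, σ e) ^ 2) + potential H L w U ω v := by
  have hβ0 : 0 < β := by linarith
  induction hn : U.card using Nat.strong_induction_on generalizing U ω v with
  | _ n ih =>
  -- the bound for separated parts is inherited by their union
  have hsplit : ∀ U₁ ⊆ U, U₁.Nonempty → U₁ ≠ U → Separated H U₁ (U \ U₁) →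
      var (colorings H L) U ω (lin v)
        ≤ ∑ e ∈ U, avg (colorings H L) U ω (fun σ => v (e, σ e) ^ 2) + potential H L w U ω v := by
    intro U₁ hsub hne hneU hsep
    have hU : U₁ ∪ (U \ U₁) = U := union_sdiff_of_subset hsub
    have hlt : U₁.card < U.card := card_lt_card (ssubset_of_subset_of_ne hsub hneU)
    have h1 := ih U₁.card (by omega) U₁ hω v rfl
    have h2 := ih (U \ U₁).card (by
      have := card_sdiff_add_card_eq_card hsub
      have := card_pos.2 hne
      omega) (U \ U₁) hω v rfl
    have h3 := hsep.var_lin_union hω v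
    have h4 := hw.potential_union hsep hω v
    have h5 : ∀ {W W' : Finset E}, Separated H W W' → ∀ e ∈ W,
        avg (colorings H L) (W ∪ W') ω (fun σ => v (e, σ e) ^ 2)
          = avg (colorings H L) W ω (fun σ => v (e, σ e) ^ 2) := fun {W W'} hW e he =>
      hW.avg_union_eq hω fun τ τ' hτ => by rw [hτ e (disjoint_left.1 hW.1 he)]
    have h6 : ∑ e ∈ U, avg (colorings H L) U ω (fun σ => v (e, σ e) ^ 2)
        = ∑ e ∈ U₁, avg (colorings H L) U₁ ω (fun σ => v (e, σ e) ^ 2)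
          + ∑ e ∈ U \ U₁, avg (colorings H L) (U \ U₁) ω (fun σ => v (e, σ e) ^ 2) := by
      have h7 := sum_union hsep.1 (f := fun e =>
        avg (colorings H L) (U₁ ∪ (U \ U₁)) ω (fun σ => v (e, σ e) ^ 2))
      rw [sum_congr rfl (h5 hsep), union_comm U₁, sum_congr rfl (h5 hsep.symm), union_comm _ U₁,
        hU] at h7
      exact h7
    rw [hU] at h3 h4
    rw [h3, h4, h6]
    linarith
  by_cases hiso : ∃ e ∈ U, (∃ g ∈ U, g ≠ e) ∧ ∀ f ∈ U, ¬ H.Adj e f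
  · obtain ⟨e, he, ⟨g, hg, hge⟩, hef⟩ := hiso
    refine hsplit {e} (singleton_subset_iff.2 he) (singleton_nonempty e) ?_
      ⟨disjoint_sdiff, fun e' he' f hf => ?_⟩
    · rintro rfl
      exact hge (mem_singleton.1 hg)
    · rw [mem_singleton.1 he']
      exact hef f (mem_sdiff.1 hf).1
  by_cases hpair : ∃ e ∈ U, ∃ f ∈ U, H.Adj e f ∧
      ∀ g ∈ U, g ≠ e → g ≠ f → ¬ H.Adj e g ∧ ¬ H.Adj f g
  · obtain ⟨e, he, f, hf, hef, hg⟩ := hpair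
    have hsub : {e, f} ⊆ U := by
      intro g hg
      rcases mem_insert.1 hg with rfl | hg
      · exact he
      · rwa [mem_singleton.1 hg]
    by_cases hU : {e, f} = U
    · rw [← hU]
      refine (var_lin_pair_le hβ0 hL hef hω v).trans ?_
      have h1 : ({e, f} : Finset E).filter (H.Adj e) = {f} := by
        ext g
        simp only [mem_filter, mem_insert, mem_singleton]
        constructor
        · rintro ⟨rfl | rfl, h⟩
          · exact absurd h (H.loopless.irrefl _)
          · rfl
        · rintro rfl
          exact ⟨Or.inr rfl, hef⟩
      have h2 : ({e, f} : Finset E).filter (H.Adj f) = {e} := by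
        ext g
        simp only [mem_filter, mem_insert, mem_singleton]
        constructor
        · rintro ⟨rfl | rfl, h⟩
          · rfl
          · exact absurd h (H.loopless.irrefl _)
        · rintro rfl
          exact ⟨Or.inl rfl, hef.symm⟩
      have h3 : ∀ c, avg (colorings H L) {e, f} ω (defect H L e f c) = defect H L e f c ω := by
        intro c
        rw [← avg_const hω (defect H L e f c ω) (U := {e, f})]
        exact avg_congr fun σ hσ => defect_congr
          (fun g hg hgf => (mem_fiber.1 hσ).2 g (by simp [hgf, hg.ne']))
          (fun g hg hge => (mem_fiber.1 hσ).2 g (by simp [hge, hg.ne'])) c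
      have h4 : ∀ c, avg (colorings H L) {e, f} ω (defect H L f e c) = defect H L e f c ω := by
        intro c
        rw [← h3]
        exact avg_congr fun σ _ => defect_comm c
      have h5 := hw.pair e f hef
      have h6 := hw.pair f e hef.symm
      rw [pair_comm] at h6
      rw [potential, sum_pair hef.ne, sum_pair hef.ne]
      simp only [siteCoef, h1, h2, sum_singleton, h3, h4, mul_comm (v (f, _))]
      have h7 : 0 ≤ avg (colorings H L) {e, f} ω (fun σ => v (e, σ e) ^ 2) :=
        avg_nonneg fun _ _ => sq_nonneg _
      have h8 : 0 ≤ avg (colorings H L) {e, f} ω (fun σ => v (f, σ f) ^ 2) :=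
        avg_nonneg fun _ _ => sq_nonneg _
      have h9 := mul_le_mul_of_nonneg_right h5 h7
      have h10 := mul_le_mul_of_nonneg_right h6 h8
      linarith
    · refine hsplit {e, f} hsub ⟨e, mem_insert_self e _⟩ hU ⟨disjoint_sdiff, fun e' he' g hg' => ?_⟩
      simp only [mem_sdiff, mem_insert, mem_singleton, not_or] at hg'
      rcases mem_insert.1 he' with rfl | he'
      · exact (hg g hg'.1 hg'.2.1 hg'.2.2).1
      · rw [mem_singleton.1 he']
        exact (hg g hg'.1 hg'.2.1 hg'.2.2).2
  push Not at hiso hpair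
  have hU : ∀ e ∈ U, ∀ f ∈ U, H.Adj e f →
      ∃ g ∈ U, g ≠ e ∧ g ≠ f ∧ (H.Adj e g ∨ H.Adj f g) := by
    intro e he f hf hef
    obtain ⟨g, hg, hge, hgf, h⟩ := hpair e he f hf hef
    exact ⟨g, hg, hge, hgf, by tauto⟩
  rcases lt_or_ge U.card 3 with hlt | hge
  · -- at most one vertex is left
    have hcard : U.card ≤ 1 := by
      by_contra! h2
      obtain ⟨e, he, f, hf, hef⟩ := one_lt_card.1 h2
      obtain ⟨g, hg, heg⟩ := hiso e he ⟨f, hf, hef.symm⟩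
      obtain ⟨g', hg', h1, h3, _⟩ := hU e he g hg heg
      have h4 : ({e, g, g'} : Finset E) ⊆ U := by
        intro x hx
        simp only [mem_insert, mem_singleton] at hx
        rcases hx with rfl | rfl | rfl <;> assumption
      have h5 := card_le_card h4
      rw [card_eq_three.2 ⟨e, g, g', heg.ne, h1.symm, h3.symm, rfl⟩] at h5
      omega
    have hpot : potential H L w U ω v = 0 := by
      refine sum_eq_zero fun e he => ?_
      have : U.filter (H.Adj e) = ∅ := filter_eq_empty_iff.2 fun f hf hef =>
        hef.ne (card_le_one.1 hcard e he f hf)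
      simp [siteCoef, this]
    rw [hpot, add_zero]
    have h1 : var (colorings H L) U ω (lin v)
        = var (colorings H L) U ω (fun σ => ∑ e ∈ U, v (e, σ e)) := by
      rw [← var_add_const hω (∑ e ∈ Uᶜ, v (e, ω e)) (φ := fun σ => ∑ e ∈ U, v (e, σ e))]
      refine var_congr fun σ hσ => ?_
      rw [lin, ← sum_add_sum_compl U]
      congr 1
      exact sum_congr rfl fun g hg => by rw [(mem_fiber.1 hσ).2 g (mem_compl.1 hg)]
    rw [h1, var, ← avg_sum]
    refine (sub_le_self _ (sq_nonneg _)).trans (avg_mono fun σ _ => ?_)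
    have h2 := sq_sum_le_card_mul_sum_sq (s := U) (f := fun e => v (e, σ e))
    have h3 : (U.card : ℝ) ≤ 1 := by exact_mod_cast hcard
    have h4 : 0 ≤ ∑ e ∈ U, v (e, σ e) ^ 2 := sum_nonneg fun _ _ => sq_nonneg _
    nlinarith
  · exact hw.var_lin_le_of_erase hβ hL hω hge hU
      (fun g hg σ hσ v => ih (U.erase g).card (by
        rw [card_erase_of_mem hg]
        omega) (U.erase g) hσ v rfl) v

end Induction

/-! ### The deterministic inequality on line graphs -/

section Clique

variable {E : Type*} [DecidableEq E]

theorem sum_add_sq_le {C : Finset E} {x y : E → ℝ} {p q n : ℝ} (hp : 0 ≤ p) (hq : 0 ≤ q)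
    (hn : 0 ≤ n) (hx : ∑ e ∈ C, x e ^ 2 ≤ p ^ 2 * n) (hy : ∑ e ∈ C, y e ^ 2 ≤ q ^ 2 * n) :
    ∑ e ∈ C, (x e + y e) ^ 2 ≤ (p + q) ^ 2 * n := by
  have h1 : (∑ e ∈ C, x e * y e) ^ 2 ≤ (p * q * n) ^ 2 := by
    calc _ ≤ (∑ e ∈ C, x e ^ 2) * ∑ e ∈ C, y e ^ 2 := sum_mul_sq_le_sq_mul_sq ..
      _ ≤ (p ^ 2 * n) * (q ^ 2 * n) :=
        mul_le_mul hx hy (sum_nonneg fun _ _ => sq_nonneg _) (by positivity)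
      _ = _ := by ring
  have h2 := (le_abs_self _).trans (abs_le_of_sq_le_sq h1 (by positivity))
  have h3 : ∑ e ∈ C, (x e + y e) ^ 2
      = ∑ e ∈ C, x e ^ 2 + 2 * ∑ e ∈ C, x e * y e + ∑ e ∈ C, y e ^ 2 := by
    rw [mul_sum, ← sum_add_distrib, ← sum_add_distrib]
    exact sum_congr rfl fun e _ => by ring
  rw [h3]
  linarith

/-- On a clique with `s` elements, an operator `φ - (4 / 5) κ`, where `κ` has zero diagonal and
entries in `[0, 1 / β]` off it, has norm at most `φ + 2 s / (5 β)`, provided that `φ` is not too small. The reason is that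
off the diagonal `κ` is the constant `1 / (2 β)` up to an error of norm `(s - 1) / (2 β)`. -/
theorem sum_clique_sq_le {C : Finset E} {β φ : ℝ} (hβ : 0 < β)
    (hφ : ((C.card : ℝ) - 2) / (5 * β) ≤ φ) {κ : E → E → ℝ}
    (hκ : ∀ e ∈ C, ∀ f ∈ C, e ≠ f → 0 ≤ κ e f ∧ κ e f ≤ 1 / β) (z : E → ℝ) :
    ∑ e ∈ C, (φ * z e - 4 / 5 * ∑ f ∈ C.erase e, κ e f * z f) ^ 2
      ≤ (φ + 2 * (C.card : ℝ) / (5 * β)) ^ 2 * ∑ e ∈ C, z e ^ 2 := by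
  rcases C.eq_empty_or_nonempty with rfl | hC
  · simp
  set s : ℝ := (C.card : ℝ) with hs
  have hs1 : 1 ≤ s := by
    rw [hs]
    exact_mod_cast card_pos.2 hC
  set n := ∑ e ∈ C, z e ^ 2 with hn
  have hn0 : 0 ≤ n := sum_nonneg fun _ _ => sq_nonneg _
  set Z := ∑ e ∈ C, z e with hZ
  set ψ : ℝ := 2 / (5 * β) with hψ
  have hψ0 : 0 < ψ := by positivity
  have hφ' : s * ψ ≤ 2 * (φ + ψ) := by
    have h1 : (s - 2) / (5 * β) = (s * ψ - 2 * ψ) / 2 := by rw [hψ]; field_simp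
    linarith
  have hp : 0 ≤ φ + ψ := by nlinarith
  set y : E → ℝ := fun e => - (4 / 5 * ∑ f ∈ C.erase e, (κ e f - 1 / (2 * β)) * z f) with hy
  have hsplit : ∀ e ∈ C, φ * z e - 4 / 5 * ∑ f ∈ C.erase e, κ e f * z f
      = ((φ + ψ) * z e - ψ * Z) + y e := by
    intro e he
    have h1 : Z = z e + ∑ f ∈ C.erase e, z f := (add_sum_erase _ _ he).symm
    simp only [hy, sub_mul, sum_sub_distrib, ← mul_sum]
    rw [h1, hψ]
    field_simp
    ring
  have hx : ∑ e ∈ C, ((φ + ψ) * z e - ψ * Z) ^ 2 ≤ (φ + ψ) ^ 2 * n := by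
    have h1 : ∑ e ∈ C, ((φ + ψ) * z e - ψ * Z) ^ 2
        = (φ + ψ) ^ 2 * n - (2 * (φ + ψ) - s * ψ) * (ψ * Z ^ 2) := by
      have h2 : ∀ e, ((φ + ψ) * z e - ψ * Z) ^ 2
          = (φ + ψ) ^ 2 * z e ^ 2 - 2 * (φ + ψ) * ψ * Z * z e + ψ ^ 2 * Z ^ 2 := fun e => by ring
      simp only [h2, sum_add_distrib, sum_sub_distrib, ← mul_sum, sum_const, nsmul_eq_mul,
        ← hs, ← hn, ← hZ]
      ring
    rw [h1]
    have : 0 ≤ (2 * (φ + ψ) - s * ψ) * (ψ * Z ^ 2) :=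
      mul_nonneg (by linarith) (by positivity)
    linarith
  have hcard : ∀ e ∈ C, ((C.erase e).card : ℝ) = s - 1 := fun e he => by
    rw [card_erase_of_mem he, Nat.cast_sub (card_pos.2 hC), Nat.cast_one]
  have hyb : ∑ e ∈ C, y e ^ 2 ≤ (ψ * (s - 1)) ^ 2 * n := by
    have h1 : ∀ e ∈ C, y e ^ 2 ≤ ψ ^ 2 * ((s - 1) * ∑ f ∈ C.erase e, z f ^ 2) := by
      intro e he
      have h2 := sq_sum_le_card_mul_sum_sq (s := C.erase e)
        (f := fun f => (κ e f - 1 / (2 * β)) * z f)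
      rw [hcard e he] at h2
      have h3 : ∑ f ∈ C.erase e, ((κ e f - 1 / (2 * β)) * z f) ^ 2
          ≤ (1 / (2 * β)) ^ 2 * ∑ f ∈ C.erase e, z f ^ 2 := by
        rw [mul_sum]
        refine sum_le_sum fun f hf => ?_
        rw [mem_erase] at hf
        obtain ⟨h4, h5⟩ := hκ e he f hf.2 hf.1.symm
        rw [mul_pow]
        refine mul_le_mul_of_nonneg_right ?_ (sq_nonneg _)
        have h6 : 1 / β = 1 / (2 * β) + 1 / (2 * β) := by field_simp; ring
        refine sq_le_sq' ?_ ?_ <;> linarith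
      calc y e ^ 2 = (4 / 5) ^ 2 * (∑ f ∈ C.erase e, (κ e f - 1 / (2 * β)) * z f) ^ 2 := by
            simp only [hy]
            ring
        _ ≤ (4 / 5) ^ 2 * ((s - 1) * ((1 / (2 * β)) ^ 2 * ∑ f ∈ C.erase e, z f ^ 2)) := by
            refine mul_le_mul_of_nonneg_left (h2.trans ?_) (by positivity)
            exact mul_le_mul_of_nonneg_left h3 (by linarith)
        _ = _ := by
            rw [hψ]
            field_simp
            ring
    have h2 : ∑ e ∈ C, ∑ f ∈ C.erase e, z f ^ 2 = (s - 1) * n := by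
      have h3 : ∀ e ∈ C, ∑ f ∈ C.erase e, z f ^ 2 = n - z e ^ 2 := fun e he => by
        rw [hn, ← add_sum_erase _ _ he]
        ring
      rw [sum_congr rfl h3, sum_sub_distrib, sum_const, nsmul_eq_mul, ← hs, ← hn]
      ring
    calc ∑ e ∈ C, y e ^ 2 ≤ ∑ e ∈ C, ψ ^ 2 * ((s - 1) * ∑ f ∈ C.erase e, z f ^ 2) :=
          sum_le_sum h1
      _ = _ := by
          rw [← mul_sum, ← mul_sum, h2]
          ring
  rw [sum_congr rfl fun e he => by rw [hsplit e he]]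
  have h1 := sum_add_sq_le hp (mul_nonneg hψ0.le (by linarith : 0 ≤ s - 1)) hn0 hx hyb
  have h2 : φ + 2 * s / (5 * β) = φ + ψ + ψ * (s - 1) := by
    rw [hψ]
    field_simp
    ring
  rw [h2]
  exact h1

theorem sum_sub_erase (W X : Finset E) (r : ℕ → ℝ) :
    ∑ g ∈ W, (r X.card - r (X.erase g).card)
      = ((X ∩ W).card : ℝ) * (r X.card - r (X.card - 1)) := by
  have h1 : ∀ g ∈ W, r X.card - r (X.erase g).card
      = if g ∈ X then r X.card - r (X.card - 1) else 0 := by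
    intro g _
    split_ifs with hg
    · rw [card_erase_of_mem hg]
    · rw [erase_eq_of_notMem hg, sub_self]
  rw [sum_congr rfl h1, ← sum_filter, sum_const, nsmul_eq_mul, filter_mem_eq_inter, inter_comm]

end Clique

section LineGraph

variable {V E : Type*} [Fintype V] [DecidableEq V] [Fintype E] [DecidableEq E]
  {H : SimpleGraph E} [DecidableRel H.Adj] {S : V → Finset E} {U : Finset E}

/-- `H` is the line graph of a simple graph with edge set `E` in which `S u` is the set of edges at
the vertex `u`. -/
structure IsLineGraph (H : SimpleGraph E) (S : V → Finset E) : Prop where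
  card_ends : ∀ e, ({u | e ∈ S u} : Finset V).card = 2
  adj_iff : ∀ e f, H.Adj e f ↔ e ≠ f ∧ ∃ u, e ∈ S u ∧ f ∈ S u
  eq_of_mem : ∀ e f, e ≠ f → ∀ u u', e ∈ S u → f ∈ S u → e ∈ S u' → f ∈ S u' → u = u'

theorem IsLineGraph.sum_adj (hS : IsLineGraph H S) {M : Type*} [AddCommMonoid M] (e : E)
    (φ : E → M) : ∑ f ∈ U with H.Adj e f, φ f
      = ∑ u with e ∈ S u, ∑ f ∈ (U ∩ S u).erase e, φ f := by
  rw [← sum_biUnion]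
  · refine sum_congr ?_ fun _ _ => rfl
    ext f
    simp only [mem_filter, hS.adj_iff, mem_biUnion, mem_univ, true_and, mem_erase, mem_inter]
    constructor
    · rintro ⟨hf, hef, u, heu, hfu⟩
      exact ⟨u, heu, hef.symm, hf, hfu⟩
    · rintro ⟨u, heu, hef, hf, hfu⟩
      exact ⟨hf, hef.symm, u, heu, hfu⟩
  · intro u hu u' hu' huu
    refine disjoint_left.2 fun f hf hf' => huu ?_
    simp only [coe_filter, mem_univ, true_and, Set.mem_ofPred_eq] at hu hu'
    simp only [mem_erase, mem_inter] at hf hf'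
    exact hS.eq_of_mem e f hf.1.symm u u' hu hf.2.2 hu' hf'.2.2

/-- The vertices of `U` other than `e` and `f` that are adjacent to `e` or to `f`. -/
def pairNbrs (H : SimpleGraph E) [DecidableRel H.Adj] (U : Finset E) (e f : E) : Finset E :=
  {g ∈ U | g ≠ e ∧ g ≠ f ∧ (H.Adj e g ∨ H.Adj f g)}

/-- The pair weights. The main part is a function `γ` of the number of edges of `U` at the common
end of `e` and `f`; the small harmonic part has excess exactly `η`, however few neighbors the pair
has. -/
noncomputable def pairWeight (H : SimpleGraph E) [DecidableRel H.Adj] (S : V → Finset E)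
    (γ : ℕ → ℝ) (η : ℝ) (U : Finset E) (e f : E) : ℝ :=
  ∑ u with e ∈ S u ∧ f ∈ S u, γ (U ∩ S u).card + η * (harmonic (pairNbrs H U e f).card : ℝ)

variable {γ : ℕ → ℝ} {η : ℝ}

theorem IsLineGraph.pairWeight_eq (hS : IsLineGraph H S) {e f : E} (hef : e ≠ f) {u : V}
    (he : e ∈ S u) (hf : f ∈ S u) (U : Finset E) : pairWeight H S γ η U e f
      = γ (U ∩ S u).card + η * (harmonic (pairNbrs H U e f).card : ℝ) := by
  have h1 : ({u | e ∈ S u ∧ f ∈ S u} : Finset V) = {u} := by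
    ext u'
    simp only [mem_filter, mem_univ, true_and, mem_singleton]
    constructor
    · rintro ⟨h1, h2⟩
      exact hS.eq_of_mem e f hef u' u h1 h2 he hf
    · rintro rfl
      exact ⟨he, hf⟩
  rw [pairWeight, h1, sum_singleton]

theorem erase_inter_eq (g : E) (T : Finset E) : U.erase g ∩ T = (U ∩ T).erase g := by
  ext x
  simp only [mem_inter, mem_erase]
  tauto

theorem pairNbrs_erase (g e f : E) : pairNbrs H (U.erase g) e f = (pairNbrs H U e f).erase g := by
  ext x
  simp only [pairNbrs, mem_filter, mem_erase]
  tauto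

theorem IsLineGraph.sum_pairWeight_sub (hS : IsLineGraph H S) {e f : E} (hef : e ≠ f) {u : V}
    (he : e ∈ U ∩ S u) (hf : f ∈ U ∩ S u) (hne : (pairNbrs H U e f).Nonempty) :
    ∑ g ∈ (U.erase e).erase f, (pairWeight H S γ η U e f - pairWeight H S γ η (U.erase g) e f)
      = (((U ∩ S u).card : ℝ) - 2) * (γ (U ∩ S u).card - γ ((U ∩ S u).card - 1)) + η := by
  rw [mem_inter] at he hf
  have h1 : ∀ g, pairWeight H S γ η U e f - pairWeight H S γ η (U.erase g) e f
      = (γ (U ∩ S u).card - γ ((U ∩ S u).erase g).card)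
        + η * ((harmonic (pairNbrs H U e f).card : ℝ)
          - (harmonic ((pairNbrs H U e f).erase g).card : ℝ)) := by
    intro g
    rw [hS.pairWeight_eq hef he.2 hf.2, hS.pairWeight_eq hef he.2 hf.2, erase_inter_eq,
      pairNbrs_erase]
    ring
  simp only [h1, sum_add_distrib, ← mul_sum]
  rw [sum_sub_erase, sum_sub_erase _ _ fun n => (harmonic n : ℝ)]
  have h2 : ((U ∩ S u) ∩ (U.erase e).erase f) = ((U ∩ S u).erase e).erase f := by
    ext x
    simp only [mem_inter, mem_erase]
    tauto
  have h3 : pairNbrs H U e f ∩ (U.erase e).erase f = pairNbrs H U e f := by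
    ext x
    simp only [pairNbrs, mem_inter, mem_erase, mem_filter]
    tauto
  have hpos := card_pos.2 hne
  rw [h2, h3, cast_card_erase_erase (mem_inter.2 he) (mem_inter.2 hf) hef]
  congr 1
  obtain ⟨n, hn⟩ : ∃ n, (pairNbrs H U e f).card = n + 1 := ⟨_, (Nat.sub_add_cancel hpos).symm⟩
  rw [hn, harmonic_succ, Nat.add_sub_cancel]
  push_cast
  field_simp
  ring

/-- Numerical conditions on the pair weights of a line graph of a graph with maximum degree `D`. The
recursion is `clique`, for a star with `s` edges; half of the excess `η` is used there, and the other
half pays in `error` for the harmonic parts. -/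
structure GoodWeights (D : ℕ) (β δ η Λ : ℝ) (γ : ℕ → ℝ) : Prop where
  β_pos : 0 < β
  δ_pos : 0 < δ
  η_nonneg : 0 ≤ η
  harmonic_le : ∀ n ≤ 3 * D, (harmonic n : ℝ) ≤ Λ
  le_γ : ∀ s ≤ D, 1 / (5 * β) ≤ γ s
  pair : (1 / 5 + 2 / β) / β ≤ γ 2
  le : ∀ s ≤ D, γ s + η * Λ + 4 / 5 / β ≤ 1 / 10
  clique : ∀ s ≤ D, 2 ≤ s → 2 * (1 + δ) * (((s : ℝ) - 1) * γ s + 2 * (s : ℝ) / (5 * β)) ^ 2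
    ≤ ((s : ℝ) - 1) * (((s : ℝ) - 2) * (γ s - γ (s - 1)) + η / 2)
  error : (1 + 1 / δ) * (2 * D * (η * Λ ^ 2)) ≤ 1 / 2

variable {D : ℕ} {β δ Λ : ℝ}

theorem IsLineGraph.card_pairNbrs_le (hS : IsLineGraph H S) (hD : ∀ u, (S u).card ≤ D) {e f : E}
    {u : V} (he : e ∈ S u) (hf : f ∈ S u) : (pairNbrs H U e f).card ≤ 3 * D := by
  -- besides `u`, each of `e` and `f` has one more end
  have hother : ∀ e, e ∈ S u → ∃ v, ∀ u', e ∈ S u' → u' = u ∨ u' = v := by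
    intro e he
    obtain ⟨a, b, _, hab⟩ := card_eq_two.1 (hS.card_ends e)
    have h1 : ∀ u', e ∈ S u' ↔ u' = a ∨ u' = b := fun u' => by
      have := congrArg (u' ∈ ·) hab
      simpa using this
    rcases (h1 u).1 he with rfl | rfl
    · exact ⟨b, fun u' h => (h1 u').1 h⟩
    · exact ⟨a, fun u' h => ((h1 u').1 h).symm⟩
  obtain ⟨v, hv⟩ := hother e he
  obtain ⟨v', hv'⟩ := hother f hf
  have h1 : pairNbrs H U e f ⊆ S u ∪ (S v ∪ S v') := by
    intro g hg
    simp only [pairNbrs, mem_filter, hS.adj_iff] at hg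
    simp only [mem_union]
    rcases hg.2.2.2 with ⟨_, u', h1, h2⟩ | ⟨_, u', h1, h2⟩
    · rcases hv u' h1 with rfl | rfl
      · exact Or.inl h2
      · exact Or.inr (Or.inl h2)
    · rcases hv' u' h1 with rfl | rfl
      · exact Or.inl h2
      · exact Or.inr (Or.inr h2)
  have h2 := card_le_card h1
  have h3 := card_union_le (S u) (S v ∪ S v')
  have h4 := card_union_le (S v) (S v')
  have := hD u
  have := hD v
  have := hD v'
  omega

theorem IsLineGraph.pairWeight_le (hS : IsLineGraph H S) (hD : ∀ u, (S u).card ≤ D)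
    (hγ : GoodWeights D β δ η Λ γ) {e f : E} (hef : e ≠ f) {u : V} (he : e ∈ S u) (hf : f ∈ S u) :
    pairWeight H S γ η U e f ≤ γ (U ∩ S u).card + η * Λ := by
  rw [hS.pairWeight_eq hef he hf]
  have := mul_le_mul_of_nonneg_left
    (hγ.harmonic_le _ (hS.card_pairNbrs_le (U := U) hD he hf)) hγ.η_nonneg
  linarith

theorem harmonic_nonneg (n : ℕ) : 0 ≤ (harmonic n : ℝ) := by
  rw [harmonic]
  push_cast
  positivity

/-- The deterministic inequality required of admissible pair weights. -/
theorem IsLineGraph.sum_siteCoef_sq_le (hS : IsLineGraph H S) (hD : ∀ u, (S u).card ≤ D)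
    (hγ : GoodWeights D β δ η Λ γ)
    (hU : ∀ e ∈ U, ∀ f ∈ U, H.Adj e f → ∃ g ∈ U, g ≠ e ∧ g ≠ f ∧ (H.Adj e g ∨ H.Adj f g))
    {κ : E → E → ℝ} (hκ : ∀ e ∈ U, ∀ f ∈ U, H.Adj e f → 0 ≤ κ e f ∧ κ e f ≤ 1 / β) (z : E → ℝ) :
    ∑ e ∈ U, (siteCoef H (pairWeight H S γ η) U e * z e
        - 4 / 5 * ∑ f ∈ U with H.Adj e f, κ e f * z f) ^ 2
      ≤ ∑ e ∈ U, excess H (pairWeight H S γ η) U e * z e ^ 2 := by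
  have hδ := hγ.δ_pos
  have hη := hγ.η_nonneg
  have hβ := hγ.β_pos
  set s : V → ℝ := fun u => ((U ∩ S u).card : ℝ) with hs
  have hsD : ∀ u, (U ∩ S u).card ≤ D := fun u => (card_le_card inter_subset_right).trans (hD u)
  have hcard : ∀ e ∈ U, ∀ u, e ∈ S u → (((U ∩ S u).erase e).card : ℝ) = s u - 1 := by
    intro e he u heu
    rw [hs, card_erase_of_mem (mem_inter.2 ⟨he, heu⟩), Nat.cast_sub
      (card_pos.2 ⟨e, mem_inter.2 ⟨he, heu⟩⟩), Nat.cast_one]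
  have hadj : ∀ {e f u}, e ∈ S u → f ∈ S u → e ≠ f → H.Adj e f :=
    fun {e f u} he hf hef => (hS.adj_iff e f).2 ⟨hef, u, he, hf⟩
  -- the contribution of the star of `u`, and the harmonic error
  set b : V → E → ℝ := fun u e => (s u - 1) * γ (U ∩ S u).card * z e
    - 4 / 5 * ∑ f ∈ (U ∩ S u).erase e, κ e f * z f with hb
  set R : E → ℝ := fun e => η * ∑ f ∈ U with H.Adj e f, (harmonic (pairNbrs H U e f).card : ℝ)
    with hR
  set d : E → ℝ := fun e => ∑ u with e ∈ S u, (s u - 1) with hd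
  have hd' : ∀ e ∈ U, d e = ∑ f ∈ U with H.Adj e f, (1 : ℝ) := by
    intro e he
    rw [hS.sum_adj, hd]
    refine sum_congr rfl fun u hu => ?_
    rw [sum_const, nsmul_eq_mul, mul_one, hcard e he u (mem_filter.1 hu).2]
  have hdecomp : ∀ e ∈ U, siteCoef H (pairWeight H S γ η) U e * z e
      - 4 / 5 * ∑ f ∈ U with H.Adj e f, κ e f * z f
      = ∑ u with e ∈ S u, b u e + R e * z e := by
    intro e he
    have h1 : siteCoef H (pairWeight H S γ η) U e
        = ∑ u with e ∈ S u, (s u - 1) * γ (U ∩ S u).card + R e := by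
      have h2 : R e = η * ∑ f ∈ U with H.Adj e f, (harmonic (pairNbrs H U e f).card : ℝ) := rfl
      rw [siteCoef, h2, mul_sum, hS.sum_adj, hS.sum_adj, ← sum_add_distrib]
      refine sum_congr rfl fun u hu => ?_
      have hu' := (mem_filter.1 hu).2
      rw [← hcard e he u hu', ← nsmul_eq_mul, ← sum_const, ← sum_add_distrib]
      refine sum_congr rfl fun f hf => ?_
      simp only [mem_erase, mem_inter] at hf
      exact hS.pairWeight_eq hf.1.symm hu' hf.2.2 U
    rw [h1, hS.sum_adj e fun f => κ e f * z f]
    simp only [hb, sum_sub_distrib, ← sum_mul, ← mul_sum]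
    ring
  have hexcess : ∀ e ∈ U, excess H (pairWeight H S γ η) U e = ∑ u with e ∈ S u,
      (s u - 1) * ((s u - 2) * (γ (U ∩ S u).card - γ ((U ∩ S u).card - 1)) + η) := by
    intro e he
    rw [excess, hS.sum_adj]
    refine sum_congr rfl fun u hu => ?_
    have hu' := (mem_filter.1 hu).2
    rw [← hcard e he u hu', ← nsmul_eq_mul, ← sum_const]
    refine sum_congr rfl fun f hf => ?_
    simp only [mem_erase, mem_inter] at hf
    refine hS.sum_pairWeight_sub hf.1.symm (mem_inter.2 ⟨he, hu'⟩) (mem_inter.2 hf.2) ?_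
    obtain ⟨g, hg, h⟩ := hU e he f hf.2.1 (hadj hu' hf.2.2 hf.1.symm)
    exact ⟨g, mem_filter.2 ⟨hg, h⟩⟩
  have hstar : ∀ u, 2 * (1 + δ) * ∑ e ∈ U ∩ S u, b u e ^ 2 ≤ ∑ e ∈ U ∩ S u,
      (s u - 1) * ((s u - 2) * (γ (U ∩ S u).card - γ ((U ∩ S u).card - 1)) + η / 2) * z e ^ 2 := by
    intro u
    rcases lt_or_ge (U ∩ S u).card 2 with hlt | hge
    · -- a star with a single edge contributes nothing
      have h1 : ∀ e ∈ U ∩ S u, s u = 1 ∧ b u e = 0 := by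
        intro e he
        have hc : (U ∩ S u).card = 1 := by
          have := card_pos.2 ⟨e, he⟩
          omega
        have hs1 : s u = 1 := by simp [hs, hc]
        have h2 : (U ∩ S u).erase e = ∅ := by
          rw [← card_eq_zero, card_erase_of_mem he, hc]
        exact ⟨hs1, by simp [hb, hs1, h2]⟩
      rw [sum_eq_zero fun e he => by rw [(h1 e he).2]; ring, mul_zero]
      exact (sum_eq_zero fun e he => by rw [(h1 e he).1]; ring).ge
    · have h1 := hγ.clique _ (hsD u) hge
      have hs2 : 2 ≤ s u := by
        simp only [hs]
        exact_mod_cast hge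
      have h2 := sum_clique_sq_le (C := U ∩ S u) (φ := (s u - 1) * γ (U ∩ S u).card) hβ (by
          have h3 := mul_le_mul_of_nonneg_left (hγ.le_γ _ (hsD u)) (by linarith : 0 ≤ s u - 1)
          have h4 : (s u - 2) / (5 * β) ≤ (s u - 1) * (1 / (5 * β)) := by
            rw [mul_one_div]
            gcongr
            linarith
          exact h4.trans h3) (fun e he f hf hef => hκ e (mem_inter.1 he).1 f (mem_inter.1 hf).1
            (hadj (mem_inter.1 he).2 (mem_inter.1 hf).2 hef)) z
      rw [← mul_sum]
      calc _ ≤ 2 * (1 + δ) * (((s u - 1) * γ (U ∩ S u).card + 2 * s u / (5 * β)) ^ 2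
            * ∑ e ∈ U ∩ S u, z e ^ 2) := mul_le_mul_of_nonneg_left h2 (by linarith)
        _ = 2 * (1 + δ) * ((s u - 1) * γ (U ∩ S u).card + 2 * s u / (5 * β)) ^ 2
            * ∑ e ∈ U ∩ S u, z e ^ 2 := by ring
        _ ≤ _ := mul_le_mul_of_nonneg_right h1 (sum_nonneg fun _ _ => sq_nonneg _)
  have hswap : ∀ φ : V → E → ℝ, ∑ e ∈ U, ∑ u with e ∈ S u, φ u e
      = ∑ u, ∑ e ∈ U ∩ S u, φ u e := fun φ => sum_comm' fun e u => by
    simp [mem_inter]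
  have hRd : ∀ e ∈ U, (1 + 1 / δ) * R e ^ 2 ≤ d e * (η / 2) := by
    intro e he
    have hd0 : 0 ≤ d e := by
      rw [hd' e he]
      positivity
    have hd2 : d e ≤ 2 * D := by
      have h1 : d e ≤ ({u | e ∈ S u} : Finset V).card • (D : ℝ) := by
        refine sum_le_card_nsmul _ _ _ fun u _ => ?_
        have : s u ≤ D := by
          simp only [hs]
          exact_mod_cast hsD u
        linarith
      rw [hS.card_ends e] at h1
      simpa using h1
    have hR0 : 0 ≤ R e := mul_nonneg hη (sum_nonneg fun _ _ => harmonic_nonneg _)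
    have hR1 : R e ≤ η * (d e * Λ) := by
      rw [hd' e he, sum_mul]
      refine mul_le_mul_of_nonneg_left (sum_le_sum fun f hf => ?_) hη
      rw [one_mul]
      obtain ⟨_, u, heu, hfu⟩ := (hS.adj_iff e f).1 (mem_filter.1 hf).2
      exact hγ.harmonic_le _ (hS.card_pairNbrs_le hD heu hfu)
    have hδ' : 0 ≤ 1 + 1 / δ := by positivity
    calc (1 + 1 / δ) * R e ^ 2 ≤ (1 + 1 / δ) * (η * (d e * Λ)) ^ 2 := by gcongr
      _ = (1 + 1 / δ) * (d e * (η * Λ ^ 2)) * (d e * η) := by ring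
      _ ≤ (1 + 1 / δ) * (2 * D * (η * Λ ^ 2)) * (d e * η) := by gcongr
      _ ≤ 1 / 2 * (d e * η) := mul_le_mul_of_nonneg_right hγ.error (by positivity)
      _ = d e * (η / 2) := by ring
  -- each edge lies in two stars, and the harmonic error is split off with the parameter `δ`
  have hsq : ∀ e ∈ U, (siteCoef H (pairWeight H S γ η) U e * z e
      - 4 / 5 * ∑ f ∈ U with H.Adj e f, κ e f * z f) ^ 2
      ≤ 2 * (1 + δ) * ∑ u with e ∈ S u, b u e ^ 2 + d e * (η / 2) * z e ^ 2 := by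
    intro e he
    rw [hdecomp e he]
    set x := ∑ u with e ∈ S u, b u e with hx
    have h1 : x ^ 2 ≤ 2 * ∑ u with e ∈ S u, b u e ^ 2 := by
      have := sq_sum_le_card_mul_sum_sq (s := ({u | e ∈ S u} : Finset V)) (f := fun u => b u e)
      rw [hS.card_ends e] at this
      exact_mod_cast this
    have h2 : (x + R e * z e) ^ 2 ≤ (1 + δ) * x ^ 2 + (1 + 1 / δ) * (R e * z e) ^ 2 := by
      have h3 : (1 + δ) * x ^ 2 + (1 + 1 / δ) * (R e * z e) ^ 2 - (x + R e * z e) ^ 2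
          = (δ * x - R e * z e) ^ 2 / δ := by
        field_simp
        ring
      have h4 : 0 ≤ (δ * x - R e * z e) ^ 2 / δ := by positivity
      linarith
    have h3 : (1 + δ) * x ^ 2 ≤ (1 + δ) * (2 * ∑ u with e ∈ S u, b u e ^ 2) :=
      mul_le_mul_of_nonneg_left h1 (by linarith)
    have h4 := mul_le_mul_of_nonneg_right (hRd e he) (sq_nonneg (z e))
    nlinarith
  calc _ ≤ ∑ e ∈ U, (2 * (1 + δ) * ∑ u with e ∈ S u, b u e ^ 2 + d e * (η / 2) * z e ^ 2) :=
        sum_le_sum hsq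
    _ = ∑ u, 2 * (1 + δ) * ∑ e ∈ U ∩ S u, b u e ^ 2 + ∑ e ∈ U, d e * (η / 2) * z e ^ 2 := by
        rw [sum_add_distrib, ← mul_sum, hswap, mul_sum]
    _ ≤ ∑ u, ∑ e ∈ U ∩ S u, (s u - 1) * ((s u - 2) * (γ (U ∩ S u).card
          - γ ((U ∩ S u).card - 1)) + η / 2) * z e ^ 2 + ∑ e ∈ U, d e * (η / 2) * z e ^ 2 := by
        gcongr with u _
        exact hstar u
    _ = ∑ e ∈ U, excess H (pairWeight H S γ η) U e * z e ^ 2 := by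
        rw [← hswap, ← sum_add_distrib]
        refine sum_congr rfl fun e he => ?_
        rw [hexcess e he, ← sum_mul, ← add_mul, hd]
        congr 1
        simp only [sum_mul, ← sum_add_distrib]
        exact sum_congr rfl fun u _ => by ring

theorem IsLineGraph.admissible (hS : IsLineGraph H S) (hD : ∀ u, (S u).card ≤ D)
    (hγ : GoodWeights D β δ η Λ γ) : Admissible H β (pairWeight H S γ η) where
  separated U₁ U₂ h e he f hf hef := by
    obtain ⟨hne, u, heu, hfu⟩ := (hS.adj_iff e f).1 hef
    rw [hS.pairWeight_eq hne heu hfu, hS.pairWeight_eq hne heu hfu]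
    have h1 : (U₁ ∪ U₂) ∩ S u = U₁ ∩ S u := by
      ext g
      simp only [mem_inter, mem_union]
      refine ⟨fun hg => ⟨hg.1.resolve_right fun hg' => h.2 e he g hg' ?_, hg.2⟩,
        fun hg => ⟨Or.inl hg.1, hg.2⟩⟩
      exact (hS.adj_iff e g).2 ⟨fun heg => disjoint_left.1 h.1 he (heg ▸ hg'), u, heu, hg.2⟩
    have h2 : pairNbrs H (U₁ ∪ U₂) e f = pairNbrs H U₁ e f := by
      ext g
      simp only [pairNbrs, mem_filter, mem_union]
      refine ⟨fun hg => ⟨hg.1.resolve_right fun hg' => ?_, hg.2⟩, fun hg => ⟨Or.inl hg.1, hg.2⟩⟩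
      rcases hg.2.2.2 with h' | h'
      · exact h.2 e he g hg' h'
      · exact h.2 f hf g hg' h'
    rw [h1, h2]
  pair e f hef := by
    obtain ⟨hne, u, heu, hfu⟩ := (hS.adj_iff e f).1 hef
    rw [hS.pairWeight_eq hne heu hfu]
    have h1 : ({e, f} : Finset E) ∩ S u = {e, f} := by
      refine inter_eq_left.2 fun g hg => ?_
      rcases mem_insert.1 hg with rfl | hg
      · exact heu
      · rwa [mem_singleton.1 hg]
    rw [h1, card_pair hne]
    have := hγ.pair
    have := mul_nonneg hγ.η_nonneg (harmonic_nonneg (pairNbrs H {e, f} e f).card)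
    linarith
  le U e _ f _ hef := by
    obtain ⟨hne, u, heu, hfu⟩ := (hS.adj_iff e f).1 hef
    have h1 := hS.pairWeight_le (U := U) hD hγ hne heu hfu
    have h2 := hγ.le (U ∩ S u).card ((card_le_card inter_subset_right).trans (hD u))
    linarith
  sq_le U hU κ hκ z := hS.sum_siteCoef_sq_le hD hγ hU hκ z

theorem IsLineGraph.card_adj_le (hS : IsLineGraph H S) (hD : ∀ u, (S u).card ≤ D) (e : E) :
    (({f ∈ U | H.Adj e f}.card : ℕ) : ℝ) ≤ 2 * D := by
  have h1 : ({f ∈ U | H.Adj e f} : Finset E).card ≤ 2 * D := by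
    rw [card_eq_sum_ones, hS.sum_adj, ← hS.card_ends e, ← smul_eq_mul]
    refine sum_le_card_nsmul _ _ _ fun u _ => ?_
    rw [← card_eq_sum_ones]
    exact (card_le_card ((erase_subset _ _).trans inter_subset_right)).trans (hD u)
  exact_mod_cast h1

variable {K : Type*} [Fintype K] [DecidableEq K] {L : E → Finset K} {ω : E → K}

/-- Good weights yield a spectral gap: the variance of a statistic is at most a constant times the
sum of the second moments. -/
theorem IsLineGraph.var_lin_le (hS : IsLineGraph H S) (hD : ∀ u, (S u).card ≤ D)
    (hγ : GoodWeights D β δ η Λ γ) (hβ : 3 ≤ β) {M : ℝ} (hM0 : 0 ≤ M)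
    (hM : ∀ s ≤ D, 2 * D * (γ s + η * Λ + 4 / 5 / β) ≤ M)
    (hL : ∀ e, β + H.degree e ≤ (L e).card) (hω : ω ∈ colorings H L) (v : E × K → ℝ) :
    var (colorings H L) U ω (lin v)
      ≤ (1 + M) * ∑ e ∈ U, avg (colorings H L) U ω (fun σ => v (e, σ e) ^ 2) := by
  have h1 := (hS.admissible hD hγ).var_lin_le hβ hL U hω v
  have h2 : potential H L (pairWeight H S γ η) U ω v
      ≤ M * ∑ e ∈ U, avg (colorings H L) U ω (fun σ => v (e, σ e) ^ 2) := by
    refine potential_le hγ.β_pos hL (fun e he => ?_) v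
    rcases Nat.eq_zero_or_pos D with hD0 | hD0
    · -- there are no adjacent edges
      have h3 := hS.card_adj_le (U := U) hD e
      rw [hD0, Nat.cast_zero, mul_zero, Nat.cast_nonpos, card_eq_zero] at h3
      rw [h3, sum_empty]
      exact hM0
    have h3 : ∀ f ∈ U.filter (H.Adj e),
        pairWeight H S γ η U e f + 4 / 5 / β ≤ M / (2 * D) := by
      intro f hf
      obtain ⟨hne, u, heu, hfu⟩ := (hS.adj_iff e f).1 (mem_filter.1 hf).2
      have h4 := hS.pairWeight_le (U := U) hD hγ hne heu hfu
      have h5 := hM (U ∩ S u).card ((card_le_card inter_subset_right).trans (hD u))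
      rw [le_div_iff₀ (by positivity)]
      refine le_trans ?_ h5
      rw [mul_comm]
      gcongr
    refine (sum_le_card_nsmul _ _ _ h3).trans ?_
    rw [nsmul_eq_mul]
    calc _ ≤ 2 * (D : ℝ) * (M / (2 * D)) :=
          mul_le_mul_of_nonneg_right (hS.card_adj_le hD e) (by positivity)
      _ = M := by field_simp
  linarith

end LineGraph

/-! ### Choice of the pair weights -/

section Parameters

/-- The reciprocal of an affine function. Its increments are `B` times the product of consecutive
values, a discrete version of the Riccati equation `b' = B b ^ 2`. -/
noncomputable def recip (B : ℝ) (s : ℕ) : ℝ := 1 / (8 / 5 - B * s)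

/-- The main part of the pair weights. The shift by `2 / 5` absorbs, up to a constant, the norm
`2 s / (5 β)` of the defects on a clique with `s` elements. -/
noncomputable def mainWeight (B β : ℝ) (s : ℕ) : ℝ := (recip B s - 2 / 5) / β

theorem large_of_log_sq_div_le {D : ℕ} {ε : ℝ} (hε : 0 < ε) (hε' : ε ≤ 1 / 10) (hD : 2 ≤ D)
    (h : Real.log D ^ 2 / D ≤ ε ^ 3 / 15) :
    7 ≤ D * ε ^ 3 ∧ 5 ≤ Real.log D ∧ Real.log D ^ 2 ≤ D * ε ^ 3 / 15 := by
  have hD0 : (2 : ℝ) ≤ D := by exact_mod_cast hD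
  have h1 : Real.log D ^ 2 ≤ D * ε ^ 3 / 15 := by
    rw [div_le_iff₀ (by linarith)] at h
    linarith
  have h2 : 0.6931471803 < Real.log 2 := Real.log_two_gt_d9
  have h3 : Real.log 2 ≤ Real.log D := Real.log_le_log (by norm_num) hD0
  have h4 : 7 ≤ D * ε ^ 3 := by nlinarith
  refine ⟨h4, ?_, h1⟩
  have h5 : ε ^ 3 ≤ (1 / 10) ^ 3 := pow_le_pow_left₀ hε.le hε' 3
  have h6 : (7000 : ℝ) ≤ D := by nlinarith
  rw [Real.le_log_iff_exp_le (by linarith)]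
  have h7 : Real.exp 5 = Real.exp 1 ^ 5 := by
    rw [← Real.exp_nat_mul]
    norm_num
  have h8 : Real.exp 1 ^ 5 ≤ 3 ^ 5 :=
    pow_le_pow_left₀ (Real.exp_pos 1).le Real.exp_one_lt_three.le 5
  rw [h7]
  refine h8.trans (le_trans (by norm_num) h6)

theorem harmonic_le_of_le {D : ℕ} (h : 5 ≤ Real.log D) {n : ℕ} (hn : n ≤ 3 * D) :
    (harmonic n : ℝ) ≤ 3 / 2 * Real.log D := by
  rcases Nat.eq_zero_or_pos n with rfl | hn0
  · rw [harmonic_zero, Rat.cast_zero]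
    linarith
  have hD : (D : ℝ) ≠ 0 := by
    rintro h0
    rw [h0, Real.log_zero] at h
    linarith
  have h1 : Real.log n ≤ Real.log (4 * D) := by
    refine Real.log_le_log (by exact_mod_cast hn0) ?_
    have : n ≤ 4 * D := by omega
    exact_mod_cast this
  have h2 : Real.log (4 * D) = 2 * Real.log 2 + Real.log D := by
    rw [Real.log_mul (by norm_num) hD, show (4 : ℝ) = 2 ^ 2 by norm_num, Real.log_pow]
    norm_num
  have h3 := Real.log_two_lt_d9
  have h4 := harmonic_le_one_add_log n
  linarith

/-- The affine function stays above `3 ε`; this is where the factor `4 / 3 + 4 ε` is used. -/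
theorem three_mul_le_sub {D : ℕ} {ε β B : ℝ} (hε : 0 < ε) (hε' : ε ≤ 1 / 10) (hD : 0 < D)
    (hβ : β = (4 / 3 + 4 * ε) * D) (hB : B = 2 * (1 + ε / 2) ^ 2 / β) {s : ℕ} (hs : s ≤ D) :
    3 * ε ≤ 8 / 5 - B * s := by
  have hD' : (0 : ℝ) < D := by exact_mod_cast hD
  have hs' : (s : ℝ) ≤ D := by exact_mod_cast hs
  have hβ0 : 0 < β := by rw [hβ]; positivity
  have hB0 : 0 ≤ B := by rw [hB]; positivity
  have h1 : B * D * (4 / 3 + 4 * ε) = 2 * (1 + ε / 2) ^ 2 := by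
    rw [hB, hβ]
    field_simp
  have h2 : B * s ≤ B * D := mul_le_mul_of_nonneg_left hs' hB0
  have h3 : B * D ≤ 8 / 5 - 3 * ε := by
    by_contra! h
    nlinarith
  linarith

theorem one_div_sub_one_div {x y : ℝ} (hx : x ≠ 0) (hy : y ≠ 0) :
    1 / x - 1 / y = (y - x) * (1 / x) * (1 / y) := by
  field_simp

/-- The recursion for the main part of the pair weights, in terms of two consecutive values `b'` and
`b` of the reciprocal function. -/
theorem clique_le {B b b' t ε β : ℝ} (hε : 0 < ε) (hε' : ε ≤ 1 / 10) (hβ : 0 < β) (ht : 1 ≤ t)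
    (hβB : β * B = 2 * (1 + ε / 2) ^ 2) (hbb : b - b' = B * b * b')
    (hb : 0 < b) (hb' : 0 < b') (hbε : ε * b ≤ 1 / 3) (hBb : B * b ≤ ε / 2) :
    2 * (1 + ε / 2) * (t * ((b - 2 / 5) / β) + 2 * (t + 1) / (5 * β)) ^ 2
      ≤ t * ((t - 1) * ((b - 2 / 5) / β - (b' - 2 / 5) / β) + 1 / (ε ^ 2 * β ^ 2) / 2) := by
  have hmain : 2 * (1 + ε / 2) * b ^ 2 ≤ β * B * (b * b') := by
    have h1 : b ≤ b' * (1 + ε / 2) := by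
      have := mul_le_mul_of_nonneg_right hBb hb'.le
      linarith
    rw [hβB]
    have h2 : 2 * (1 + ε / 2) * b * b ≤ 2 * (1 + ε / 2) * b * (b' * (1 + ε / 2)) :=
      mul_le_mul_of_nonneg_left h1 (by positivity)
    calc 2 * (1 + ε / 2) * b ^ 2 = 2 * (1 + ε / 2) * b * b := by ring
      _ ≤ 2 * (1 + ε / 2) * b * (b' * (1 + ε / 2)) := h2
      _ = 2 * (1 + ε / 2) ^ 2 * (b * b') := by ring
  have hlow : 2 * (1 + ε / 2) * (b + 2 / 5) ^ 2 ≤ 1 / (2 * ε ^ 2) := by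
    rw [le_div_iff₀ (by positivity)]
    have h1 : (ε * b + 2 / 5 * ε) ^ 2 ≤ (1 / 3 + 2 / 5 * (1 / 10)) ^ 2 :=
      pow_le_pow_left₀ (by positivity) (by linarith) 2
    have h2 : 2 * (1 + ε / 2) * (b + 2 / 5) ^ 2 * (2 * ε ^ 2)
        = 4 * (1 + ε / 2) * (ε * b + 2 / 5 * ε) ^ 2 := by ring
    rw [h2]
    have h3 : 4 * (1 + ε / 2) * (ε * b + 2 / 5 * ε) ^ 2
        ≤ 4 * (1 + 1 / 10 / 2) * (1 / 3 + 2 / 5 * (1 / 10)) ^ 2 :=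
      mul_le_mul (by linarith) h1 (sq_nonneg _) (by norm_num)
    linarith
  have hexp : (t * b + 2 / 5) ^ 2 ≤ t * (t - 1) * b ^ 2 + t * (b + 2 / 5) ^ 2 := by
    have h1 : t * (t - 1) * b ^ 2 + t * (b + 2 / 5) ^ 2 - (t * b + 2 / 5) ^ 2
        = (t - 1) * (2 / 5) ^ 2 := by ring
    have h2 : 0 ≤ (t - 1) * (2 / 5 : ℝ) ^ 2 := mul_nonneg (by linarith) (by norm_num)
    linarith
  have hfin : 2 * (1 + ε / 2) * (t * b + 2 / 5) ^ 2
      ≤ t * ((t - 1) * (β * B * (b * b')) + 1 / (2 * ε ^ 2)) := by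
    have h1 := mul_le_mul_of_nonneg_left hexp (by positivity : 0 ≤ 2 * (1 + ε / 2))
    have h2 := mul_le_mul_of_nonneg_left hmain (mul_nonneg (by linarith) (by linarith) :
      0 ≤ t * (t - 1))
    have h3 := mul_le_mul_of_nonneg_left hlow (by linarith : 0 ≤ t)
    calc 2 * (1 + ε / 2) * (t * b + 2 / 5) ^ 2
        ≤ 2 * (1 + ε / 2) * (t * (t - 1) * b ^ 2 + t * (b + 2 / 5) ^ 2) := h1
      _ = t * (t - 1) * (2 * (1 + ε / 2) * b ^ 2) + t * (2 * (1 + ε / 2) * (b + 2 / 5) ^ 2) := by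
        ring
      _ ≤ t * (t - 1) * (β * B * (b * b')) + t * (1 / (2 * ε ^ 2)) := add_le_add h2 h3
      _ = t * ((t - 1) * (β * B * (b * b')) + 1 / (2 * ε ^ 2)) := by ring
  have hγ : (b - 2 / 5) / β - (b' - 2 / 5) / β = B * (b * b') / β := by
    rw [← sub_div, sub_sub_sub_cancel_right, hbb, mul_assoc]
  have h1 : t * ((b - 2 / 5) / β) + 2 * (t + 1) / (5 * β) = (t * b + 2 / 5) / β := by
    field_simp
    ring
  have h2 : t * ((t - 1) * (B * (b * b') / β) + 1 / (ε ^ 2 * β ^ 2) / 2)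
      = t * ((t - 1) * (β * B * (b * b')) + 1 / (2 * ε ^ 2)) / β ^ 2 := by
    field_simp
  rw [hγ, h1, h2, div_pow, ← mul_div_assoc]
  exact div_le_div_of_nonneg_right hfin (by positivity)

/-- The total weight at an edge, with the harmonic part and the defect. -/
theorem two_mul_weight_le {D ε β l b : ℝ} (hε : 0 < ε) (hε' : ε ≤ 1 / 10) (hD : 0 < D)
    (hβD : 4 / 3 * D ≤ β) (hl : 0 ≤ l) (hlD : 100 * l ≤ D * ε) (hb : 0 < b) (hbε : ε * b ≤ 1 / 3) :
    2 * D * ((b - 2 / 5) / β + 1 / (ε ^ 2 * β ^ 2) * (3 / 2 * l) + 4 / 5 / β) ≤ 1 / ε := by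
  have hβ0 : 0 < β := by linarith
  have h1 : 2 * D * ((b - 2 / 5) / β + 1 / (ε ^ 2 * β ^ 2) * (3 / 2 * l) + 4 / 5 / β)
      = (2 * (D / β) * (ε * b + 2 / 5 * ε) + 3 * (D / β) ^ 2 * (l / (D * ε))) / ε := by
    field_simp
    ring
  rw [h1]
  refine div_le_div_of_nonneg_right ?_ hε.le
  have h2 : D / β ≤ 3 / 4 := by
    rw [div_le_iff₀ hβ0]
    linarith
  have h3 : l / (D * ε) ≤ 1 / 100 := by
    rw [div_le_iff₀ (by positivity)]
    linarith
  have h4 : 0 ≤ D / β := by positivity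
  have h5 : (D / β) ^ 2 ≤ (3 / 4) ^ 2 := pow_le_pow_left₀ h4 h2 2
  have h6 : 0 ≤ l / (D * ε) := by positivity
  have h9 : 0 ≤ ε * b + 2 / 5 * ε := by positivity
  have h10 : 2 * (D / β) * (ε * b + 2 / 5 * ε) ≤ 2 * (3 / 4) * (1 / 3 + 2 / 5 * (1 / 10)) :=
    mul_le_mul (by linarith) (by linarith) h9 (by norm_num)
  have h11 : 3 * (D / β) ^ 2 * (l / (D * ε)) ≤ 3 * (3 / 4) ^ 2 * (1 / 100) :=
    mul_le_mul (by linarith) h3 h6 (by norm_num)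
  linarith

/-- The harmonic parts of the weights contribute a small error. -/
theorem harmonic_error_le {D ε β l : ℝ} (hε : 0 < ε) (hε' : ε ≤ 1 / 10) (hD : 0 < D)
    (hβD : 4 / 3 * D ≤ β) (hl : l ^ 2 ≤ D * ε ^ 3 / 15) :
    (1 + 1 / (ε / 2)) * (2 * D * (1 / (ε ^ 2 * β ^ 2) * (3 / 2 * l) ^ 2)) ≤ 1 / 2 := by
  have hβ0 : 0 < β := by linarith
  have h1 : (1 + 1 / (ε / 2)) * (2 * D * (1 / (ε ^ 2 * β ^ 2) * (3 / 2 * l) ^ 2))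
      = (ε + 2) * (9 / 2) * (D / β) ^ 2 * (l ^ 2 / (D * ε ^ 3)) := by
    field_simp
    ring
  have h2 : D / β ≤ 3 / 4 := by
    rw [div_le_iff₀ hβ0]
    linarith
  have h4 : (D / β) ^ 2 ≤ (3 / 4) ^ 2 := pow_le_pow_left₀ (by positivity) h2 2
  have h5 : l ^ 2 / (D * ε ^ 3) ≤ 1 / 15 := by
    rw [div_le_iff₀ (by positivity)]
    linarith
  rw [h1]
  have h6 : (ε + 2) * (9 / 2) * (D / β) ^ 2 ≤ (1 / 10 + 2) * (9 / 2) * (3 / 4) ^ 2 :=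
    mul_le_mul (by linarith) h4 (by positivity) (by norm_num)
  have h7 : (ε + 2) * (9 / 2) * (D / β) ^ 2 * (l ^ 2 / (D * ε ^ 3))
      ≤ (1 / 10 + 2) * (9 / 2) * (3 / 4) ^ 2 * (1 / 15) :=
    mul_le_mul h6 h5 (by positivity) (by norm_num)
  exact h7.trans (by norm_num)

/-- The weights satisfy all numerical conditions, and their total at an edge is at most `1 / ε`. -/
theorem goodWeights {D : ℕ} {ε β B : ℝ} (hε : 0 < ε) (hε' : ε ≤ 1 / 10) (hD : 2 ≤ D)
    (h : Real.log D ^ 2 / D ≤ ε ^ 3 / 15) (hβ : β = (4 / 3 + 4 * ε) * D)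
    (hB : B = 2 * (1 + ε / 2) ^ 2 / β) :
    GoodWeights D β (ε / 2) (1 / (ε ^ 2 * β ^ 2)) (3 / 2 * Real.log D) (mainWeight B β) ∧
    3 ≤ β ∧ ∀ s ≤ D, 2 * D * (mainWeight B β s + 1 / (ε ^ 2 * β ^ 2) * (3 / 2 * Real.log D)
      + 4 / 5 / β) ≤ 1 / ε := by
  obtain ⟨hD7, hlog, hlog2⟩ := large_of_log_sq_div_le hε hε' hD h
  set l := Real.log D with hl
  have hD0 : (0 : ℝ) < D := by
    have : 0 < D := by omega
    exact_mod_cast this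
  have hD2 : 70 ≤ D * ε ^ 2 := by
    have h1 : D * ε ^ 3 ≤ D * ε ^ 2 * (1 / 10) := by
      have : D * ε ^ 3 = D * ε ^ 2 * ε := by ring
      rw [this]
      exact mul_le_mul_of_nonneg_left hε' (by positivity)
    linarith
  have hD1 : 700 ≤ D * ε := by
    have h1 : D * ε ^ 2 ≤ D * ε * (1 / 10) := by
      have : D * ε ^ 2 = D * ε * ε := by ring
      rw [this]
      exact mul_le_mul_of_nonneg_left hε' (by positivity)
    linarith
  have hD7000 : 7000 ≤ (D : ℝ) := by
    have := mul_le_mul_of_nonneg_left hε' hD0.le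
    linarith
  have hβD : 4 / 3 * D ≤ β := by
    rw [hβ]
    have := mul_pos hε hD0
    linarith
  have hβ0 : 0 < β := by linarith
  have hB0 : 0 < B := by rw [hB]; positivity
  have hβB : β * B = 2 * (1 + ε / 2) ^ 2 := by rw [hB]; field_simp
  have hden : ∀ s ≤ D, 3 * ε ≤ 8 / 5 - B * s := fun s hs =>
    three_mul_le_sub hε hε' (by omega) hβ hB hs
  have hb_le : ∀ s ≤ D, ε * recip B s ≤ 1 / 3 := by
    intro s hs
    have h1 := hden s hs
    rw [recip, mul_one_div, div_le_iff₀ (by linarith)]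
    linarith
  have hb_ge : ∀ s ≤ D, 5 / 8 ≤ recip B s := by
    intro s hs
    have h1 := hden s hs
    have h2 : 0 ≤ B * s := by positivity
    rw [recip, le_div_iff₀ (by linarith)]
    linarith
  have hlD : 100 * l ≤ D * ε := by
    have h1 : D * ε ^ 3 ≤ D * ε * (1 / 100) := by
      have h2 : ε ^ 2 ≤ (1 / 10) ^ 2 := pow_le_pow_left₀ hε.le hε' 2
      have : D * ε ^ 3 = D * ε * ε ^ 2 := by ring
      rw [this]
      exact mul_le_mul_of_nonneg_left (by linarith) (by positivity)
    have h3 : 5 * l ≤ l ^ 2 := by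
      rw [sq]
      exact mul_le_mul_of_nonneg_right hlog (by linarith)
    linarith
  have hW : ∀ s ≤ D, 2 * D * (mainWeight B β s + 1 / (ε ^ 2 * β ^ 2) * (3 / 2 * l) + 4 / 5 / β)
      ≤ 1 / ε := fun s hs =>
    two_mul_weight_le hε hε' hD0 hβD (by linarith) hlD (by linarith [hb_ge s hs]) (hb_le s hs)
  refine ⟨⟨hβ0, by positivity, by positivity, fun n hn => harmonic_le_of_le hlog hn,
    fun s hs => ?_, ?_, fun s hs => ?_, fun s hs hs2 => ?_,
    harmonic_error_le hε hε' hD0 hβD hlog2⟩, by linarith, hW⟩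
  · rw [mainWeight, ← div_div]
    have := hb_ge s hs
    exact div_le_div_of_nonneg_right (by linarith) hβ0.le
  · rw [mainWeight]
    have := hb_ge 2 hD
    have h1 : 2 / β ≤ 1 / 40 := by
      rw [div_le_iff₀ hβ0]
      linarith
    exact div_le_div_of_nonneg_right (by linarith) hβ0.le
  · have h1 := hW s hs
    set W := mainWeight B β s + 1 / (ε ^ 2 * β ^ 2) * (3 / 2 * l) + 4 / 5 / β
    rw [le_div_iff₀ hε] at h1
    by_contra! h2
    have h3 : D * ε * (1 / 10) ≤ D * ε * W := mul_le_mul_of_nonneg_left h2.le (by positivity)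
    have h4 : 2 * D * W * ε = 2 * (D * ε * W) := by ring
    linarith
  · obtain ⟨t, rfl⟩ : ∃ t, s = t + 1 := ⟨s - 1, by omega⟩
    have ht : 1 ≤ (t : ℝ) := by
      have : 1 ≤ t := by omega
      exact_mod_cast this
    have hbl := hb_le (t + 1) hs
    have hbg := hb_ge (t + 1) hs
    have hb'g := hb_ge t (by omega)
    have hd1 := hden (t + 1) hs
    have hd2 := hden t (by omega)
    have hbb : recip B (t + 1) - recip B t = B * recip B (t + 1) * recip B t := by
      rw [recip, recip, one_div_sub_one_div (by linarith) (by linarith)]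
      push_cast
      ring
    have hBb : B * recip B (t + 1) ≤ ε / 2 := by
      refine le_of_mul_le_mul_left ?_ (mul_pos hβ0 hε)
      have h2 : β * ε * (B * recip B (t + 1)) = 2 * (1 + ε / 2) ^ 2 * (ε * recip B (t + 1)) := by
        rw [← hβB]
        ring
      have h3 : (1 + ε / 2) ^ 2 ≤ (1 + 1 / 10 / 2) ^ 2 :=
        pow_le_pow_left₀ (by positivity) (by linarith) 2
      have h4 : 2 * (1 + ε / 2) ^ 2 * (ε * recip B (t + 1)) ≤ 2 * 2 * (1 / 3) :=
        mul_le_mul (by linarith) hbl (mul_nonneg hε.le (by linarith)) (by norm_num)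
      have h5 := mul_le_mul_of_nonneg_right hβD (sq_nonneg ε)
      have h6 : β * ε * (ε / 2) = β * ε ^ 2 / 2 := by ring
      rw [h2, h6]
      linarith
    have h1 := clique_le hε hε' hβ0 ht hβB hbb (by linarith) (by linarith) hbl hBb
    have h2 : (((t + 1 : ℕ) : ℝ) - 1) = t := by push_cast; ring
    have h3 : (((t + 1 : ℕ) : ℝ) - 2) = t - 1 := by push_cast; ring
    rw [Nat.add_sub_cancel, h2, h3, mainWeight, mainWeight]
    push_cast
    exact h1

end Parameters

/-! ### The spectral gap of edge-list-colorings -/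

section SpectralGap

section NoEdges

variable {E K : Type*} [Fintype E] [DecidableEq E] [Fintype K] [DecidableEq K]
  {H : SimpleGraph E} [DecidableRel H.Adj] {L : E → Finset K} {ω : E → K}

theorem var_lin_singleton_le {Ω : Finset (E → K)} (hω : ω ∈ Ω) (e : E) (v : E × K → ℝ) :
    var Ω {e} ω (lin v) ≤ avg Ω {e} ω (fun σ => v (e, σ e) ^ 2) := by
  have h1 : ∀ σ ∈ fiber Ω {e} ω, lin v σ = v (e, σ e) + ∑ f ∈ univ.erase e, v (f, ω f) := by
    intro σ hσ
    rw [lin, ← add_sum_erase _ _ (mem_univ e)]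
    congr 1
    refine sum_congr rfl fun f hf => ?_
    rw [(mem_fiber.1 hσ).2 f (by simpa using ne_of_mem_erase hf)]
  rw [var_congr h1, var_add_const hω, var]
  have := sq_nonneg (avg Ω {e} ω fun σ => v (e, σ e))
  linarith

/-- If no two sites are adjacent, then the colors of the sites are independent. -/
theorem var_lin_le_of_forall_not_adj (hH : ∀ e f, ¬ H.Adj e f) (hω : ω ∈ colorings H L)
    (U : Finset E) (v : E × K → ℝ) : var (colorings H L) U ω (lin v)
      ≤ ∑ e ∈ U, avg (colorings H L) U ω (fun σ => v (e, σ e) ^ 2) := by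
  induction U using Finset.induction_on with
  | empty =>
    have h1 : ∀ σ ∈ fiber (colorings H L) ∅ ω, lin v σ = lin v ω := fun σ hσ => by
      rw [funext fun e => (mem_fiber.1 hσ).2 e (notMem_empty e)]
    rw [var_congr h1, var, avg_const hω, avg_const hω, sub_self, sum_empty]
  | insert e U he ih =>
    have hs : Separated H {e} U := ⟨disjoint_singleton_left.2 he, fun _ _ _ _ => hH _ _⟩
    rw [insert_eq, hs.var_lin_union hω, sum_union hs.1, sum_singleton]
    have h1 : ∀ f ∈ U, avg (colorings H L) ({e} ∪ U) ω (fun σ => v (f, σ f) ^ 2)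
        = avg (colorings H L) U ω (fun σ => v (f, σ f) ^ 2) := by
      intro f hf
      have hfe : f ∉ ({e} : Finset E) := by
        rw [mem_singleton]
        rintro rfl
        exact he hf
      rw [union_comm]
      exact hs.symm.avg_union_eq hω fun τ τ' h => by rw [h f hfe]
    rw [sum_congr rfl h1, hs.avg_union_eq hω fun τ τ' h => by rw [h e he]]
    exact add_le_add (var_lin_singleton_le hω e v) ih

end NoEdges

variable {V : Type*} [Fintype V] [DecidableEq V] (G : SimpleGraph V) [DecidableRel G.Adj]

/-- The edges at the vertex `u`. -/
def star (u : V) : Finset G.edgeSet := {e | u ∈ e.1}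

theorem card_star (u : V) : (star G u).card = G.degree u := by
  rw [← G.card_incidenceFinset_eq_degree u]
  refine card_bij (fun e _ => e.1) (fun e he => ?_) (fun _ _ _ _ h => Subtype.ext h) fun e he => ?_
  · rw [SimpleGraph.mem_incidenceFinset]
    exact ⟨e.2, (mem_filter.1 he).2⟩
  · rw [SimpleGraph.mem_incidenceFinset] at he
    exact ⟨⟨e, he.1⟩, mem_filter.2 ⟨mem_univ _, he.2⟩, rfl⟩

theorem isLineGraph_lineGraph : IsLineGraph G.lineGraph (star G) where
  card_ends e := by
    have h1 : ({u | e ∈ star G u} : Finset V) = e.1.toFinset := by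
      ext u
      simp [star, Sym2.mem_toFinset]
    rw [h1]
    exact Sym2.card_toFinset_of_not_isDiag _ (G.not_isDiag_of_mem_edgeSet e.2)
  adj_iff e f := by
    rw [SimpleGraph.lineGraph_adj_iff_exists]
    simp [star]
  eq_of_mem e f hef u u' h1 h2 h3 h4 := by
    simp only [star, mem_filter, mem_univ, true_and] at h1 h2 h3 h4
    by_contra huu
    exact hef (Subtype.ext (((Sym2.mem_and_mem_iff huu).1 ⟨h1, h3⟩).trans
      ((Sym2.mem_and_mem_iff huu).1 ⟨h2, h4⟩).symm))

variable {G} {q : ℕ} {L : G.edgeSet → Finset (Fin q)} {ε : ℝ}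

/-- The spectral gap under any boundary condition: the variance of a statistic is at most
`1 + 1 / ε` times the sum of the second moments. -/
theorem var_lin_edgeColorings_le [DecidableRel G.lineGraph.Adj] (hε : 0 < ε) (hε' : ε ≤ 1 / 10)
    (hL : IsExtraColor G L ((4 / 3 + 4 * ε) * (G.maxDegree : ℝ)))
    (hΔ : Real.log (G.maxDegree : ℝ) ^ 2 / (G.maxDegree : ℝ) ≤ ε ^ 3 / 15)
    (U : Finset G.edgeSet) {ω : G.edgeSet → Fin q} (hω : ω ∈ colorings G.lineGraph L)
    (v : G.edgeSet × Fin q → ℝ) :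
    var (colorings G.lineGraph L) U ω (lin v)
      ≤ (1 + 1 / ε) * ∑ e ∈ U, avg (colorings G.lineGraph L) U ω (fun σ => v (e, σ e) ^ 2) := by
  have hS := isLineGraph_lineGraph G
  have hD : ∀ u, (star G u).card ≤ G.maxDegree := fun u => by
    rw [card_star]
    exact G.degree_le_maxDegree u
  have hε1 : 0 ≤ 1 / ε := by positivity
  rcases Nat.lt_or_ge G.maxDegree 2 with h2 | h2
  · -- the edges form a matching
    have hH : ∀ e f, ¬ G.lineGraph.Adj e f := by
      intro e f h
      obtain ⟨hef, u, he, hf⟩ := (hS.adj_iff e f).1 h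
      have h3 := card_le_card (insert_subset he (singleton_subset_iff.2 hf))
      rw [card_pair hef] at h3
      have := hD u
      omega
    refine (var_lin_le_of_forall_not_adj hH hω U v).trans ?_
    have h3 : 0 ≤ ∑ e ∈ U, avg (colorings G.lineGraph L) U ω (fun σ => v (e, σ e) ^ 2) :=
      sum_nonneg fun e _ => avg_nonneg fun _ _ => sq_nonneg _
    have h4 := mul_nonneg hε1 h3
    linarith
  · obtain ⟨hγ, hβ, hM⟩ := goodWeights hε hε' h2 hΔ rfl rfl
    refine hS.var_lin_le hD hγ hβ hε1 hM (fun e => ?_) hω v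
    have h3 := hL e
    rwa [Set.ncard_eq_toFinset_card', ← SimpleGraph.neighborFinset,
      SimpleGraph.card_neighborFinset_eq_degree] at h3

end SpectralGap

/-! ### From the spectral gap to the second eigenvalue of a local walk -/

section SecondEigenvalue

open Matrix

/-- A bound for a quadratic form on a hyperplane bounds the second eigenvalue. -/
theorem lambda2_le {n : Type*} [Fintype n] [DecidableEq n] {A T : Matrix n n ℝ} {w l : n → ℝ}
    {κ : ℝ} (hκ : 0 ≤ κ) (hT : T.IsSymm) (hA : ∀ x y, A x y = w x ^ 2 * T x y)
    (h : ∀ z : n → ℝ, ∑ x, l x * z x = 0 →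
      ∑ x, ∑ y, (w x * z x) * T x y * (w y * z y) ≤ κ * ∑ x, z x ^ 2) :
    lambda2 A ≤ κ := by
  set B := diagonal w * T * diagonal w with hB
  have hBH : B.IsHermitian := by
    ext x y
    rw [hB, conjTranspose_apply, mul_diagonal, mul_diagonal, diagonal_mul, diagonal_mul,
      star_trivial, hT.apply]
    ring
  have hAB : A.charpoly = B.charpoly := by
    rw [hB, ← charpoly_mul_comm]
    congr 1
    ext x y
    rw [diagonal_mul, diagonal_mul, hA]
    ring
  have hsort : A.charpoly.roots.sort (· ≥ ·) = List.ofFn hBH.eigenvalues₀ := by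
    rw [hAB, ← hBH.sort_roots_charpoly_eq_eigenvalues₀]
    simp
  rw [lambda2, hsort]
  by_contra! hlt
  have hn : 1 < Fintype.card n := by
    by_contra hn
    rw [List.getD_eq_default _ _ (by simpa using hn)] at hlt
    linarith
  rw [List.getD_eq_getElem _ _ (by simpa using hn), List.getElem_ofFn] at hlt
  set g := Fintype.equivOfCardEq (Fintype.card_fin (Fintype.card n)) with hg
  set i := g ⟨0, by omega⟩ with hi
  set j := g ⟨1, hn⟩ with hj
  have hij : i ≠ j := fun h => by
    have := g.injective h
    simp at this
  have hμj : κ < hBH.eigenvalues j := by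
    rw [IsHermitian.eigenvalues, hj, Equiv.symm_apply_apply]
    exact hlt
  have hμi : κ < hBH.eigenvalues i := by
    rw [IsHermitian.eigenvalues, hi, Equiv.symm_apply_apply]
    exact hlt.trans_le (hBH.eigenvalues₀_antitone (Fin.mk_le_mk.2 zero_le_one))
  set u := fun a => (hBH.eigenvectorBasis a).ofLp with hu
  have hdot : ∀ a b, u a ⬝ᵥ u b = if a = b then 1 else 0 := by
    intro a b
    have h1 := orthonormal_iff_ite.1 hBH.eigenvectorBasis.orthonormal b a
    rw [EuclideanSpace.inner_eq_star_dotProduct, star_trivial] at h1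
    rw [hu, h1]
    simp [eq_comm]
  -- a combination of two eigenvectors in the hyperplane
  obtain ⟨a, b, hab, hab0⟩ : ∃ a b : ℝ,
      a * (l ⬝ᵥ u i) + b * (l ⬝ᵥ u j) = 0 ∧ 0 < a ^ 2 + b ^ 2 := by
    by_cases h0 : l ⬝ᵥ u i = 0
    · exact ⟨1, 0, by rw [h0]; ring, by norm_num⟩
    · exact ⟨-(l ⬝ᵥ u j), l ⬝ᵥ u i, by ring, by positivity⟩
  set z : n → ℝ := a • u i + b • u j with hz
  have h1 := h z (by
    change l ⬝ᵥ z = 0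
    rw [hz, dotProduct_add, dotProduct_smul, dotProduct_smul, smul_eq_mul, smul_eq_mul, hab])
  have h2 : ∑ x, z x ^ 2 = a ^ 2 + b ^ 2 := by
    have : ∑ x, z x ^ 2 = z ⬝ᵥ z := sum_congr rfl fun x _ => sq (z x)
    rw [this, hz]
    simp only [add_dotProduct, dotProduct_add, smul_dotProduct, dotProduct_smul, hdot, hij,
      hij.symm, if_true, if_false, smul_eq_mul]
    ring
  have h3 : ∑ x, ∑ y, (w x * z x) * T x y * (w y * z y) = z ⬝ᵥ B *ᵥ z := by
    rw [dotProduct]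
    refine sum_congr rfl fun x _ => ?_
    rw [mulVec, dotProduct, mul_sum]
    refine sum_congr rfl fun y _ => ?_
    rw [hB, mul_diagonal, diagonal_mul]
    ring
  have h4 : z ⬝ᵥ B *ᵥ z = a ^ 2 * hBH.eigenvalues i + b ^ 2 * hBH.eigenvalues j := by
    have h5 : ∀ a, B *ᵥ u a = hBH.eigenvalues a • u a := hBH.mulVec_eigenvectorBasis
    rw [hz, mulVec_add, mulVec_smul, mulVec_smul, h5, h5]
    simp only [add_dotProduct, dotProduct_add, smul_dotProduct, dotProduct_smul, hdot, hij,
      hij.symm, if_true, if_false, smul_eq_mul]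
    ring
  rw [h2, h3, h4] at h1
  rcases eq_or_ne a 0 with ha | ha
  · have hb : 0 < b ^ 2 := by simpa [ha] using hab0
    have := mul_lt_mul_of_pos_left hμj hb
    rw [ha] at h1
    linarith
  · have ha2 : 0 < a ^ 2 := by positivity
    have h6 := mul_lt_mul_of_pos_left hμi ha2
    have h7 := mul_le_mul_of_nonneg_left hμj.le (sq_nonneg b)
    linarith

variable {E K : Type*} [Fintype E] [DecidableEq E] [Fintype K] [DecidableEq K]
  {Ω : Finset (E → K)} {U : Finset E} {ω : E → K}

open scoped Classical in
/-- The probability that two distinct site-color pairs occur together, set to `0` unless both occur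
with positive probability at resampled sites. -/
noncomputable def pairProb (Ω : Finset (E → K)) (U : Finset E) (ω : E → K) (x y : E × K) : ℝ :=
  if x ≠ y ∧ wt Ω U ω x ≠ 0 ∧ wt Ω U ω y ≠ 0 then avg Ω U ω (fun σ => ind x σ * ind y σ) else 0

theorem pairProb_comm (x y : E × K) : pairProb Ω U ω x y = pairProb Ω U ω y x := by
  rw [pairProb, pairProb]
  simp only [mul_comm, ne_comm, and_comm]

theorem marg_mul_eq_wt_mul {v : E × K → ℝ} (hv : ∀ x, wt Ω U ω x = 0 → v x = 0) (x : E × K) :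
    marg Ω U ω x * v x = wt Ω U ω x * v x := by
  by_cases hx : x.1 ∈ U
  · rw [wt, if_pos hx]
  · rw [hv x (by rw [wt, if_neg hx]), mul_zero, mul_zero]

/-- For a centered statistic, the spectral gap bounds the off-diagonal part of the quadratic form of
pair probabilities. -/
theorem sum_pairProb_le {M : ℝ} (h : ∀ v : E × K → ℝ, var Ω U ω (lin v)
      ≤ (1 + M) * ∑ e ∈ U, avg Ω U ω (fun σ => v (e, σ e) ^ 2)) {v : E × K → ℝ}
    (hv : ∀ x, wt Ω U ω x = 0 → v x = 0) (hmean : ∑ x, marg Ω U ω x * v x = 0) :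
    ∑ x, ∑ y, v x * pairProb Ω U ω x y * v y ≤ M * ∑ x, wt Ω U ω x * v x ^ 2 := by
  have h1 := h v
  rw [← sum_wt_mul (fun x => v x ^ 2)] at h1
  have h2 : avg Ω U ω (lin v) = 0 := by
    rw [show lin v = fun σ => ∑ y, v y * ind y σ from funext fun σ => lin_eq_sum_ind v σ, avg_sum,
      ← hmean]
    exact sum_congr rfl fun x _ => by rw [avg_const_mul, marg, mul_comm]
  have h3 : (fun σ => lin v σ ^ 2) = fun σ => ∑ x, ∑ y, v x * v y * (ind x σ * ind y σ) := by
    ext σ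
    rw [sq, lin_eq_sum_ind, sum_mul_sum]
    exact sum_congr rfl fun x _ => sum_congr rfl fun y _ => by ring
  have h4 : ∀ x y, avg Ω U ω (fun σ => v x * v y * (ind x σ * ind y σ))
      = v x * pairProb Ω U ω x y * v y + if x = y then wt Ω U ω x * v x ^ 2 else 0 := by
    intro x y
    rw [avg_const_mul]
    by_cases hx : wt Ω U ω x = 0
    · simp [hv x hx]
    by_cases hy : wt Ω U ω y = 0
    · have hxy : x ≠ y := fun hxy => hx (hxy ▸ hy)
      simp [hv y hy, hxy]
    by_cases hxy : x = y
    · subst hxy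
      have h5 : (fun σ : E → K => ind x σ * ind x σ) = ind x := by
        ext σ
        rw [ind]
        split_ifs <;> norm_num
      rw [h5, pairProb, if_neg fun h => h.1 rfl, if_pos rfl, ← marg]
      linear_combination v x * marg_mul_eq_wt_mul hv x
    · rw [pairProb, if_pos ⟨hxy, hx, hy⟩, if_neg hxy]
      ring
  rw [var, h2, h3, avg_sum] at h1
  have h6 : ∑ x, avg Ω U ω (fun σ => ∑ y, v x * v y * (ind x σ * ind y σ))
      = ∑ x, ∑ y, v x * pairProb Ω U ω x y * v y + ∑ x, wt Ω U ω x * v x ^ 2 := by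
    rw [← sum_add_distrib]
    refine sum_congr rfl fun x _ => ?_
    rw [avg_sum, sum_congr rfl fun y _ => h4 x y, sum_add_distrib]
    simp
  rw [h6] at h1
  linarith

/-- The second eigenvalue of a matrix of conditional pair probabilities. -/
theorem lambda2_le_of_var_lin_le {M : ℝ} (hM : 0 ≤ M)
    (h : ∀ v : E × K → ℝ, var Ω U ω (lin v)
      ≤ (1 + M) * ∑ e ∈ U, avg Ω U ω (fun σ => v (e, σ e) ^ 2))
    {s : Finset (E × K)} {k : ℝ} (hk : 0 < k) {A : Matrix s s ℝ}
    (hA : ∀ x y, A x y = pairProb Ω U ω x.1 y.1 / (k * wt Ω U ω x.1)) : lambda2 A ≤ M / k := by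
  set w : E × K → ℝ := fun x => (Real.sqrt (wt Ω U ω x))⁻¹ with hw
  have hw2 : ∀ x, w x ^ 2 = (wt Ω U ω x)⁻¹ := fun x => by
    rw [hw, inv_pow, Real.sq_sqrt (wt_nonneg x)]
  refine lambda2_le (T := of fun x y : s => pairProb Ω U ω x.1 y.1 / k) (w := fun x => w x.1)
    (l := fun x => marg Ω U ω x.1 * w x.1) (div_nonneg hM hk.le) ?_ ?_ ?_
  · ext x y
    rw [transpose_apply, of_apply, of_apply, pairProb_comm]
  · intro x y
    rw [hA, of_apply, hw2, div_mul_eq_div_div, div_eq_mul_inv _ (wt Ω U ω x.1), mul_comm]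
  intro z hz
  set v : E × K → ℝ := fun x => if hx : x ∈ s then w x * z ⟨x, hx⟩ else 0 with hv
  have hvs : ∀ x : s, v x.1 = w x.1 * z x := fun x => dif_pos x.2
  have hvs0 : ∀ x, x ∉ s → v x = 0 := fun x hx => dif_neg hx
  have hv0 : ∀ x, wt Ω U ω x = 0 → v x = 0 := by
    intro x hx
    simp only [hv, hw, hx, Real.sqrt_zero, _root_.inv_zero, zero_mul, dite_eq_ite, ite_self]
  -- sums over `s` of terms that vanish where `v` does
  have hsum : ∀ F : E × K → ℝ, (∀ x, v x = 0 → F x = 0) → ∑ x : s, F x.1 = ∑ x, F x := by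
    intro F hF
    rw [sum_coe_sort s F]
    exact sum_subset (subset_univ s) fun x _ hx => hF x (hvs0 x hx)
  have hmean : ∑ x, marg Ω U ω x * v x = 0 := by
    rw [← hsum _ fun x hx => by rw [hx, mul_zero], ← hz]
    exact sum_congr rfl fun x _ => by rw [hvs, mul_assoc]
  have h1 := sum_pairProb_le h hv0 hmean
  have h2 : ∑ x : s, ∑ y : s, (w x.1 * z x) * (of fun x y : s => pairProb Ω U ω x.1 y.1 / k) x y
      * (w y.1 * z y) = (∑ x, ∑ y, v x * pairProb Ω U ω x y * v y) / k := by
    rw [← hsum _ fun x hx => sum_eq_zero fun y _ => by rw [hx, zero_mul, zero_mul], sum_div]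
    refine sum_congr rfl fun x _ => ?_
    rw [← hsum _ fun y hy => by rw [hy, mul_zero], sum_div]
    refine sum_congr rfl fun y _ => ?_
    rw [hvs, hvs, of_apply]
    ring
  have h3 : ∑ x, wt Ω U ω x * v x ^ 2 ≤ ∑ x, z x ^ 2 := by
    rw [← hsum _ fun x hx => by rw [hx, zero_pow two_ne_zero, mul_zero]]
    refine sum_le_sum fun x _ => ?_
    rw [hvs, mul_pow, hw2, ← mul_assoc]
    by_cases hx : wt Ω U ω x.1 = 0
    · rw [hx, zero_mul, zero_mul]
      exact sq_nonneg _
    · rw [mul_inv_cancel₀ hx, one_mul]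
  rw [h2, div_mul_eq_mul_div]
  exact div_le_div_of_nonneg_right (h1.trans (mul_le_mul_of_nonneg_left h3 hM)) hk.le

end SecondEigenvalue

/-! ### Local walks of the complex of edge-list-colorings -/

section LocalWalk

variable {V : Type*} [Fintype V] [DecidableEq V] {G : SimpleGraph V} [DecidableRel G.Adj] {q : ℕ}
  {L : G.edgeSet → Finset (Fin q)} [DecidableRel G.lineGraph.Adj]
  {c : G.edgeSet → Fin q} {τ : Finset (G.edgeSet × Fin q)}

theorem mem_coloringFacet {x : G.edgeSet × Fin q} : x ∈ coloringFacet G c ↔ c x.1 = x.2 := by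
  simp only [coloringFacet, mem_image, mem_univ, true_and]
  constructor
  · rintro ⟨e, rfl⟩
    rfl
  · intro h
    exact ⟨x.1, Prod.ext rfl h⟩

theorem coloringFacet_injective :
    Function.Injective (coloringFacet G : (G.edgeSet → Fin q) → Finset (G.edgeSet × Fin q)) := by
  intro c c' h
  ext1 e
  have h1 : (e, c e) ∈ coloringFacet G c := mem_coloringFacet.2 rfl
  rw [h] at h1
  exact (mem_coloringFacet.1 h1).symm

theorem coloringFacets_eq :
    coloringFacets G L = (colorings G.lineGraph L).image (coloringFacet G) := by
  rw [coloringFacets]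
  congr 1
  ext c
  simp [mem_colorings, IsProperListColoring]

/-- The edges that the face `τ` leaves uncolored. -/
def freeEdges (τ : Finset (G.edgeSet × Fin q)) : Finset G.edgeSet := (τ.image Prod.fst)ᶜ

theorem mem_fiber_freeEdges (hτ : τ ⊆ coloringFacet G c) {σ : G.edgeSet → Fin q} :
    σ ∈ fiber (colorings G.lineGraph L) (freeEdges τ) c
      ↔ σ ∈ colorings G.lineGraph L ∧ τ ⊆ coloringFacet G σ := by
  rw [mem_fiber]
  refine and_congr_right fun _ => ?_
  simp only [freeEdges, mem_compl, not_not, mem_image]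
  constructor
  · intro h x hx
    rw [mem_coloringFacet, h x.1 ⟨x, hx, rfl⟩]
    exact mem_coloringFacet.1 (hτ hx)
  · rintro h e ⟨x, hx, rfl⟩
    rw [mem_coloringFacet.1 (h hx), mem_coloringFacet.1 (hτ hx)]

theorem card_freeEdges (hτ : τ ⊆ coloringFacet G c) :
    (freeEdges τ).card = (coloringComplex G L).codim τ := by
  rw [freeEdges, card_compl, WeightedComplex.codim, card_image_of_injOn]
  · rfl
  · intro x hx y hy hxy
    have h1 := mem_coloringFacet.1 (hτ hx)
    have h2 := mem_coloringFacet.1 (hτ hy)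
    exact Prod.ext hxy (by rw [← h1, ← h2, hxy])

theorem probContains_eq (η : Finset (G.edgeSet × Fin q)) :
    (coloringComplex G L).probContains η
      = (({σ ∈ colorings G.lineGraph L | η ⊆ coloringFacet G σ}.card : ℕ) : ℝ)
        / ((coloringFacets G L).card : ℝ) := by
  rw [WeightedComplex.probContains]
  change ∑ σ ∈ coloringFacets G L with η ⊆ σ, 1 / ((coloringFacets G L).card : ℝ) = _
  rw [sum_const, nsmul_eq_mul, mul_one_div]
  congr 2
  rw [coloringFacets_eq, filter_image, card_image_of_injective _ coloringFacet_injective]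

/-- Conditioning on the face `τ` amounts to resampling the edges that `τ` leaves uncolored. -/
theorem linkDist_eq (hc : c ∈ colorings G.lineGraph L) (hτ : τ ⊆ coloringFacet G c)
    (η : Finset (G.edgeSet × Fin q)) : (coloringComplex G L).linkDist τ η
      = 1 / (((freeEdges τ).card.choose η.card : ℕ) : ℝ)
        * avg (colorings G.lineGraph L) (freeEdges τ) c (fun σ => ∏ x ∈ η, ind x σ) := by
  have h1 : {σ ∈ colorings G.lineGraph L | τ ⊆ coloringFacet G σ}
      = fiber (colorings G.lineGraph L) (freeEdges τ) c := by
    ext σ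
    rw [mem_fiber_freeEdges hτ, mem_filter]
  have h2 : {σ ∈ colorings G.lineGraph L | η ∪ τ ⊆ coloringFacet G σ}
      = {σ ∈ fiber (colorings G.lineGraph L) (freeEdges τ) c | ∀ x ∈ η, σ x.1 = x.2} := by
    ext σ
    simp only [mem_filter, mem_fiber_freeEdges hτ, union_subset_iff, and_assoc]
    refine and_congr_right fun _ => ?_
    rw [and_comm]
    refine and_congr_right fun _ => ?_
    exact forall₂_congr fun x _ => mem_coloringFacet
  have h3 : ((coloringFacets G L).card : ℝ) ≠ 0 := by
    have : 0 < (coloringFacets G L).card := by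
      rw [coloringFacets_eq]
      exact card_pos.2 ⟨_, mem_image_of_mem _ hc⟩
    positivity
  have h4 : avg (colorings G.lineGraph L) (freeEdges τ) c (fun σ => ∏ x ∈ η, ind x σ)
      = (({σ ∈ fiber (colorings G.lineGraph L) (freeEdges τ) c | ∀ x ∈ η, σ x.1 = x.2}.card : ℕ)
        : ℝ) / ((fiber (colorings G.lineGraph L) (freeEdges τ) c).card : ℝ) := by
    rw [avg, expect_eq_sum_div_card]
    congr 1
    rw [card_filter, Nat.cast_sum]
    refine sum_congr rfl fun σ _ => ?_
    simp only [ind, prod_ite_zero, prod_const_one]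
    split_ifs <;> simp
  rw [WeightedComplex.linkDist, ← card_freeEdges hτ, probContains_eq, probContains_eq, h1, h2, h4,
    div_div_div_cancel_right₀ h3]

theorem singleton_mem_link_iff (hτ : τ ⊆ coloringFacet G c)
    (x : G.edgeSet × Fin q) : {x} ∈ (coloringComplex G L).link τ
      ↔ wt (colorings G.lineGraph L) (freeEdges τ) c x ≠ 0 := by
  have hface : ∀ η, (coloringComplex G L).IsFace η
      ↔ ∃ σ ∈ colorings G.lineGraph L, η ⊆ coloringFacet G σ := by
    intro η
    change (∃ σ ∈ coloringFacets G L, η ⊆ σ) ↔ _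
    rw [coloringFacets_eq]
    simp
  constructor
  · rintro ⟨ρ, hρ, hτρ, hx⟩
    obtain ⟨σ, hσ, hρσ⟩ := (hface ρ).1 hρ
    have hσ' : σ ∈ fiber (colorings G.lineGraph L) (freeEdges τ) c :=
      (mem_fiber_freeEdges hτ).2 ⟨hσ, hτρ.trans hρσ⟩
    obtain ⟨hxρ, hxτ⟩ := mem_sdiff.1 (hx ▸ mem_singleton_self x)
    have hσx := mem_coloringFacet.1 (hρσ hxρ)
    have hxU : x.1 ∈ freeEdges τ := by
      rw [freeEdges, mem_compl, mem_image]
      rintro ⟨y, hy, hyx⟩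
      have h1 := mem_coloringFacet.1 (hρσ (hτρ hy))
      rw [hyx, hσx] at h1
      exact hxτ (Prod.ext hyx.symm h1 ▸ hy)
    rw [wt, if_pos hxU]
    have := marg_pos hσ' x.1
    rw [hσx] at this
    exact this.ne'
  · intro h
    have hxU : x.1 ∈ freeEdges τ := by
      by_contra hx
      exact h (by rw [wt, if_neg hx])
    rw [wt, if_pos hxU, marg_eq_card_div] at h
    obtain ⟨σ, hσ⟩ :
        ({σ ∈ fiber (colorings G.lineGraph L) (freeEdges τ) c | σ x.1 = x.2}).Nonempty := by
      rw [nonempty_iff_ne_empty]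
      intro h0
      rw [h0] at h
      simp at h
    obtain ⟨hσ, hσx⟩ := mem_filter.1 hσ
    obtain ⟨hσΩ, hστ⟩ := (mem_fiber_freeEdges hτ).1 hσ
    have hxτ : x ∉ τ := fun hx => mem_compl.1 hxU (mem_image_of_mem _ hx)
    refine ⟨insert x τ, (hface _).2 ⟨σ, hσΩ, insert_subset (mem_coloringFacet.2 hσx) hστ⟩,
      subset_insert x τ, ?_⟩
    rw [insert_sdiff_of_notMem _ hxτ, sdiff_self]
    rfl

theorem localWalk_apply (hc : c ∈ colorings G.lineGraph L) (hτ : τ ⊆ coloringFacet G c)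
    (hk : 2 ≤ (freeEdges τ).card) (x y : (coloringComplex G L).vertices) :
    (coloringComplex G L).localWalk τ x y
      = pairProb (colorings G.lineGraph L) (freeEdges τ) c x.1 y.1
        / ((((freeEdges τ).card : ℝ) - 1)
          * wt (colorings G.lineGraph L) (freeEdges τ) c x.1) := by
  have hk' : (2 : ℝ) ≤ ((freeEdges τ).card : ℝ) := by exact_mod_cast hk
  rw [WeightedComplex.localWalk, pairProb]
  simp only [singleton_mem_link_iff hτ, ne_eq, Subtype.coe_inj]
  split_ifs with h
  · have hxy : x.1 ≠ y.1 := fun h' => h.1 (Subtype.ext h')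
    have hw : wt (colorings G.lineGraph L) (freeEdges τ) c x.1
        = avg (colorings G.lineGraph L) (freeEdges τ) c (ind x.1) := by
      rw [wt, if_pos, marg]
      by_contra hx
      exact h.2.1 (by rw [wt, if_neg hx])
    have h1 := h.2.1
    rw [linkDist_eq hc hτ, linkDist_eq hc hτ, card_pair hxy, card_singleton, Nat.cast_choose_two,
      Nat.choose_one_right]
    simp only [prod_pair hxy, prod_singleton]
    rw [hw] at h1 ⊢
    have h2 : ((freeEdges τ).card : ℝ) - 1 ≠ 0 := by linarith
    have h3 : ((freeEdges τ).card : ℝ) ≠ 0 := by linarith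
    change _ / (2 * (_ * avg (colorings G.lineGraph L) (freeEdges τ) c (ind x.1))) = _
    field_simp
  · rw [zero_div]

end LocalWalk

end ListColoring

theorem mainTheorem6 {V : Type*} [Fintype V] [DecidableEq V] (G : SimpleGraph V)
    [DecidableRel G.Adj] {q : ℕ} (L : G.edgeSet → Finset (Fin q)) (ε : ℝ) (hε : 0 < ε)
    (hε' : ε ≤ 1 / 10)
    (hL : IsExtraColor G L ((4 / 3 + 4 * ε) * (G.maxDegree : ℝ)))
    (hΔ : Real.log (G.maxDegree : ℝ) ^ 2 / (G.maxDegree : ℝ) ≤ ε ^ 3 / 15)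
    (k : ℕ) (hk : 2 ≤ k) (τ : Finset (G.edgeSet × Fin q))
    (hτ : (coloringComplex G L).IsFace τ) (hcodim : (coloringComplex G L).codim τ = k) :
    lambda2 ((coloringComplex G L).localWalk τ) ≤ (ε + 1 / ε) / ((k : ℝ) - 1) := by
  classical
  obtain ⟨σ, hσ, hτσ⟩ := hτ
  obtain ⟨c, hc, rfl⟩ : ∃ c ∈ ListColoring.colorings G.lineGraph L, coloringFacet G c = σ := by
    rw [← Finset.mem_image, ← ListColoring.coloringFacets_eq]
    exact hσ
  have hU : (ListColoring.freeEdges τ).card = k := by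
    rw [← hcodim]
    exact ListColoring.card_freeEdges hτσ
  have hk' : (2 : ℝ) ≤ k := by exact_mod_cast hk
  have h := ListColoring.lambda2_le_of_var_lin_le (A := (coloringComplex G L).localWalk τ)
    (k := (k : ℝ) - 1) (M := 1 / ε) (by positivity)
    (ListColoring.var_lin_edgeColorings_le hε hε' hL hΔ (ListColoring.freeEdges τ) hc)
    (by linarith) (fun x y => by rw [ListColoring.localWalk_apply hc hτσ (by omega), hU])
  exact h.trans (div_le_div_of_nonneg_right (by linarith) (by linarith))
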